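/- Let $d\ge 2$, $s\in(\frac12,\frac d2)$, and let $\sigma$ be the induced Lebesgue measure on the unit sphere $\mathbb S^{d-1}\subset\mathbb R^d$. Let $\mathcal H_k\subset L^2(\mathbb S^{d-1})$ be the space of complex spherical harmonics of degree $k$ and $H_k$ the orthogonal projection of $L^2(\mathbb S^{d-1})$ onto $\mathcal H_k$. For $\theta:[0,\infty)\to\mathbb C$ put $$\theta(-\Lambda)=\sum_{k\ge 0}\theta(k(k+d-2))H_k$$ on functions on $\mathbb S^{d-1}$, and on functions $f$ on $\mathbb R^d$ by letting it act on $f(r\,\cdot)$ for (almost) every radius $r>0$. Let $\widehat f(\xi)=\int_{\mathbb R^d} f(x)e^{-ix\cdot\xi}\,dx$, $D=\sqrt{-\Delta}$ (so $\widehat{Df}=|\xi|\widehat f$), $\|f\|_{\dot H^s}^2=\|D^sf\|_{L^2}^2=(2\pi)^{-d}\int|\xi|^{2s}|\widehat f(\xi)|^2\,d\xi$, let $\mathcal R$ denote restriction to $\mathbb S^{d-1}$ in the sense of traces (that is, $\mathcal RF=h$ means that $F(r\,\cdot)\to h$ in $L^2(\mathbb S^{d-1})$ as $r\to1$ outside a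 null set of radii), and let $$S_\theta^*G=\big(|\cdot|^{-s}\,\theta(-\Lambda)\widehat{G\,d\sigma}\big)^\vee,\qquad \lambda_k(\theta)=2^{1-2s}\frac{\Gamma(2s-1)\,\Gamma(k+\frac d2-s)}{\Gamma(s)^2\,\Gamma(k+\frac d2-1+s)}\,|\theta(k(k+d-2))|^2,$$ $$\mathbf K=\{k\in\mathbb N_0:\lambda_k(\theta)=\sup_{\ell}\lambda_\ell(\theta)\}.$$ Suppose that $\sup_k\lambda_k(\theta)<\infty$. Then $\mathcal R\,\overline\theta(-\Lambda)$ is well defined on $\dot H^s(\mathbb R^d)$, the function $D^{-s}S_\theta^*G$ is defined for every $G\in L^2(\mathbb S^{d-1})$, and for all $f\in\dot H^s(\mathbb R^d)$ $$\|\mathcal R\,\overline\theta(-\Lambda)f\|_{L^2(\mathbb S^{d-1})}^2\le \sup_{k}\lambda_k(\theta)\,\|f\|_{\dot H^s(\mathbb R^d)}^2,$$ where the constant is optimal. If moreover $\theta(k(k+d-2))\ne0$ for at least one $k\in\mathbb N_0$, then the extremisers (the nonzero $f\in\dot H^s(\mathbb R^d)$ for which equality holds) are precisely the nonzero elements of $D^{-s}S_\theta^*\big(\bigoplus_{k\in\mathbf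 K}\mathcal H_k\big)$, where $\bigoplus$ is the closed direct sum in $L^2(\mathbb S^{d-1})$; in particular there are none if $\mathbf K=\emptyset$. -/

import Mathlib

open MeasureTheory Filter Topology
open scoped SchwartzMap

namespace SphereTrace

noncomputable section

/-- Euclidean space `ℝᵈ`. -/
abbrev Eu (d : ℕ) : Type := EuclideanSpace ℝ (Fin d)

/-- The unit sphere of `ℝᵈ`. -/
abbrev Sph (d : ℕ) : Type := Metric.sphere (0 : Eu d) 1

/-- The induced Lebesgue (surface) measure on the unit sphere. -/
abbrev surf (d : ℕ) : Measure (Sph d) := (volume : Measure (Eu d)).toSphere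

/-- The Hilbert space of square integrable complex functions on the unit sphere. -/
abbrev L2S (d : ℕ) : Type := Lp ℂ 2 (surf d)

/-! ### Spherical harmonics -/

/-- The Laplacian `∑ᵢ ∂ᵢ²` on complex polynomials in `d` variables. -/
def polyLaplacian (d : ℕ) : MvPolynomial (Fin d) ℂ →ₗ[ℂ] MvPolynomial (Fin d) ℂ :=
  ∑ i, (MvPolynomial.pderiv i).toLinearMap ∘ₗ (MvPolynomial.pderiv i).toLinearMap

/-- Restriction of a polynomial to the unit sphere, as a continuous function. -/
def restrictPoly (d : ℕ) : MvPolynomial (Fin d) ℂ →ₗ[ℂ] C(Sph d, ℂ) where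
  toFun p :=
    { toFun := fun ω => MvPolynomial.eval (fun i => (((ω : Eu d) i : ℝ) : ℂ)) p
      continuous_toFun := by
        refine (MvPolynomial.continuous_eval p).comp ?_
        fun_prop }
  map_add' p q := by ext ω; simp
  map_smul' c p := by ext ω; simp [MvPolynomial.smul_eval]

/-- The homogeneous harmonic polynomials of degree `k`. -/
def harmonicPoly (d k : ℕ) : Submodule ℂ (MvPolynomial (Fin d) ℂ) :=
  MvPolynomial.homogeneousSubmodule (Fin d) ℂ k ⊓ LinearMap.ker (polyLaplacian d)

/-- `ℋ_k`, the space of spherical harmonics of degree `k`: the restrictions to the sphere of the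
homogeneous harmonic polynomials of degree `k`. -/
def sphHarm (d k : ℕ) : Submodule ℂ (L2S d) :=
  (harmonicPoly d k).map
    ((ContinuousMap.toLp 2 (surf d) ℂ : C(Sph d, ℂ) →L[ℂ] L2S d).toLinearMap ∘ₗ restrictPoly d)

instance (d k : ℕ) : FiniteDimensional ℂ (harmonicPoly d k) := by
  have : FiniteDimensional ℂ (MvPolynomial.homogeneousSubmodule (Fin d) ℂ k) :=
    Module.Finite.iff_fg.mpr (MvPolynomial.homogeneousSubmodule_fg (Fin d) ℂ k)
  exact Submodule.finiteDimensional_of_le inf_le_left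

instance (d k : ℕ) : FiniteDimensional ℂ (sphHarm d k) := by
  unfold sphHarm; infer_instance

/-- `H_k`, the orthogonal projection of `L²` of the sphere onto `ℋ_k`. -/
def projH (d k : ℕ) : L2S d →L[ℂ] L2S d := (sphHarm d k).starProjection

/-- The (closed, Hilbert space) direct sum `⨁_{k ∈ K} ℋ_k` inside `L²` of the sphere. -/
def sumHarm (d : ℕ) (K : Set ℕ) : Submodule ℂ (L2S d) :=
  (⨆ k ∈ K, sphHarm d k).topologicalClosure

/-! ### Functions of the Laplace-Beltrami operator -/

/-- The eigenvalue `k (k + d - 2)` of the operator `-Λ` on `ℋ_k`. -/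
def lbEigen (d k : ℕ) : ℝ := (k : ℝ) * ((k : ℝ) + (d : ℝ) - 2)

/-- `F = θ(-Λ) f` on the sphere: `F = ∑ₖ θ(k(k+d-2)) H_k f`, with convergence in `L²`. -/
def IsThetaSphere {d : ℕ} (θ : ℝ → ℂ) (f F : L2S d) : Prop :=
  HasSum (fun k : ℕ => θ (lbEigen d k) • projH d k f) F

/-- The function `ω ↦ f (r ω)` on the unit sphere. -/
def slice {d : ℕ} (f : Eu d → ℂ) (r : ℝ) (ω : Sph d) : ℂ := f (r • (ω : Eu d))

/-- `F = θ(-Λ) f` on `ℝᵈ`, where `θ(-Λ)` acts on functions on `ℝᵈ` in the angular variable: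
for almost every radius `r > 0` one has `F(r ·) = θ(-Λ) (f(r ·))` in `L²` of the sphere. -/
def IsTheta {d : ℕ} (θ : ℝ → ℂ) (f F : Eu d → ℂ) : Prop :=
  AEStronglyMeasurable F volume ∧
  ∀ᵐ r ∂(volume.restrict (Set.Ioi (0 : ℝ))),
    ∃ (hf : MemLp (slice f r) 2 (surf d)) (hF : MemLp (slice F r) 2 (surf d)),
      IsThetaSphere θ (hf.toLp (slice f r)) (hF.toLp (slice F r))

/-! ### Restriction to the sphere -/

/-- `h = ℛ F`: the function `F` on `ℝᵈ` has restriction (trace) `h` on the unit sphere, that is,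
`F(r ·) → h` in `L²` of the sphere as `r → 1`, with `r` outside of a null set of radii. For
continuous `F` this is the pointwise restriction; the notion does not change if `F` is modified
on a null set of `ℝᵈ`. -/
def IsTrace {d : ℕ} (F : Eu d → ℂ) (h : L2S d) : Prop :=
  Tendsto (fun r : ℝ => eLpNorm (fun ω => slice F r ω - h ω) 2 (surf d))
    (𝓝 1 ⊓ ae volume) (𝓝 0)

/-! ### Fourier transform and the homogeneous Sobolev space -/

/-- The Fourier transform `∫ f(x) exp(-i x·ξ) dx` of an integrable function. -/
def fourierInt {d : ℕ} (f : Eu d → ℂ) (ξ : Eu d) : ℂ :=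
  ∫ x, f x * Complex.exp (-(Complex.I * ((inner ℝ x ξ : ℝ) : ℂ)))

/-- Functions on `ℝᵈ` that define a tempered distribution by integration. -/
def IsTempered {d : ℕ} (f : Eu d → ℂ) : Prop :=
  ∀ φ : 𝓢(Eu d, ℂ), Integrable (fun x => f x * φ x)

/-- `F` is the Fourier transform of `f`, in the sense of tempered distributions. -/
def IsFourier {d : ℕ} (f F : Eu d → ℂ) : Prop :=
  IsTempered f ∧ IsTempered F ∧
    ∀ φ : 𝓢(Eu d, ℂ), ∫ ξ, F ξ * φ ξ = ∫ x, f x * fourierInt (fun y => φ y) x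

open Classical in
/-- The Fourier transform of a tempered function `f` for which it is a function (it is then unique
almost everywhere). -/
def fourierT {d : ℕ} (f : Eu d → ℂ) : Eu d → ℂ :=
  if h : ∃ F, IsFourier f F then h.choose else 0

/-- Membership in the homogeneous Sobolev space of order `s` (for `s < d/2`): the Fourier transform
of `f` is a function, and `|ξ|^s f̂(ξ)` is square integrable. -/
def MemHdot {d : ℕ} (s : ℝ) (f : Eu d → ℂ) : Prop :=
  (∃ F, IsFourier f F) ∧ MemLp (fun ξ => ((‖ξ‖ ^ s : ℝ) : ℂ) * fourierT f ξ) 2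

/-- The square of the homogeneous Sobolev norm, `‖D^s f‖² = (2π)^{-d} ∫ |ξ|^{2s} |f̂(ξ)|² dξ`. -/
def hdotNormSq {d : ℕ} (s : ℝ) (f : Eu d → ℂ) : ℝ :=
  ((2 * Real.pi) ^ d)⁻¹ * ∫ ξ, ‖ξ‖ ^ (2 * s) * ‖fourierT f ξ‖ ^ 2

/-- `f = D^{-s} g`, where `D = √(-Δ)`. -/
def IsDNeg {d : ℕ} (s : ℝ) (g f : Eu d → ℂ) : Prop :=
  ∃ G, IsFourier g G ∧ IsFourier f (fun ξ => ((‖ξ‖ ^ (-s) : ℝ) : ℂ) * G ξ)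

/-! ### The operators of the trace estimate -/

/-- The Fourier transform of the measure `G dσ`. -/
def extension {d : ℕ} (G : L2S d) (ξ : Eu d) : ℂ :=
  ∫ ω, G ω * Complex.exp (-(Complex.I * ((inner ℝ (ω : Eu d) ξ : ℝ) : ℂ))) ∂(surf d)

/-- `h = ℛ (conj θ)(-Λ) f`. -/
def IsTraceTheta {d : ℕ} (θ : ℝ → ℂ) (f : Eu d → ℂ) (h : L2S d) : Prop :=
  ∃ F, IsTheta (fun t => starRingEnd ℂ (θ t)) f F ∧ IsTrace F h

/-- `g = S_θ^* G`: the function `g` is square integrable with Fourier transform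
`|ξ|^{-s} θ(-Λ) (G dσ)^`. -/
def IsSThetaStar {d : ℕ} (s : ℝ) (θ : ℝ → ℂ) (G : L2S d) (g : Eu d → ℂ) : Prop :=
  MemLp g 2 ∧ ∃ Φ, IsTheta θ (extension G) Φ ∧
    IsFourier g (fun ξ => ((‖ξ‖ ^ (-s) : ℝ) : ℂ) * Φ ξ)

/-- The numbers `λ_k(θ)`. -/
def lam (d : ℕ) (s : ℝ) (θ : ℝ → ℂ) (k : ℕ) : ℝ :=
  (2 : ℝ) ^ (1 - 2 * s) *
    (Real.Gamma (2 * s - 1) * Real.Gamma ((k : ℝ) + (d : ℝ) / 2 - s) /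
      (Real.Gamma s ^ 2 * Real.Gamma ((k : ℝ) + (d : ℝ) / 2 - 1 + s))) *
    ‖θ (lbEigen d k)‖ ^ 2

/-- The set of all `k` at which `λ_k(θ)` attains its supremum. -/
def argSup (d : ℕ) (s : ℝ) (θ : ℝ → ℂ) : Set ℕ := {k | lam d s θ k = ⨆ l, lam d s θ l}

/-- `f` is an extremiser: a nonzero element of the homogeneous Sobolev space for which equality
holds in the trace estimate with constant `sup λ_k(θ)`. -/
def IsExtremiser {d : ℕ} (s : ℝ) (θ : ℝ → ℂ) (f : Eu d → ℂ) : Prop :=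
  MemHdot s f ∧ ¬ f =ᵐ[volume] 0 ∧
    ∃ h : L2S d, IsTraceTheta θ f h ∧ ‖h‖ ^ 2 = (⨆ k, lam d s θ k) * hdotNormSq s f

end

end SphereTrace

namespace SphereTrace

noncomputable section

/-! Write the Fourier transform of `f` as `|ξ|^{-s} h` with `h` in `L²`, so that `‖f‖² = (2π)^{-d}
‖h‖²`. Everything is read off from the operator `B G = |ξ|^{-s} θ(-Λ) (G dσ)^` from `L²` of the
sphere to `L²` of `ℝᵈ` (`IsSynth`) and from its special case `A`, where `θ = 1`.

Diagonalisation. By the Funk-Hecke formula (`integral_harmonic_mul_exp`) one has `(Y dσ)^(r η) =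
m_k(r) Y(η)` for `Y` in `ℋ_k`, and `∫ r^{d-1-2s} |m_k(r)|² dr = (2π)^d λ_k(1)`
(`lintegral_extMul_sq`). The spaces `ℋ_k` are orthogonal with dense sum (`hasSum_projH`), so polar
coordinates give `‖B G‖² = (2π)^d ∑ λ_k(θ) ‖H_k G‖²`. In other words, `B* B` is multiplication by
`(2π)^d λ_k(θ)` on `ℋ_k`.

Duality. Fourier inversion and scaling give `f(r ·) = (2π)^{-d} r^{s-d/2} A* h_r`, where `h_r` is
the unitary dilation of `h` (`exists_isFourier_weight`). Applying `(conj θ)(-Λ)` replaces `A*` by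
`B*` (`isThetaSphere_radialTrace`). Dilations are strongly continuous, so the trace exists and
equals `(2π)^{-d} B* h` (`isTraceTheta_iff`). The estimate is now `‖B*‖² = ‖B‖² ≤ (2π)^d sup
λ_k(θ)`, and the choices `h = A Y` with `Y` in `ℋ_k` show that the constant is optimal
(`lam_le_of_trace_le`).

Equality. Put `M = (2π)^d sup λ_k(θ)`. The identity `‖B* h‖² = M ‖h‖²` forces `B B* h = M h`
(`apply_adjoint_eq_smul`). Hence `h = B G` with `G = M⁻¹ B* h`, and `B* B G = M G` leaves in `G`
only the degrees at which `λ_k(θ)` is maximal. The converse is the same computation read backwards.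

The radial integral is found without Bessel functions. The weight `r^{-2s}` is a superposition of
Gaussians `exp(-r²/(2u))`. The Gaussian average of `|(p dσ)^|²` produces the Funk-Hecke multiplier
at the real point `u`, a power series with positive coefficients. Integrating it term by term in `u`
leaves a hypergeometric series at `1`, which Gauss's theorem sums (`tsum_ofReal_hypergeometric`).
The coefficients, and also the orthogonality and completeness of the `ℋ_k`, come from integration by
parts against the Gaussian (`gaussInt_X_mul`). -/

/-! ### Polar coordinates, and functions assembled from their spherical slices. -/

/-- The radial measure `r ^ (d - 1) dr` on `(0, ∞)`. -/
def radial (d : ℕ) : Measure ℝ :=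
  (volume.restrict (Set.Ioi (0 : ℝ))).withDensity fun r => ENNReal.ofReal (r ^ (d - 1))

lemma measurable_radial_density (d : ℕ) : Measurable fun r : ℝ => ENNReal.ofReal (r ^ (d - 1)) := by
  fun_prop

instance (d : ℕ) : SFinite (radial d) := by unfold radial; infer_instance

/-- The density `r ^ (d - 1)` is positive on `(0, ∞)`, so it does not change the null sets. -/
lemma ae_radial_iff {d : ℕ} {p : ℝ → Prop} :
    (∀ᵐ r ∂(radial d), p r) ↔ ∀ᵐ r ∂(volume.restrict (Set.Ioi (0 : ℝ))), p r := by
  rw [radial, ae_withDensity_iff (measurable_radial_density d),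
    ae_restrict_iff' measurableSet_Ioi, ae_restrict_iff' measurableSet_Ioi]
  refine eventually_congr (Eventually.of_forall fun r => ?_)
  refine forall_congr' fun hr => ?_
  have : ENNReal.ofReal (r ^ (d - 1)) ≠ 0 := by
    have : 0 < r ^ (d - 1) := pow_pos hr _
    simpa using this
  simp [this]

lemma map_val_volumeIoiPow (n : ℕ) :
    (Measure.volumeIoiPow n).map Subtype.val =
      (volume.restrict (Set.Ioi (0 : ℝ))).withDensity fun r => ENNReal.ofReal (r ^ n) := by
  ext s hs
  rw [Measure.map_apply measurable_subtype_coe hs, Measure.volumeIoiPow,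
    withDensity_apply _ (measurable_subtype_coe hs), withDensity_apply _ hs,
    ← lintegral_indicator (measurable_subtype_coe hs), ← lintegral_indicator hs]
  have := lintegral_subtype_comap (μ := (volume : Measure ℝ)) (s := Set.Ioi (0 : ℝ))
    measurableSet_Ioi (fun r => s.indicator (fun r => ENNReal.ofReal (r ^ n)) r)
  rw [← this]
  rfl

/-- Polar coordinates on `ℝᵈ`. -/
lemma measurePreserving_polar (d : ℕ) (hd : 2 ≤ d) :
    MeasurePreserving (fun p : ℝ × Sph d => p.1 • (p.2 : Eu d)) ((radial d).prod (surf d))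
      volume := by
  have hfin : Module.finrank ℝ (Eu d) = d := by simp
  have : Nontrivial (Eu d) := Module.nontrivial_of_finrank_pos (R := ℝ) (by omega)
  refine ⟨by fun_prop, ?_⟩
  have h1 := (volume : Measure (Eu d)).measurePreserving_homeomorphUnitSphereProd
  have h2 := (h1.symm (homeomorphUnitSphereProd (Eu d)).toMeasurableEquiv).map_eq
  -- The origin is a null set, so the punctured space carries the whole volume.
  have h3 : (Measure.comap Subtype.val (volume : Measure (Eu d)) :
      Measure ({0}ᶜ : Set (Eu d))).map Subtype.val = volume := by
    rw [map_comap_subtype_coe (measurableSet_singleton _).compl,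
      restrict_compl_singleton]
  rw [← h3, ← h2, hfin]
  have h4 : (radial d).prod (surf d) =
      ((surf d).prod (Measure.volumeIoiPow (d - 1))).map
        (fun p => ((p.2 : ℝ), p.1)) := by
    have : (fun p : Sph d × Set.Ioi (0 : ℝ) => ((p.2 : ℝ), p.1)) =
      (Prod.map Subtype.val id) ∘ Prod.swap := rfl
    rw [this, ← Measure.map_map (by fun_prop) measurable_swap, Measure.prod_swap,
      ← Measure.map_prod_map _ _ measurable_subtype_coe measurable_id, map_val_volumeIoiPow,
      Measure.map_id]
    rfl
  rw [h4, Measure.map_map (by fun_prop) (by fun_prop),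
    Measure.map_map measurable_subtype_coe (MeasurableEquiv.measurable _)]
  rfl

lemma lintegral_polar {d : ℕ} (hd : 2 ≤ d) {f : Eu d → ENNReal} (hf : AEMeasurable f) :
    ∫⁻ x, f x = ∫⁻ r in Set.Ioi (0 : ℝ),
      ENNReal.ofReal (r ^ (d - 1)) * ∫⁻ ω : Sph d, f (r • (ω : Eu d)) ∂(surf d) := by
  have h := measurePreserving_polar d hd
  have hf' : AEMeasurable (fun p : ℝ × Sph d => f (p.1 • (p.2 : Eu d)))
    ((radial d).prod (surf d)) := hf.comp_quasiMeasurePreserving h.quasiMeasurePreserving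
  rw [← h.map_eq, lintegral_map' (by rwa [h.map_eq]) h.aemeasurable, lintegral_prod _ hf', radial,
    lintegral_withDensity_eq_lintegral_mul₀ (by fun_prop)]
  · rfl
  · have : AEMeasurable (fun r => ∫⁻ ω : Sph d, f (r • (ω : Eu d)) ∂(surf d)) (radial d) :=
      hf'.lintegral_prod_right'
    refine this.mono_ac ?_
    intro s hs
    have : ∀ᵐ r ∂(radial d), r ∉ s := measure_eq_zero_iff_ae_notMem.1 hs
    exact measure_eq_zero_iff_ae_notMem.2 (ae_radial_iff.1 this)

lemma integral_polar {d : ℕ} (hd : 2 ≤ d) {f : Eu d → ℂ} (hf : Integrable f) :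
    ∫ x, f x = ∫ r in Set.Ioi (0 : ℝ),
      ((r ^ (d - 1) : ℝ) : ℂ) * ∫ ω : Sph d, f (r • (ω : Eu d)) ∂(surf d) := by
  have h := measurePreserving_polar d hd
  have hf' : Integrable (fun p : ℝ × Sph d => f (p.1 • (p.2 : Eu d)))
    ((radial d).prod (surf d)) := h.integrable_comp_of_integrable hf
  rw [← h.map_eq, integral_map h.aemeasurable (by rw [h.map_eq]; exact hf.1),
    integral_prod _ hf', radial]
  have : (fun r : ℝ => ENNReal.ofReal (r ^ (d - 1))) =
    fun r : ℝ => ((Real.toNNReal (r ^ (d - 1)) : NNReal) : ENNReal) := rfl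
  rw [this, integral_withDensity_eq_integral_smul (by fun_prop)]
  refine setIntegral_congr_fun measurableSet_Ioi fun r hr => ?_
  have hr : 0 < r := hr
  simp [NNReal.smul_def, (pow_pos hr _).le]

lemma ae_slice {d : ℕ} (hd : 2 ≤ d) {p : Eu d → Prop} (h : ∀ᵐ x, p x) :
    ∀ᵐ r ∂(volume.restrict (Set.Ioi (0 : ℝ))), ∀ᵐ ω : Sph d ∂(surf d), p (r • (ω : Eu d)) := by
  rw [← ae_radial_iff (d := d)]
  have h1 : ∀ᵐ q ∂((radial d).prod (surf d)), p (q.1 • (q.2 : Eu d)) :=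
    (measurePreserving_polar d hd).quasiMeasurePreserving.ae h
  exact Measure.ae_ae_of_ae_prod h1

lemma ae_eq_of_slice {d : ℕ} (hd : 2 ≤ d) {f g : Eu d → ℂ} (hf : AEStronglyMeasurable f volume)
    (hg : AEStronglyMeasurable g volume)
    (h : ∀ᵐ r ∂(volume.restrict (Set.Ioi (0 : ℝ))), slice f r =ᵐ[surf d] slice g r) :
    f =ᵐ[volume] g := by
  have h0 : AEMeasurable fun x => ‖f x - g x‖ₑ := (hf.sub hg).enorm
  have h1 : ∫⁻ x, ‖f x - g x‖ₑ = 0 := by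
    rw [lintegral_polar hd h0]
    rw [lintegral_eq_zero_of_ae_eq_zero]
    filter_upwards [h] with r hr
    simp only [Pi.zero_apply, mul_eq_zero]
    right
    rw [lintegral_eq_zero_of_ae_eq_zero]
    filter_upwards [hr] with ω hω
    simp only [slice] at hω
    simp [hω]
  rw [lintegral_eq_zero_iff' h0] at h1
  filter_upwards [h1] with x hx
  simpa [sub_eq_zero] using hx

lemma separableSpace_L2S (d : ℕ) : TopologicalSpace.SeparableSpace (L2S d) := by
  have h0 : MeasurableSpace.CountablyGenerated (Sph d) :=
    MeasurableSpace.CountablyGenerated.comap Subtype.val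
  have h1 : IsSeparable (surf d) := inferInstance
  have h2 : Fact ((2 : ENNReal) ≠ ⊤) := ⟨by simp⟩
  infer_instance

/-- A geometric rate in `L²` makes the sequence Cauchy almost everywhere. Its pointwise limit is
`g`, because convergence in measure already gives a subsequence tending to `g`. -/
lemma ae_tendsto_of_dist_le {d : ℕ} {f : ℕ → L2S d} {g : L2S d}
    (h : ∀ n, dist (f n) g < (1 / 2) ^ n) :
    ∀ᵐ ω ∂(surf d), Tendsto (fun n => f n ω) atTop (𝓝 (g ω)) := by
  have hlim : Tendsto f atTop (𝓝 g) := by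
    rw [tendsto_iff_dist_tendsto_zero]
    exact squeeze_zero (fun _ => dist_nonneg) (fun n => (h n).le)
      (tendsto_pow_atTop_nhds_zero_of_lt_one (by norm_num) (by norm_num))
  obtain ⟨ns, hns, hsub⟩ := (tendstoInMeasure_of_tendsto_Lp hlim).exists_seq_tendsto_ae
  -- The factor `2` comes from comparing `f n` and `f m` through `g`.
  have hB : ∑' n : ℕ, (ENNReal.ofReal 2 * ENNReal.ofReal ((1 / 2) ^ n)) ≠ ⊤ := by
    rw [ENNReal.tsum_mul_left, ← ENNReal.ofReal_tsum_of_nonneg (fun n => by positivity)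
      (summable_geometric_of_lt_one (by norm_num) (by norm_num))]
    exact ENNReal.mul_ne_top (by simp) ENNReal.ofReal_ne_top
  have hc := Lp.ae_tendsto_of_cauchy_eLpNorm (μ := surf d) (p := 2) (f := fun n => ⇑(f n))
    (fun n => Lp.aestronglyMeasurable _) (by norm_num) hB (by
      intro N n m hn hm
      rw [← eLpNorm_congr_ae (Lp.coeFn_sub (f n) (f m)), ← Lp.enorm_def,
        ← ofReal_norm, ← ENNReal.ofReal_mul (by norm_num)]
      refine (ENNReal.ofReal_lt_ofReal_iff (by positivity)).2 ?_
      rw [← dist_eq_norm]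
      have h1 := dist_triangle_right (f n) (f m) g
      have h2 : ((1 : ℝ) / 2) ^ n ≤ (1 / 2) ^ N :=
        pow_le_pow_of_le_one (by norm_num) (by norm_num) hn
      have h3 : ((1 : ℝ) / 2) ^ m ≤ (1 / 2) ^ N :=
        pow_le_pow_of_le_one (by norm_num) (by norm_num) hm
      linarith [h n, h m])
  filter_upwards [hc, hsub] with ω ⟨l, hl⟩ hω
  rwa [tendsto_nhds_unique hω (hl.comp hns.tendsto_atTop)]

/-- A measurable curve in `L²` of the sphere is given by the slices of a measurable function. -/
lemma exists_slice_eq {d : ℕ} {u : ℝ → L2S d}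
    (hu : AEStronglyMeasurable u (volume.restrict (Set.Ioi (0 : ℝ)))) :
    ∃ F : Eu d → ℂ, AEStronglyMeasurable F volume ∧
      ∀ᵐ r ∂(volume.restrict (Set.Ioi (0 : ℝ))), slice F r =ᵐ[surf d] u r := by
  classical
  obtain ⟨v, hv, huv⟩ := hu
  have hsep := separableSpace_L2S d
  set q : ℕ → L2S d := TopologicalSpace.denseSeq (L2S d) with hq
  -- The least index of a dense sequence that is `2^{-n}`-close to `v r` depends measurably on `r`.
  -- The corresponding elements are therefore jointly measurable in radius and angle, and their
  -- limit is transported to `ℝᵈ` by inverse polar coordinates.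
  have hex : ∀ n : ℕ, ∀ r : ℝ, ∃ m, dist (q m) (v r) < (1 / 2 : ℝ) ^ n := fun n r => by
    obtain ⟨m, hm⟩ := (TopologicalSpace.denseRange_denseSeq (L2S d)).exists_dist_lt (v r)
      (show (0 : ℝ) < (1 / 2) ^ n by positivity)
    exact ⟨m, by rwa [dist_comm]⟩
  have hm : ∀ n, Measurable fun r => Nat.find (hex n r) := fun n => by
    refine measurable_find _ fun k => ?_
    exact measurableSet_lt ((stronglyMeasurable_const.dist hv).measurable) measurable_const
  have hq : Measurable fun p : ℕ × Sph d => q p.1 p.2 :=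
    measurable_from_prod_countable_right fun m => (Lp.stronglyMeasurable (q m)).measurable
  set G : ℕ → ℝ × Sph d → ℂ := fun n p => q (Nat.find (hex n p.1)) p.2 with hG
  have hGm : ∀ n, StronglyMeasurable (G n) := fun n =>
    (hq.comp (((hm n).comp measurable_fst).prodMk measurable_snd)).stronglyMeasurable
  set L : ℝ × Sph d → ℂ := fun p => limUnder atTop (fun n => G n p) with hL
  have hLm : StronglyMeasurable L := StronglyMeasurable.limUnder hGm
  set P : ({0}ᶜ : Set (Eu d)) → ℝ × Sph d :=
    fun x => (((homeomorphUnitSphereProd (Eu d) x).2 : ℝ), (homeomorphUnitSphereProd (Eu d) x).1)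
    with hP
  have hPm : Measurable P := by
    have : Measurable (homeomorphUnitSphereProd (Eu d)) :=
      (homeomorphUnitSphereProd (Eu d)).measurable
    exact (measurable_subtype_coe.comp (measurable_snd.comp this)).prodMk (measurable_fst.comp this)
  set F : Eu d → ℂ := fun x => if h : x ∈ ({0}ᶜ : Set (Eu d)) then L (P ⟨x, h⟩) else 0 with hF
  have hFm : Measurable F :=
    Measurable.dite (hLm.measurable.comp hPm) measurable_const (measurableSet_singleton _).compl
  refine ⟨F, hFm.aestronglyMeasurable, ?_⟩
  filter_upwards [huv, ae_restrict_mem measurableSet_Ioi] with r hr hr0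
  have hr0 : 0 < r := hr0
  rw [hr]
  have := ae_tendsto_of_dist_le (f := fun n => q (Nat.find (hex n r))) (g := v r)
    (fun n => Nat.find_spec (hex n r))
  filter_upwards [this] with ω hω
  have hω1 : ‖(ω : Eu d)‖ = 1 := by simp
  have hne : r • (ω : Eu d) ∈ ({0}ᶜ : Set (Eu d)) := by
    have : (ω : Eu d) ≠ 0 := by intro h; simp [h] at hω1
    simp [hr0.ne', this]
  have hPe : P ⟨r • (ω : Eu d), hne⟩ = (r, ω) := by
    simp only [hP]
    ext
    · simp [norm_smul, hω1, abs_of_pos hr0]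
    · simp [norm_smul, hω1, abs_of_pos hr0, smul_smul, hr0.ne']
  simp only [slice, hF]
  rw [dif_pos hne, hPe]
  exact hω.limUnder_eq

/-! ### Polynomials and Gaussian integration by parts. -/

open MvPolynomial

/-- The value of a polynomial at a point of `ℝᵈ`. -/
def evalEu {d : ℕ} (p : MvPolynomial (Fin d) ℂ) (x : Eu d) : ℂ :=
  MvPolynomial.eval (fun i => ((x i : ℝ) : ℂ)) p

section
variable {d : ℕ}

@[simp] lemma evalEu_add (p q : MvPolynomial (Fin d) ℂ) (x : Eu d) :
    evalEu (p + q) x = evalEu p x + evalEu q x := by simp [evalEu]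
@[simp] lemma evalEu_mul (p q : MvPolynomial (Fin d) ℂ) (x : Eu d) :
    evalEu (p * q) x = evalEu p x * evalEu q x := by simp [evalEu]
@[simp] lemma evalEu_pow (p : MvPolynomial (Fin d) ℂ) (n : ℕ) (x : Eu d) :
    evalEu (p ^ n) x = evalEu p x ^ n := by simp [evalEu]
@[simp] lemma evalEu_C (c : ℂ) (x : Eu d) : evalEu (C c) x = c := by simp [evalEu]
@[simp] lemma evalEu_X (i : Fin d) (x : Eu d) : evalEu (X i) x = ((x i : ℝ) : ℂ) := by
  simp [evalEu]
@[simp] lemma evalEu_smul (c : ℂ) (p : MvPolynomial (Fin d) ℂ) (x : Eu d) :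
    evalEu (c • p) x = c * evalEu p x := by simp [evalEu, smul_eval]
@[simp] lemma evalEu_sum {ι : Type*} (s : Finset ι) (p : ι → MvPolynomial (Fin d) ℂ) (x : Eu d) :
    evalEu (∑ i ∈ s, p i) x = ∑ i ∈ s, evalEu (p i) x := by simp [evalEu]

lemma continuous_evalEu (p : MvPolynomial (Fin d) ℂ) : Continuous (evalEu p) := by
  unfold evalEu
  exact (MvPolynomial.continuous_eval p).comp (by fun_prop)

lemma evalEu_smul_point {p : MvPolynomial (Fin d) ℂ} {n : ℕ} (hp : p.IsHomogeneous n) (r : ℝ)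
    (x : Eu d) : evalEu p (r • x) = (r : ℂ) ^ n * evalEu p x := by
  simp only [evalEu, eval_eq', Finset.mul_sum]
  refine Finset.sum_congr rfl fun m hm => ?_
  have hdeg : ∑ i, m i = n := by
    rw [← hp (mem_support_iff.1 hm), Finsupp.weight_apply, Finsupp.sum_fintype _ _ (by simp)]
    simp
  have : ∀ i, (((r • x) i : ℝ) : ℂ) ^ m i = (r : ℂ) ^ m i * ((x i : ℝ) : ℂ) ^ m i := fun i => by
    simp [mul_pow]
  simp only [this, Finset.prod_mul_distrib, Finset.prod_pow_eq_pow_sum, hdeg]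
  ring

lemma hasLineDerivAt_evalEu (p : MvPolynomial (Fin d) ℂ) (x : Eu d) (i : Fin d) :
    HasLineDerivAt ℝ (evalEu p) (evalEu (pderiv i p) x) x (EuclideanSpace.single i 1) := by
  unfold HasLineDerivAt
  induction p using MvPolynomial.induction_on with
  | C a => simpa [evalEu] using hasDerivAt_const (0 : ℝ) a
  | add p q hp hq =>
    simp only [map_add, evalEu_add]
    exact hp.add hq
  | mul_X p j hp =>
    have hX : HasDerivAt (fun t : ℝ => (((x + t • EuclideanSpace.single i (1 : ℝ)) j : ℝ) : ℂ))
        (evalEu (pderiv i (X j)) x) 0 := by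
      have h1 : evalEu (pderiv i (X j)) x = (((Pi.single i (1 : ℝ) : Fin d → ℝ) j : ℝ) : ℂ) := by
        rw [pderiv_X]
        by_cases h : j = i
        · subst h; simp [evalEu]
        · simp [evalEu, Pi.single_eq_of_ne h]
      rw [h1]
      refine HasDerivAt.ofReal_comp ?_
      have : HasDerivAt (fun t : ℝ => x j + t * (Pi.single i (1 : ℝ) : Fin d → ℝ) j)
        (1 * (Pi.single i (1 : ℝ) : Fin d → ℝ) j) 0 :=
        ((hasDerivAt_id (0 : ℝ)).mul_const _).const_add _
      rw [one_mul] at this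
      convert this using 2 with t
      simp [Pi.single_apply]
    have := hp.mul hX
    simp only [evalEu_mul, evalEu_X, evalEu_add, Derivation.leibniz, smul_eq_mul]
    refine this.congr_deriv ?_
    simp only [zero_smul, add_zero]
    ring

/-- Polynomials have polynomial growth. -/
lemma norm_evalEu_le (p : MvPolynomial (Fin d) ℂ) :
    ∃ (c : ℝ) (n : ℕ), 0 ≤ c ∧ ∀ x : Eu d, ‖evalEu p x‖ ≤ c * (1 + ‖x‖) ^ n := by
  induction p using MvPolynomial.induction_on with
  | C a => exact ⟨‖a‖, 0, norm_nonneg _, fun x => by simp⟩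
  | add p q hp hq =>
    obtain ⟨c, n, hc, h⟩ := hp
    obtain ⟨c', n', hc', h'⟩ := hq
    refine ⟨c + c', n + n', by positivity, fun x => ?_⟩
    rw [evalEu_add]
    have h1 : (1 + ‖x‖) ^ n ≤ (1 + ‖x‖) ^ (n + n') :=
      pow_le_pow_right₀ (by simp) (by omega)
    have h2 : (1 + ‖x‖) ^ n' ≤ (1 + ‖x‖) ^ (n + n') :=
      pow_le_pow_right₀ (by simp) (by omega)
    calc _ ≤ ‖evalEu p x‖ + ‖evalEu q x‖ := norm_add_le _ _
      _ ≤ c * (1 + ‖x‖) ^ (n + n') + c' * (1 + ‖x‖) ^ (n + n') :=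
        add_le_add ((h x).trans (by gcongr)) ((h' x).trans (by gcongr))
      _ = _ := by ring
  | mul_X p i hp =>
    obtain ⟨c, n, hc, h⟩ := hp
    refine ⟨c, n + 1, hc, fun x => ?_⟩
    rw [evalEu_mul, evalEu_X, norm_mul, Complex.norm_real, pow_succ, ← mul_assoc]
    have : ‖x i‖ ≤ 1 + ‖x‖ := (PiLp.norm_apply_le x i).trans (by simp)
    gcongr
    exact h x

/-- Polynomial growth is absorbed by `(1 + t)^n ≤ n! e^{1+t}`, and `1 + t - t²/2 ≤ 2 - t²/4` because
the difference is `(t - 2)²/4`. Half of the Gaussian exponent is left as a majorant. -/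
lemma integrable_evalEu_gauss (p : MvPolynomial (Fin d) ℂ) :
    Integrable fun x : Eu d => evalEu p x * (Real.exp (-‖x‖ ^ 2 / 2) : ℂ) := by
  obtain ⟨c, n, hc, h⟩ := norm_evalEu_le p
  have h0 : Integrable fun x : Eu d => Complex.exp (-(1 / 4 : ℂ) * ‖x‖ ^ 2) := by
    simpa using GaussianFourier.integrable_cexp_neg_mul_sq_norm_add (V := Eu d) (b := 1 / 4)
      (by norm_num) 0 0
  refine (h0.norm.const_mul (c * (n.factorial * Real.exp 2))).mono' ?_ ?_
  · refine Continuous.aestronglyMeasurable ?_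
    have := continuous_evalEu p
    fun_prop
  · refine Eventually.of_forall fun x => ?_
    have h1 : (1 + ‖x‖) ^ n ≤ n.factorial * Real.exp (1 + ‖x‖) := by
      have := Real.pow_div_factorial_le_exp (1 + ‖x‖) (by positivity) n
      rwa [div_le_iff₀' (by positivity)] at this
    have h2 : ‖Complex.exp (-(1 / 4 : ℂ) * ‖x‖ ^ 2)‖ = Real.exp (-(1 / 4) * ‖x‖ ^ 2) := by
      rw [Complex.norm_exp]
      congr 1
      have : -(1 / 4 : ℂ) * (‖x‖ : ℂ) ^ 2 = ((-(1 / 4) * ‖x‖ ^ 2 : ℝ) : ℂ) := by push_cast; ring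
      rw [this, Complex.ofReal_re]
    rw [h2, norm_mul, Complex.norm_real, Real.norm_eq_abs, Real.abs_exp]
    calc _ ≤ c * (n.factorial * Real.exp (1 + ‖x‖)) * Real.exp (-‖x‖ ^ 2 / 2) := by
            gcongr
            exact (h x).trans (by gcongr)
      _ = c * n.factorial * Real.exp (1 + ‖x‖ + -‖x‖ ^ 2 / 2) := by
            rw [Real.exp_add (1 + ‖x‖)]; ring
      _ ≤ c * n.factorial * Real.exp (2 + -(1 / 4) * ‖x‖ ^ 2) := by
            refine mul_le_mul_of_nonneg_left (Real.exp_le_exp.2 ?_) (by positivity)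
            nlinarith [sq_nonneg (‖x‖ - 2)]
      _ = _ := by rw [Real.exp_add]; ring

/-- The Gaussian integral of a polynomial. -/
def gaussInt (p : MvPolynomial (Fin d) ℂ) : ℂ :=
  ∫ x : Eu d, evalEu p x * (Real.exp (-‖x‖ ^ 2 / 2) : ℂ)

lemma gaussInt_add (p q : MvPolynomial (Fin d) ℂ) :
    gaussInt (p + q) = gaussInt p + gaussInt q := by
  unfold gaussInt
  rw [← integral_add (integrable_evalEu_gauss p) (integrable_evalEu_gauss q)]
  simp [add_mul]

lemma gaussInt_smul (c : ℂ) (p : MvPolynomial (Fin d) ℂ) :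
    gaussInt (c • p) = c * gaussInt p := by
  unfold gaussInt
  rw [← integral_const_mul]
  simp [mul_assoc]

lemma gaussInt_sum {ι : Type*} (s : Finset ι) (p : ι → MvPolynomial (Fin d) ℂ) :
    gaussInt (∑ i ∈ s, p i) = ∑ i ∈ s, gaussInt (p i) := by
  classical
  induction s using Finset.induction_on with
  | empty => simp [gaussInt, evalEu]
  | insert a s ha ih => rw [Finset.sum_insert ha, Finset.sum_insert ha, gaussInt_add, ih]

/-- Integration by parts against the Gaussian. -/
lemma gaussInt_X_mul (i : Fin d) (p : MvPolynomial (Fin d) ℂ) :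
    gaussInt (X i * p) = gaussInt (pderiv i p) := by
  have hg : ∀ x : Eu d, HasLineDerivAt ℝ (fun x : Eu d => (Real.exp (-‖x‖ ^ 2 / 2) : ℂ))
      (-((x i : ℝ) : ℂ) * (Real.exp (-‖x‖ ^ 2 / 2) : ℂ)) x (EuclideanSpace.single i 1) := by
    intro x
    unfold HasLineDerivAt
    have h1 : ∀ t : ℝ, ‖x + t • EuclideanSpace.single i (1 : ℝ)‖ ^ 2 =
        ‖x‖ ^ 2 + 2 * t * x i + t ^ 2 := fun t => by
      rw [norm_add_sq_real, inner_smul_right, EuclideanSpace.inner_single_right, norm_smul]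
      simp
      ring
    simp only [h1]
    have h2 : ∀ a b : ℝ, HasDerivAt (fun t : ℝ => ((Real.exp (-(b + 2 * t * a + t ^ 2) / 2) : ℝ) : ℂ))
        (-(a : ℂ) * (Real.exp (-b / 2) : ℂ)) 0 := fun a b => by
      have h3 : HasDerivAt (fun t : ℝ => b + 2 * t * a + t ^ 2) (2 * a) 0 := by
        have := ((((hasDerivAt_id (0 : ℝ)).const_mul 2).mul_const a).const_add
          b).add ((hasDerivAt_id (0 : ℝ)).pow 2)
        exact this.congr_deriv (by simp)
      have h4 := (h3.neg.div_const 2).exp.ofReal_comp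
      refine h4.congr_deriv ?_
      push_cast
      simp
      ring
    exact h2 (x i) (‖x‖ ^ 2)
  have h := integral_bilinear_hasLineDerivAt_right_eq_neg_left_of_integrable
    (μ := (volume : Measure (Eu d))) (v := EuclideanSpace.single i 1)
    (f := evalEu p) (f' := evalEu (pderiv i p))
    (g := fun x : Eu d => (Real.exp (-‖x‖ ^ 2 / 2) : ℂ))
    (g' := fun x : Eu d => -((x i : ℝ) : ℂ) * (Real.exp (-‖x‖ ^ 2 / 2) : ℂ))
    (B := ContinuousLinearMap.mul ℝ ℂ)
    (by simpa using integrable_evalEu_gauss (pderiv i p))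
    (by
      refine (integrable_evalEu_gauss (X i * p)).neg.congr (Eventually.of_forall fun x => ?_)
      simp
      ring)
    (by simpa using integrable_evalEu_gauss p)
    (fun x _ => hasLineDerivAt_evalEu p x i) (fun x _ => hg x)
  simp only [ContinuousLinearMap.mul_apply'] at h
  unfold gaussInt
  rw [← neg_inj, ← h, ← integral_neg]
  refine integral_congr_ae (Eventually.of_forall fun x => ?_)
  simp
  ring

lemma polyLaplacian_apply (p : MvPolynomial (Fin d) ℂ) :
    polyLaplacian d p = ∑ i, pderiv i (pderiv i p) := by
  simp [polyLaplacian]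

/-- The commutator of two derivations is a derivation, so it is enough that it vanishes on the
variables. -/
lemma pderiv_comm' (i j : Fin d) (p : MvPolynomial (Fin d) ℂ) :
    pderiv i (pderiv j p) = pderiv j (pderiv i p) := by
  have : ⁅(pderiv i : Derivation ℂ (MvPolynomial (Fin d) ℂ) (MvPolynomial (Fin d) ℂ)),
      (pderiv j : Derivation ℂ (MvPolynomial (Fin d) ℂ) (MvPolynomial (Fin d) ℂ))⁆ = 0 := by
    refine MvPolynomial.derivation_ext fun k => ?_
    rw [Derivation.commutator_apply]
    simp [pderiv_X, Pi.single_apply, apply_ite]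
  have h := congrArg (fun D : Derivation ℂ (MvPolynomial (Fin d) ℂ) (MvPolynomial (Fin d) ℂ) => D p) this
  simpa [Derivation.commutator_apply, sub_eq_zero] using h

lemma pderiv_of_isHomogeneous_zero {p : MvPolynomial (Fin d) ℂ} (hp : p.IsHomogeneous 0)
    (i : Fin d) : pderiv i p = 0 := by
  rw [← totalDegree_zero_iff_isHomogeneous, totalDegree_eq_zero_iff_eq_C] at hp
  rw [hp, pderiv_C]

lemma pderiv_mem_harmonicPoly {k : ℕ} {p : MvPolynomial (Fin d) ℂ} (hp : p ∈ harmonicPoly d k)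
    (i : Fin d) : pderiv i p ∈ harmonicPoly d (k - 1) := by
  refine ⟨IsHomogeneous.pderiv hp.1, ?_⟩
  have h : polyLaplacian d p = 0 := hp.2
  change polyLaplacian d _ = 0
  rw [polyLaplacian_apply] at h ⊢
  calc _ = pderiv i (∑ j, pderiv j (pderiv j p)) := by
        rw [map_sum]
        refine Finset.sum_congr rfl fun j _ => ?_
        rw [pderiv_comm' j i, pderiv_comm' j i]
    _ = 0 := by rw [h, map_zero]

/-- A harmonic polynomial is orthogonal to polynomials of lower degree. -/
lemma gaussInt_harmonic_mul_eq_zero {n : ℕ} : ∀ {m : ℕ} {p w : MvPolynomial (Fin d) ℂ},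
    p ∈ harmonicPoly d n → w.IsHomogeneous m → m < n → gaussInt (p * w) = 0 := by
  induction n with
  | zero => intro m p w _ _ h; omega
  | succ n ih =>
    intro m p w hp hw hm
    -- Euler's identity writes `(n + 1) p` as `∑ xᵢ ∂ᵢp`, and integration by parts trades each `xᵢ`
    -- for a derivative. The terms `∂ᵢ∂ᵢp · w` add up to zero by harmonicity. The terms `∂ᵢp · ∂ᵢw`
    -- fall under the induction hypothesis, both degrees having dropped by one.
    have hE := IsHomogeneous.sum_X_mul_pderiv (φ := p) hp.1
    have hL : ∑ i, pderiv i (pderiv i p) = 0 := by rw [← polyLaplacian_apply]; exact hp.2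
    have h1 : ((n + 1 : ℕ) : ℂ) * gaussInt (p * w) = 0 := by
      have : ((n + 1 : ℕ) : ℂ) • (p * w) = ∑ i, X i * (pderiv i p * w) := by
        rw [← smul_mul_assoc, Nat.cast_smul_eq_nsmul, ← hE, Finset.sum_mul]
        simp [mul_assoc]
      rw [← gaussInt_smul, this, gaussInt_sum]
      have h2 : ∀ i, gaussInt (X i * (pderiv i p * w)) = gaussInt (pderiv i (pderiv i p) * w) := by
        intro i
        rw [gaussInt_X_mul, pderiv_mul, gaussInt_add]
        have : gaussInt (pderiv i p * pderiv i w) = 0 := by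
          -- For `m = 0` the truncated `m - 1` is not a drop in degree, but then `w` is constant and
          -- its derivative vanishes.
          rcases Nat.eq_zero_or_pos m with h0 | h0
          · subst h0
            rw [pderiv_of_isHomogeneous_zero hw]
            simp [gaussInt, evalEu]
          · exact ih (pderiv_mem_harmonicPoly hp i) hw.pderiv (by omega)
        rw [this, add_zero]
      rw [Finset.sum_congr rfl fun i _ => h2 i, ← gaussInt_sum, ← Finset.sum_mul, hL]
      simp [gaussInt, evalEu]
    have : ((n + 1 : ℕ) : ℂ) ≠ 0 := by exact_mod_cast n.succ_ne_zero
    exact (mul_eq_zero.1 h1).resolve_left this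

/-- The polynomial with conjugate coefficients. -/
def conjPoly (p : MvPolynomial (Fin d) ℂ) : MvPolynomial (Fin d) ℂ :=
  MvPolynomial.map (starRingEnd ℂ) p

lemma evalEu_conjPoly (p : MvPolynomial (Fin d) ℂ) (x : Eu d) :
    evalEu (conjPoly p) x = starRingEnd ℂ (evalEu p x) := by
  induction p using MvPolynomial.induction_on with
  | C a => simp [conjPoly]
  | add p q hp hq => simp_all [conjPoly]
  | mul_X p i hp => simp_all [conjPoly]

lemma conjPoly_mem_harmonicPoly {k : ℕ} {p : MvPolynomial (Fin d) ℂ} (hp : p ∈ harmonicPoly d k) :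
    conjPoly p ∈ harmonicPoly d k := by
  refine ⟨IsHomogeneous.map hp.1 _, ?_⟩
  have h : polyLaplacian d p = 0 := hp.2
  change polyLaplacian d _ = 0
  rw [polyLaplacian_apply] at h ⊢
  have := congrArg (MvPolynomial.map (starRingEnd ℂ)) h
  simpa [conjPoly, pderiv_map] using this

/-- The polynomial `∑ᵢ xᵢ²`. -/
def normSqPoly (d : ℕ) : MvPolynomial (Fin d) ℂ := ∑ i, X i ^ 2

lemma evalEu_normSqPoly (x : Eu d) : evalEu (normSqPoly d) x = ((‖x‖ ^ 2 : ℝ) : ℂ) := by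
  rw [normSqPoly, evalEu_sum, EuclideanSpace.real_norm_sq_eq]
  simp

lemma isHomogeneous_normSqPoly : (normSqPoly d).IsHomogeneous 2 :=
  IsHomogeneous.sum _ _ _ fun i _ => isHomogeneous_X_pow i 2

lemma eq_zero_of_evalEu_eq_zero {q : MvPolynomial (Fin d) ℂ} (h : ∀ x : Eu d, evalEu q x = 0) :
    q = 0 := by
  refine MvPolynomial.funext_set (fun _ => Set.range ((↑) : ℝ → ℂ))
    (fun _ => Set.infinite_range_of_injective Complex.ofReal_injective) fun x hx => ?_
  choose y hy using fun i => hx i (Set.mem_univ i)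
  have := h (WithLp.toLp 2 y)
  simpa [evalEu, hy] using this

/-- A harmonic `|x|² q` has degree `n + 2`, so it is Gaussian-orthogonal to the conjugate of `q`,
which has degree `n`. This says `∫ |x|² |q|² exp(-|x|²/2) = 0`, and `q` vanishes away from the
origin. -/
lemma eq_zero_of_normSqPoly_mul_harmonic (hd : 2 ≤ d) {n : ℕ} {q : MvPolynomial (Fin d) ℂ}
    (hq : q.IsHomogeneous n) (h : polyLaplacian d (normSqPoly d * q) = 0) : q = 0 := by
  have h1 : normSqPoly d * q ∈ harmonicPoly d (2 + n) :=
    ⟨isHomogeneous_normSqPoly.mul hq, h⟩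
  have h2 : gaussInt (normSqPoly d * q * conjPoly q) = 0 :=
    gaussInt_harmonic_mul_eq_zero h1 (hq.map _ : (conjPoly q).IsHomogeneous n) (by omega)
  have h3 : ∀ x : Eu d, evalEu (normSqPoly d * q * conjPoly q) x * (Real.exp (-‖x‖ ^ 2 / 2) : ℂ) =
      ((‖x‖ ^ 2 * ‖evalEu q x‖ ^ 2 * Real.exp (-‖x‖ ^ 2 / 2) : ℝ) : ℂ) := fun x => by
    rw [evalEu_mul, evalEu_mul, evalEu_conjPoly, evalEu_normSqPoly, mul_assoc _ (evalEu q x),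
      Complex.mul_conj, Complex.normSq_eq_norm_sq]
    push_cast
    ring
  have hint := integrable_evalEu_gauss (normSqPoly d * q * conjPoly q)
  rw [gaussInt] at h2
  simp only [h3] at h2 hint
  rw [integral_complex_ofReal, Complex.ofReal_eq_zero] at h2
  have hc : Continuous fun x : Eu d => ‖x‖ ^ 2 * ‖evalEu q x‖ ^ 2 * Real.exp (-‖x‖ ^ 2 / 2) := by
    have := continuous_evalEu q
    fun_prop
  have hint' : Integrable fun x : Eu d =>
      ‖x‖ ^ 2 * ‖evalEu q x‖ ^ 2 * Real.exp (-‖x‖ ^ 2 / 2) := hint.re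
  rw [integral_eq_zero_iff_of_nonneg (fun x => by positivity) hint'] at h2
  have h4 : _ = fun _ => (0 : ℝ) := (Continuous.ae_eq_iff_eq volume hc continuous_const).1 h2
  have h5 : ∀ x : Eu d, x ≠ 0 → evalEu q x = 0 := fun x hx => by
    have := congrFun h4 x
    simpa [hx, (Real.exp_pos _).ne'] using this
  refine eq_zero_of_evalEu_eq_zero fun x => ?_
  by_contra hne
  have hd : x = 0 := by by_contra h; exact hne (h5 x h)
  -- The weight `|x|²` hides the value of `q` at `0`. The product vanishes everywhere, so it is the
  -- zero polynomial, and the factor `|x|²` is cancelled in the polynomial ring.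
  have : (normSqPoly d * q) = 0 := by
    refine eq_zero_of_evalEu_eq_zero fun z => ?_
    rw [evalEu_mul, evalEu_normSqPoly]
    by_cases hz : z = 0
    · simp [hz]
    · simp [h5 z hz]
  rcases mul_eq_zero.1 this with h6 | h6
  · have h7 := evalEu_normSqPoly (EuclideanSpace.single (⟨0, by omega⟩ : Fin d) (1 : ℝ))
    rw [h6] at h7
    simp [evalEu] at h7
  · rw [h6] at hne
    simp [evalEu] at hne
end

/-! ### Density and orthogonality of the spherical harmonics. -/

section

open MvPolynomial

variable {d : ℕ}

/-- The map `q ↦ Δ(|x|² q)` is an injective endomorphism of the finite-dimensional space of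
homogeneous polynomials of degree `n`, hence onto. Choosing `q` with `Δ(|x|² q) = Δp` makes `p -
|x|² q` harmonic. -/
lemma exists_harmonic_add_normSqPoly_mul (hd : 2 ≤ d) {n : ℕ} {p : MvPolynomial (Fin d) ℂ}
    (hp : p.IsHomogeneous (n + 2)) :
    ∃ h ∈ harmonicPoly d (n + 2), ∃ q : MvPolynomial (Fin d) ℂ, q.IsHomogeneous n ∧
      p = h + normSqPoly d * q := by
  have hhom : ∀ {m : ℕ} {p : MvPolynomial (Fin d) ℂ}, p.IsHomogeneous (m + 2) →
      (polyLaplacian d p).IsHomogeneous m := fun {m p} hp => by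
    rw [polyLaplacian_apply]
    exact IsHomogeneous.sum _ _ _ fun i _ => (hp.pderiv (i := i)).pderiv (i := i)
  have hmul : ∀ q : homogeneousSubmodule (Fin d) ℂ n,
      polyLaplacian d (normSqPoly d * q) ∈ homogeneousSubmodule (Fin d) ℂ n := fun q => by
    refine hhom ?_
    rw [add_comm]
    exact isHomogeneous_normSqPoly.mul q.2
  let T : homogeneousSubmodule (Fin d) ℂ n →ₗ[ℂ] homogeneousSubmodule (Fin d) ℂ n :=
    { toFun := fun q => ⟨polyLaplacian d (normSqPoly d * q), hmul q⟩
      map_add' := fun a b => by ext1; simp [mul_add]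
      map_smul' := fun c a => by ext1; simp }
  have hfin : FiniteDimensional ℂ (homogeneousSubmodule (Fin d) ℂ n) :=
    Module.Finite.iff_fg.mpr (homogeneousSubmodule_fg (Fin d) ℂ n)
  have hinj : Function.Injective T := by
    rw [injective_iff_map_eq_zero]
    intro q hq
    ext1
    exact eq_zero_of_normSqPoly_mul_harmonic hd q.2 (congrArg Subtype.val hq)
  obtain ⟨q, hq⟩ := LinearMap.injective_iff_surjective.1 hinj ⟨polyLaplacian d p, hhom hp⟩
  have hq' : polyLaplacian d (normSqPoly d * q) = polyLaplacian d p := congrArg Subtype.val hq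
  refine ⟨p - normSqPoly d * q, ⟨?_, ?_⟩, q, q.2, by ring⟩
  · refine hp.sub ?_
    rw [add_comm]
    exact isHomogeneous_normSqPoly.mul q.2
  · change polyLaplacian d _ = 0
    rw [map_sub, hq', sub_self]

lemma norm_coe_sph (ω : Sph d) : ‖(ω : Eu d)‖ = 1 := by simp

lemma restrictPoly_apply (p : MvPolynomial (Fin d) ℂ) (ω : Sph d) :
    restrictPoly d p ω = evalEu p ω := rfl

/-- The class in `L²` of the sphere of the restriction of a polynomial. -/
def polyL2 (d : ℕ) : MvPolynomial (Fin d) ℂ →ₗ[ℂ] L2S d :=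
  (ContinuousMap.toLp 2 (surf d) ℂ : C(Sph d, ℂ) →L[ℂ] L2S d).toLinearMap ∘ₗ restrictPoly d

lemma coeFn_polyL2 (p : MvPolynomial (Fin d) ℂ) :
    polyL2 d p =ᵐ[surf d] fun ω => evalEu p ω :=
  ContinuousMap.coeFn_toLp (surf d) (restrictPoly d p)

lemma polyL2_mem_sphHarm {k : ℕ} {p : MvPolynomial (Fin d) ℂ} (hp : p ∈ harmonicPoly d k) :
    polyL2 d p ∈ sphHarm d k := ⟨p, hp, rfl⟩

/-- On the sphere `|x|² = 1`, so splitting off the harmonic part lowers the degree by two. In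
degrees `0` and `1` every polynomial is harmonic. -/
lemma polyL2_mem_iSup_sphHarm (hd : 2 ≤ d) (n : ℕ) : ∀ {p : MvPolynomial (Fin d) ℂ},
    p.IsHomogeneous n → polyL2 d p ∈ ⨆ k, sphHarm d k := by
  induction n using Nat.strong_induction_on with
  | _ n ih =>
    intro p hp
    rcases lt_or_ge n 2 with hn | hn
    · refine Submodule.mem_iSup_of_mem n (polyL2_mem_sphHarm ⟨hp, ?_⟩)
      change polyLaplacian d _ = 0
      rw [polyLaplacian_apply]
      refine Finset.sum_eq_zero fun i _ => ?_
      refine pderiv_of_isHomogeneous_zero ?_ i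
      have := hp.pderiv (i := i)
      rwa [show n - 1 = 0 by omega] at this
    · obtain ⟨m, rfl⟩ := Nat.exists_eq_add_of_le' hn
      obtain ⟨h, hh, q, hq, rfl⟩ := exists_harmonic_add_normSqPoly_mul hd hp
      rw [map_add]
      refine add_mem (Submodule.mem_iSup_of_mem _ (polyL2_mem_sphHarm hh)) ?_
      have : polyL2 d (normSqPoly d * q) = polyL2 d q := by
        change ContinuousMap.toLp 2 (surf d) ℂ _ = ContinuousMap.toLp 2 (surf d) ℂ _
        congr 1
        ext ω
        rw [restrictPoly_apply, restrictPoly_apply, evalEu_mul, evalEu_normSqPoly, norm_coe_sph]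
        simp
      rw [this]
      exact ih m (by omega) hq

/-- Stone-Weierstrass: the restrictions of polynomials form a star subalgebra that separates points,
so they are dense in the continuous functions and therefore in `L²`. Homogeneous components then
reduce to `polyL2_mem_iSup_sphHarm`. -/
lemma topologicalClosure_iSup_sphHarm (hd : 2 ≤ d) :
    (⨆ k, sphHarm d k).topologicalClosure = ⊤ := by
  let A : StarSubalgebra ℂ C(Sph d, ℂ) :=
    { carrier := Set.range (restrictPoly d)
      mul_mem' := by
        rintro _ _ ⟨p, rfl⟩ ⟨q, rfl⟩
        exact ⟨p * q, by ext ω; simp [restrictPoly_apply]⟩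
      add_mem' := by
        rintro _ _ ⟨p, rfl⟩ ⟨q, rfl⟩
        exact ⟨p + q, by simp⟩
      algebraMap_mem' := fun c => ⟨C c, by ext ω; simp [restrictPoly_apply]⟩
      star_mem' := by
        rintro _ ⟨p, rfl⟩
        exact ⟨conjPoly p, by ext ω; simp [restrictPoly_apply, evalEu_conjPoly]⟩ }
  have hA : A.topologicalClosure = ⊤ := by
    refine ContinuousMap.starSubalgebra_topologicalClosure_eq_top_of_separatesPoints A ?_
    intro x y hxy
    by_contra! hne
    refine hxy (Subtype.ext ?_)
    ext i
    have := hne (restrictPoly d (X i)) ⟨_, ⟨X i, rfl⟩, rfl⟩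
    simpa [restrictPoly_apply] using this
  have hdense : Dense (Set.range (restrictPoly d)) := by
    intro f
    have : f ∈ A.topologicalClosure := by rw [hA]; trivial
    exact this
  have h2 : DenseRange fun p => polyL2 d p := by
    have h3 : DenseRange (ContinuousMap.toLp 2 (surf d) ℂ : C(Sph d, ℂ) →L[ℂ] L2S d) :=
      ContinuousMap.toLp_denseRange ℂ (surf d) ℂ (by simp)
    exact h3.comp hdense (ContinuousLinearMap.continuous _)
  rw [← Submodule.dense_iff_topologicalClosure_eq_top]
  refine h2.mono ?_
  rintro _ ⟨p, rfl⟩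
  simp only [SetLike.mem_coe]
  rw [← sum_homogeneousComponent p, map_sum]
  exact sum_mem fun n _ => polyL2_mem_iSup_sphHarm hd n (homogeneousComponent_isHomogeneous n p)

/-- The Gaussian integral of a homogeneous polynomial in terms of its integral over the sphere. -/
lemma gaussInt_eq_sphere (hd : 2 ≤ d) {n : ℕ} {p : MvPolynomial (Fin d) ℂ}
    (hp : p.IsHomogeneous n) :
    gaussInt p = ((2 ^ (((d + n : ℕ) : ℝ) / 2 - 1) * Real.Gamma (((d + n : ℕ) : ℝ) / 2) : ℝ) : ℂ) *
      ∫ ω : Sph d, evalEu p ω ∂(surf d) := by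
  rw [gaussInt, integral_polar hd (integrable_evalEu_gauss p)]
  have h1 : ∀ r ∈ Set.Ioi (0 : ℝ), ((r ^ (d - 1) : ℝ) : ℂ) * ∫ ω : Sph d,
      evalEu p (r • (ω : Eu d)) * (Real.exp (-‖r • (ω : Eu d)‖ ^ 2 / 2) : ℂ) ∂(surf d) =
      ((r ^ (((d + n : ℕ) : ℝ) - 1) * Real.exp (-(1 / 2) * r ^ (2 : ℝ)) : ℝ) : ℂ) *
        ∫ ω : Sph d, evalEu p ω ∂(surf d) := by
    intro r hr
    have hr : 0 < r := hr
    have h2 : ∀ ω : Sph d,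
        evalEu p (r • (ω : Eu d)) * (Real.exp (-‖r • (ω : Eu d)‖ ^ 2 / 2) : ℂ) =
        ((r ^ n * Real.exp (-(1 / 2) * r ^ (2 : ℝ)) : ℝ) : ℂ) * evalEu p ω := fun ω => by
      rw [evalEu_smul_point hp, norm_smul, norm_coe_sph, mul_one, Real.norm_eq_abs, sq_abs,
        Real.rpow_two]
      push_cast
      ring_nf
    have h3 : r ^ (((d + n : ℕ) : ℝ) - 1) = r ^ (d - 1) * r ^ n := by
      rw [← pow_add, ← Real.rpow_natCast]
      congr 1
      rw [show d + n = (d - 1 + n) + 1 by omega]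
      push_cast
      ring
    simp only [h2]
    rw [integral_const_mul, h3]
    push_cast
    ring
  rw [setIntegral_congr_fun measurableSet_Ioi h1, integral_mul_const, integral_complex_ofReal]
  congr 2
  have hpos : (0 : ℝ) < ((d + n : ℕ) : ℝ) := by exact_mod_cast (by omega : 0 < d + n)
  rw [integral_rpow_mul_exp_neg_mul_rpow (by norm_num) (by linarith) (by norm_num)]
  rw [show ((((d + n : ℕ) : ℝ) - 1 + 1) / 2) = ((d + n : ℕ) : ℝ) / 2 by ring,
    show -(((d + n : ℕ) : ℝ) - 1 + 1) / 2 = -(((d + n : ℕ) : ℝ) / 2) by ring,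
    one_div, Real.inv_rpow (by norm_num), Real.rpow_neg (by norm_num), inv_inv,
    Real.rpow_sub_one (by norm_num)]
  ring

lemma radial_const_ne_zero (hd : 2 ≤ d) (n : ℕ) :
    ((2 ^ (((d + n : ℕ) : ℝ) / 2 - 1) * Real.Gamma (((d + n : ℕ) : ℝ) / 2) : ℝ) : ℂ) ≠ 0 := by
  have hpos : (0 : ℝ) < ((d + n : ℕ) : ℝ) := by exact_mod_cast (by omega : 0 < d + n)
  have := Real.Gamma_pos_of_pos (half_pos hpos)
  exact_mod_cast (by positivity : (0 : ℝ) <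
    2 ^ (((d + n : ℕ) : ℝ) / 2 - 1) * Real.Gamma (((d + n : ℕ) : ℝ) / 2)).ne'

lemma inner_polyL2 (p q : MvPolynomial (Fin d) ℂ) :
    inner ℂ (polyL2 d p) (polyL2 d q) = ∫ ω : Sph d, evalEu (conjPoly p * q) ω ∂(surf d) := by
  rw [L2.inner_def]
  refine integral_congr_ae ?_
  filter_upwards [coeFn_polyL2 p, coeFn_polyL2 q] with ω hp hq
  rw [hp, hq, evalEu_mul, evalEu_conjPoly, RCLike.inner_apply, mul_comm]

/-- For a homogeneous polynomial the Gaussian integral is a nonzero multiple of the integral over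
the sphere, so Gaussian orthogonality to lower degrees carries over. The factor of higher degree
plays the harmonic role. -/
lemma inner_sphHarm_eq_zero (hd : 2 ≤ d) {j k : ℕ} (hjk : j ≠ k) {f g : L2S d}
    (hf : f ∈ sphHarm d j) (hg : g ∈ sphHarm d k) : inner ℂ f g = 0 := by
  obtain ⟨p, hp, rfl⟩ := hf
  obtain ⟨q, hq, rfl⟩ := hg
  have hp' := conjPoly_mem_harmonicPoly hp
  change inner ℂ (polyL2 d p) (polyL2 d q) = 0
  rw [inner_polyL2]
  have h := gaussInt_eq_sphere hd (hp'.1.mul hq.1)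
  have h0 : gaussInt (conjPoly p * q) = 0 := by
    rcases lt_or_gt_of_ne hjk with h | h
    · rw [mul_comm]; exact gaussInt_harmonic_mul_eq_zero hq hp'.1 h
    · exact gaussInt_harmonic_mul_eq_zero hp' hq.1 h
  rw [h0] at h
  exact (mul_eq_zero.1 h.symm).resolve_left (radial_const_ne_zero hd _)

lemma orthogonalFamily_sphHarm (hd : 2 ≤ d) :
    OrthogonalFamily ℂ (fun k => sphHarm d k) fun k => (sphHarm d k).subtypeₗᵢ := by
  intro j k hjk f g
  exact inner_sphHarm_eq_zero hd hjk f.2 g.2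

lemma projH_mem (k : ℕ) (f : L2S d) : projH d k f ∈ sphHarm d k :=
  Submodule.starProjection_apply_mem _ _

lemma projH_of_mem {k : ℕ} {f : L2S d} (hf : f ∈ sphHarm d k) : projH d k f = f :=
  Submodule.starProjection_eq_self_iff.2 hf

lemma projH_of_mem_ne (hd : 2 ≤ d) {j k : ℕ} (hjk : j ≠ k) {f : L2S d} (hf : f ∈ sphHarm d j) :
    projH d k f = 0 := by
  refine (Submodule.starProjection_apply_eq_zero_iff _).2 ?_
  rw [Submodule.mem_orthogonal]
  intro u hu
  exact inner_sphHarm_eq_zero hd hjk.symm hu hf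

lemma inner_projH_left (k : ℕ) (f g : L2S d) :
    inner ℂ (projH d k f) g = inner ℂ f (projH d k g) :=
  Submodule.inner_starProjection_left_eq_right _ f g

/-- The expansion of a function on the sphere into spherical harmonics. -/
lemma hasSum_projH (hd : 2 ≤ d) (f : L2S d) : HasSum (fun k => projH d k f) f := by
  have hH : IsHilbertSum ℂ (fun k => sphHarm d k) fun k => (sphHarm d k).subtypeₗᵢ :=
    IsHilbertSum.mkInternal _ (orthogonalFamily_sphHarm hd)
      (by rw [topologicalClosure_iSup_sphHarm hd])
  set w := hH.linearIsometryEquiv f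
  have h := hH.hasSum_linearIsometryEquiv_symm w
  rw [LinearIsometryEquiv.symm_apply_apply] at h
  -- The abstract Hilbert sum coordinates are identified by applying `H_k` to the whole series,
  -- where only the term of degree `k` survives.
  have h2 : ∀ k, projH d k f = (w k : L2S d) := fun k => by
    have h3 := h.mapL (projH d k)
    refine h3.unique ?_
    convert hasSum_single k ?_ using 1
    · exact (projH_of_mem (w k).2).symm
    · intro j hj
      exact projH_of_mem_ne hd hj (w j).2
  simpa [h2] using h
end

/-! ### Parseval's identity and the Funk-Hecke formula for exponentials. -/

section

open MvPolynomial

variable {d : ℕ}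

lemma inner_projH_self (k : ℕ) (f : L2S d) :
    inner ℂ f (projH d k f) = ((‖projH d k f‖ ^ 2 : ℝ) : ℂ) := by
  rw [← projH_of_mem (projH_mem k f), ← inner_projH_left, projH_of_mem (projH_mem k f)]
  rw [inner_self_eq_norm_sq_to_K]
  simp

lemma hasSum_norm_sq_projH (hd : 2 ≤ d) (f : L2S d) :
    HasSum (fun k => ‖projH d k f‖ ^ 2) (‖f‖ ^ 2) := by
  have h := (hasSum_projH hd f).mapL (innerSL ℂ f)
  simp only [innerSL_apply_apply, inner_projH_self] at h
  rw [inner_self_eq_norm_sq_to_K] at h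
  exact Complex.hasSum_ofReal.1 (by simpa using h)

lemma projH_of_hasSum (hd : 2 ≤ d) {c : ℕ → ℂ} {f F : L2S d}
    (h : HasSum (fun k => c k • projH d k f) F) (k : ℕ) : projH d k F = c k • projH d k f := by
  refine (h.mapL (projH d k)).unique ?_
  convert hasSum_single k ?_ using 1
  · rw [map_smul, projH_of_mem (projH_mem k f)]
  · intro j hj
    rw [map_smul, projH_of_mem_ne hd hj (projH_mem j f), smul_zero]

lemma hasSum_norm_sq_of_hasSum (hd : 2 ≤ d) {c : ℕ → ℂ} {f F : L2S d}
    (h : HasSum (fun k => c k • projH d k f) F) :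
    HasSum (fun k => ‖c k‖ ^ 2 * ‖projH d k f‖ ^ 2) (‖F‖ ^ 2) := by
  have := hasSum_norm_sq_projH hd F
  simpa only [projH_of_hasSum hd h, norm_smul, mul_pow] using this

lemma summable_smul_projH (hd : 2 ≤ d) {c : ℕ → ℂ} {f : L2S d}
    (h : Summable fun k => ‖c k‖ ^ 2 * ‖projH d k f‖ ^ 2) :
    Summable fun k => c k • projH d k f := by
  have := (orthogonalFamily_sphHarm hd).summable_iff_norm_sq_summable
    (fun k => ⟨c k • projH d k f, (sphHarm d k).smul_mem _ (projH_mem k f)⟩)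
  refine this.2 ?_
  simpa only [Submodule.coe_norm, norm_smul, mul_pow] using h

/-- The linear form `∑ᵢ yᵢ xᵢ`. -/
def linPoly (y : Eu d) : MvPolynomial (Fin d) ℂ := ∑ i, ((y i : ℝ) : ℂ) • X i

lemma evalEu_linPoly (y x : Eu d) : evalEu (linPoly y) x = ((inner ℝ x y : ℝ) : ℂ) := by
  rw [linPoly, evalEu_sum, PiLp.inner_apply]
  push_cast
  refine Finset.sum_congr rfl fun i _ => ?_
  rw [evalEu_smul, evalEu_X]
  simp

lemma isHomogeneous_linPoly (y : Eu d) : (linPoly y).IsHomogeneous 1 :=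
  IsHomogeneous.sum _ _ _ fun i _ => by
    rw [smul_eq_C_mul]
    exact isHomogeneous_C_mul_X _ i

lemma pderiv_linPoly (y : Eu d) (i : Fin d) : pderiv i (linPoly y) = C ((y i : ℝ) : ℂ) := by
  simp [linPoly, pderiv_X, Pi.single_apply, smul_eq_C_mul]

/-- The directional derivative `∑ᵢ yᵢ ∂ᵢ`. -/
def dirDeriv (y : Eu d) (p : MvPolynomial (Fin d) ℂ) : MvPolynomial (Fin d) ℂ :=
  ∑ i, ((y i : ℝ) : ℂ) • pderiv i p

lemma dirDeriv_mem_harmonicPoly {k : ℕ} {p : MvPolynomial (Fin d) ℂ} (hp : p ∈ harmonicPoly d k)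
    (y : Eu d) : dirDeriv y p ∈ harmonicPoly d (k - 1) :=
  sum_mem fun i _ => Submodule.smul_mem _ _ (pderiv_mem_harmonicPoly hp i)

lemma evalEu_dirDeriv {k : ℕ} {p : MvPolynomial (Fin d) ℂ} (hp : p.IsHomogeneous k) (y : Eu d) :
    evalEu (dirDeriv y p) y = k * evalEu p y := by
  have h := congrArg (fun q => evalEu q y) hp.sum_X_mul_pderiv
  simp only [evalEu_sum, evalEu_mul, evalEu_X] at h
  rw [dirDeriv, evalEu_sum]
  simp only [evalEu_smul]
  rw [h, ← Nat.cast_smul_eq_nsmul ℂ, evalEu_smul]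

/-- One factor `∑ yᵢ xᵢ` is integrated by parts. The derivative `∑ yᵢ ∂ᵢ` falls either on `p` or on
the remaining power, where it produces `n |y|²`. The truncation of `n - 1` at `n = 0` is harmless
because of the factor `n`. -/
lemma gaussInt_mul_linPoly_pow_succ (p : MvPolynomial (Fin d) ℂ) (y : Eu d) (n : ℕ) :
    gaussInt (p * linPoly y ^ (n + 1)) = gaussInt (dirDeriv y p * linPoly y ^ n) +
      n * (‖y‖ : ℂ) ^ 2 * gaussInt (p * linPoly y ^ (n - 1)) := by
  have h1 : p * linPoly y ^ (n + 1) = ∑ i, ((y i : ℝ) : ℂ) • (X i * (p * linPoly y ^ n)) := by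
    rw [pow_succ, linPoly, Finset.mul_sum, Finset.mul_sum]
    refine Finset.sum_congr rfl fun i _ => ?_
    rw [smul_eq_C_mul, smul_eq_C_mul]
    ring
  have h2 : (‖y‖ : ℂ) ^ 2 = ∑ i, ((y i : ℝ) : ℂ) * ((y i : ℝ) : ℂ) := by
    have := EuclideanSpace.real_norm_sq_eq y
    have h3 : ((‖y‖ ^ 2 : ℝ) : ℂ) = ((∑ i, y i ^ 2 : ℝ) : ℂ) := by rw [this]
    push_cast at h3
    simpa [sq] using h3
  rw [h1, gaussInt_sum, dirDeriv, Finset.sum_mul, gaussInt_sum, h2, Finset.mul_sum, Finset.sum_mul,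
    ← Finset.sum_add_distrib]
  refine Finset.sum_congr rfl fun i _ => ?_
  rw [gaussInt_smul, gaussInt_X_mul, pderiv_mul, gaussInt_add, pderiv_pow, pderiv_linPoly,
    smul_mul_assoc, gaussInt_smul,
    show p * ((n : MvPolynomial (Fin d) ℂ) * linPoly y ^ (n - 1) * C ((y i : ℝ) : ℂ)) =
      ((n : ℂ) * ((y i : ℝ) : ℂ)) • (p * linPoly y ^ (n - 1)) by
      rw [smul_eq_C_mul, map_mul, map_natCast]; ring, gaussInt_smul]
  ring

/-- Wick's rule: `k` of the `n` linear factors differentiate `p` down to a constant and the other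
`2j` are paired among themselves, which can be done in `n! / (2^j j!)` ways. An odd or negative
number of leftover factors gives zero. -/
lemma gaussInt_harmonic_mul_linPoly_pow (y : Eu d) (n : ℕ) : ∀ (k : ℕ) (p : MvPolynomial (Fin d) ℂ),
    p ∈ harmonicPoly d k →
    (∀ j, n = k + 2 * j → gaussInt (p * linPoly y ^ n) =
      (n.factorial / (2 ^ j * j.factorial) : ℂ) * gaussInt (1 : MvPolynomial (Fin d) ℂ) *
        evalEu p y * (‖y‖ : ℂ) ^ (2 * j)) ∧
    ((∀ j, n ≠ k + 2 * j) → gaussInt (p * linPoly y ^ n) = 0) := by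
  have hzero : gaussInt (0 : MvPolynomial (Fin d) ℂ) = 0 := by simp [gaussInt, evalEu]
  induction n using Nat.strong_induction_on with
  | _ n ih =>
    intro k p hp
    rcases n with _ | n
    · refine ⟨fun j hj => ?_, fun h => ?_⟩
      · obtain rfl : j = 0 := by omega
        obtain rfl : k = 0 := by omega
        have h0 := hp.1
        rw [SetLike.mem_coe, mem_homogeneousSubmodule, ← totalDegree_zero_iff_isHomogeneous,
          totalDegree_eq_zero_iff_eq_C] at h0
        rw [h0, pow_zero, C_mul', gaussInt_smul, evalEu_C]
        simp
        ring
      · have hk : 0 < k := by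
          rcases Nat.eq_zero_or_pos k with h0 | h0
          · exact absurd (by omega) (h 0)
          · exact h0
        exact gaussInt_harmonic_mul_eq_zero hp ((isHomogeneous_linPoly y).pow 0) (by omega)
    · rw [gaussInt_mul_linPoly_pow_succ]
      have hQ := dirDeriv_mem_harmonicPoly hp y
      -- In degree zero the truncated degree `k - 1` carries no information, so this case is settled
      -- directly.
      have hQ0 : k = 0 → dirDeriv y p = 0 := by
        rintro rfl
        have h0 : p.IsHomogeneous 0 := hp.1
        simp [dirDeriv, pderiv_of_isHomogeneous_zero h0]
      refine ⟨fun j hj => ?_, fun h => ?_⟩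
      · have hA : gaussInt (dirDeriv y p * linPoly y ^ n) =
            (n.factorial / (2 ^ j * j.factorial) : ℂ) * gaussInt (1 : MvPolynomial (Fin d) ℂ) *
              (k * evalEu p y) * (‖y‖ : ℂ) ^ (2 * j) := by
          rcases Nat.eq_zero_or_pos k with h0 | h0
          · rw [hQ0 h0, h0]; simp [hzero]
          · rw [(ih n (by omega) (k - 1) _ hQ).1 j (by omega), evalEu_dirDeriv hp.1]
        have hB : n * (‖y‖ : ℂ) ^ 2 * gaussInt (p * linPoly y ^ (n - 1)) =
            (n.factorial / (2 ^ j * j.factorial) : ℂ) * gaussInt (1 : MvPolynomial (Fin d) ℂ) *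
              (2 * j * evalEu p y) * (‖y‖ : ℂ) ^ (2 * j) := by
          rcases j with _ | j
          · rcases n with _ | n
            · simp
            · rw [Nat.add_sub_cancel, (ih n (by omega) k _ hp).2 (by omega)]
              simp
          · rw [(ih (n - 1) (by omega) k _ hp).1 j (by omega)]
            obtain ⟨m, rfl⟩ : ∃ m, n = m + 1 := ⟨n - 1, by omega⟩
            simp only [Nat.add_sub_cancel, Nat.factorial_succ]
            have hj1 : ((j : ℂ) + 1) ≠ 0 := by exact_mod_cast j.succ_ne_zero
            have hj2 : (j.factorial : ℂ) ≠ 0 := by exact_mod_cast j.factorial_ne_zero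
            push_cast
            field_simp
            ring
        -- The two contributions carry the factors `k` and `2j`, and their sum `n + 1` completes the
        -- factorial.
        rw [hA, hB, Nat.factorial_succ, hj]
        push_cast
        ring
      · have hA : gaussInt (dirDeriv y p * linPoly y ^ n) = 0 := by
          rcases Nat.eq_zero_or_pos k with h0 | h0
          · rw [hQ0 h0]; simp [hzero]
          · exact (ih n (by omega) (k - 1) _ hQ).2 fun j hj => h j (by omega)
        have hB : n * (‖y‖ : ℂ) ^ 2 * gaussInt (p * linPoly y ^ (n - 1)) = 0 := by
          rcases Nat.eq_zero_or_pos n with h0 | h0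
          · simp [h0]
          · rw [(ih (n - 1) (by omega) k _ hp).2 fun j hj => h (j + 1) (by omega), mul_zero]
        rw [hA, hB, add_zero]

lemma gaussInt_one : gaussInt (1 : MvPolynomial (Fin d) ℂ) =
    (((2 * Real.pi) ^ ((d : ℝ) / 2) : ℝ) : ℂ) := by
  have h := GaussianFourier.integral_rexp_neg_mul_sq_norm (V := Eu d) (b := 1 / 2) (by norm_num)
  have h2 : gaussInt (1 : MvPolynomial (Fin d) ℂ) =
      ((∫ x : Eu d, Real.exp (-(1 / 2) * ‖x‖ ^ 2) : ℝ) : ℂ) := by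
    rw [gaussInt, ← integral_complex_ofReal]
    refine integral_congr_ae (Eventually.of_forall fun x => ?_)
    simp only [evalEu, map_one, one_mul]
    congr 2
    ring
  rw [h2, h, finrank_euclideanSpace_fin]
  congr 2
  ring

/-- The coefficients of the power series of the Funk-Hecke multiplier of the exponential. -/
def fhCoeff (d k j : ℕ) : ℝ :=
  (2 * Real.pi) ^ ((d : ℝ) / 2) / (2 ^ j * j.factorial *
    (2 ^ ((d : ℝ) / 2 + k + j - 1) * Real.Gamma ((d : ℝ) / 2 + k + j)))

/-- This is the Gaussian moment formula divided by the radial integral belonging to the degree `k +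
n`. For `n = k + 2j` that radial factor is the Gamma term in `fhCoeff`. -/
lemma integral_harmonic_mul_inner_pow (hd : 2 ≤ d) {k : ℕ} {p : MvPolynomial (Fin d) ℂ}
    (hp : p ∈ harmonicPoly d k) (η : Sph d) (n : ℕ) :
    (∀ j, n = k + 2 * j →
      ∫ ω : Sph d, evalEu p ω * ((inner ℝ (ω : Eu d) (η : Eu d) : ℝ) : ℂ) ^ n ∂(surf d) =
        n.factorial * fhCoeff d k j * evalEu p η) ∧
    ((∀ j, n ≠ k + 2 * j) →
      ∫ ω : Sph d, evalEu p ω * ((inner ℝ (ω : Eu d) (η : Eu d) : ℝ) : ℂ) ^ n ∂(surf d) = 0) := by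
  have hhom : (p * linPoly (η : Eu d) ^ n).IsHomogeneous (k + n) := by
    have := IsHomogeneous.mul hp.1 ((isHomogeneous_linPoly (η : Eu d)).pow n)
    rwa [one_mul] at this
  have h := gaussInt_eq_sphere hd hhom
  have hne := radial_const_ne_zero hd (k + n)
  have hG := gaussInt_harmonic_mul_linPoly_pow (η : Eu d) n k p hp
  simp only [evalEu_mul, evalEu_pow, evalEu_linPoly] at h
  refine ⟨fun j hj => ?_, fun hj => ?_⟩
  · rw [hG.1 j hj, norm_coe_sph, gaussInt_one] at h
    rw [← mul_right_inj' hne, ← h, fhCoeff, hj]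
    have h1 : ((d + (k + (k + 2 * j)) : ℕ) : ℝ) / 2 = (d : ℝ) / 2 + k + j := by push_cast; ring
    rw [hj, h1] at hne
    rw [h1]
    generalize (2 : ℝ) ^ ((d : ℝ) / 2 + k + j - 1) * Real.Gamma ((d : ℝ) / 2 + k + j) = R at hne ⊢
    have h2 : (j.factorial : ℂ) ≠ 0 := by exact_mod_cast j.factorial_ne_zero
    push_cast
    field_simp
    simp
  · rw [hG.2 hj] at h
    exact (mul_eq_zero.1 h.symm).resolve_left hne

/-- The witness is `(x₁ + i x₂)^k`, harmonic since `1 + i² = 0` and equal to `1` at the first basis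
vector. A point where some element of `ℋ_k` does not vanish allows multipliers to be read off by
division. -/
lemma exists_harmonicPoly_eval_ne_zero (hd : 2 ≤ d) (k : ℕ) :
    ∃ p ∈ harmonicPoly d k, ∃ η : Sph d, evalEu p η ≠ 0 := by
  let i : Fin d := ⟨0, by omega⟩
  let j : Fin d := ⟨1, by omega⟩
  have hij : i ≠ j := by simp [i, j]
  let l : MvPolynomial (Fin d) ℂ := X i + C Complex.I * X j
  have hl : ∀ m, pderiv m l = C (if m = i then 1 else if m = j then Complex.I else 0) := by
    intro m
    by_cases h1 : m = i
    · subst h1; simp [l, pderiv_X, hij.symm]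
    · by_cases h2 : m = j
      · subst h2; simp [l, pderiv_X, h1, Ne.symm h1]
      · simp [l, pderiv_X, h1, h2, Ne.symm h1, Ne.symm h2]
  have hhom : l.IsHomogeneous 1 := (isHomogeneous_X ℂ i).add (isHomogeneous_C_mul_X _ j)
  refine ⟨l ^ k, ⟨by simpa using hhom.pow k, ?_⟩,
    ⟨EuclideanSpace.single i 1, by simp⟩, ?_⟩
  · change polyLaplacian d _ = 0
    rw [polyLaplacian_apply]
    have h2 : ∀ m, pderiv m (pderiv m (l ^ k)) = ((k : MvPolynomial (Fin d) ℂ) *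
        ((k - 1 : ℕ) : MvPolynomial (Fin d) ℂ) * l ^ (k - 1 - 1)) *
        C ((if m = i then 1 else if m = j then Complex.I else 0) ^ 2) := fun m => by
      rw [pderiv_pow, hl, pderiv_mul, pderiv_C, pderiv_mul, pderiv_pow, hl]
      have : pderiv m (k : MvPolynomial (Fin d) ℂ) = 0 := by
        rw [← map_natCast C, pderiv_C]
      rw [this, map_pow]
      ring
    simp only [h2]
    rw [← Finset.mul_sum, ← map_sum]
    have h3 : ∑ m, (if m = i then (1 : ℂ) else if m = j then Complex.I else 0) ^ 2 = 0 := by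
      have h4 : ∀ m, (if m = i then (1 : ℂ) else if m = j then Complex.I else 0) ^ 2 =
          (if m = i then 1 else 0) + (if m = j then -1 else 0) := fun m => by
        by_cases h1 : m = i
        · subst h1; simp [hij]
        · by_cases h2 : m = j
          · subst h2; simp [h1]
          · simp [h1, h2]
      simp only [h4, Finset.sum_add_distrib]
      simp
    rw [h3]
    simp
  · simp [l, hij.symm]

/-- The Funk-Hecke multiplier of the kernel `exp (z ⟨ω, η⟩)` on spherical harmonics of
degree `k`. -/
def fhMul (d k : ℕ) (z : ℂ) : ℂ := ∑' j, (fhCoeff d k j : ℂ) * z ^ (k + 2 * j)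

/-- Expand the exponential and integrate term by term, dominated by a multiple of `|z|^n / n!`. Only
the powers `n = k + 2j` survive, and their `n!` cancels. -/
lemma hasSum_integral_harmonic_mul_exp (hd : 2 ≤ d) {k : ℕ} {p : MvPolynomial (Fin d) ℂ}
    (hp : p ∈ harmonicPoly d k) (z : ℂ) (η : Sph d) :
    HasSum (fun j => (fhCoeff d k j : ℂ) * z ^ (k + 2 * j) * evalEu p η)
      (∫ ω : Sph d, evalEu p ω *
        Complex.exp (z * ((inner ℝ (ω : Eu d) (η : Eu d) : ℝ) : ℂ)) ∂(surf d)) := by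
  obtain ⟨c, m, hc, hb⟩ := norm_evalEu_le p
  have hcont := continuous_evalEu p
  have h1 : HasSum (fun n : ℕ => ∫ ω : Sph d, (z ^ n / n.factorial) *
      (evalEu p ω * ((inner ℝ (ω : Eu d) (η : Eu d) : ℝ) : ℂ) ^ n) ∂(surf d))
      (∫ ω : Sph d, evalEu p ω *
        Complex.exp (z * ((inner ℝ (ω : Eu d) (η : Eu d) : ℝ) : ℂ)) ∂(surf d)) := by
    refine hasSum_integral_of_dominated_convergence
      (fun n _ => (c * 2 ^ m) * (‖z‖ ^ n / n.factorial)) (fun n => ?_) (fun n => ?_) ?_ ?_ ?_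
    · exact Continuous.aestronglyMeasurable (by fun_prop)
    · refine Eventually.of_forall fun ω => ?_
      have h2 : ‖evalEu p (ω : Eu d)‖ ≤ c * 2 ^ m := by
        have := hb (ω : Eu d)
        rw [norm_coe_sph] at this
        convert this using 3
        norm_num
      have h3 : ‖((inner ℝ (ω : Eu d) (η : Eu d) : ℝ) : ℂ)‖ ≤ 1 := by
        rw [Complex.norm_real]
        have := norm_inner_le_norm (𝕜 := ℝ) (ω : Eu d) (η : Eu d)
        rwa [norm_coe_sph, norm_coe_sph, one_mul] at this
      rw [norm_mul, norm_mul, norm_div, norm_pow, norm_pow, Complex.norm_natCast]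
      calc _ ≤ ‖z‖ ^ n / n.factorial * ((c * 2 ^ m) * 1 ^ n) := by gcongr
        _ = _ := by ring
    · exact Eventually.of_forall fun ω => (Real.summable_pow_div_factorial ‖z‖).mul_left _
    · exact integrable_const _
    · refine Eventually.of_forall fun ω => ?_
      have h2 := (NormedSpace.expSeries_div_hasSum_exp
        (z * ((inner ℝ (ω : Eu d) (η : Eu d) : ℝ) : ℂ))).mul_left (evalEu p (ω : Eu d))
      rw [← Complex.exp_eq_exp_ℂ] at h2
      have h3 : ∀ n : ℕ, z ^ n / n.factorial *
          (evalEu p ω * ((inner ℝ (ω : Eu d) (η : Eu d) : ℝ) : ℂ) ^ n) = evalEu p ω *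
          ((z * ((inner ℝ (ω : Eu d) (η : Eu d) : ℝ) : ℂ)) ^ n / n.factorial) := fun n => by
        rw [mul_pow]
        ring
      simpa only [h3] using h2
  have hinj : Function.Injective fun j : ℕ => k + 2 * j := fun a b h => by simpa using h
  rw [← hinj.hasSum_iff] at h1
  · convert h1 using 2 with j
    rw [Function.comp_apply, integral_const_mul,
      (integral_harmonic_mul_inner_pow hd hp η (k + 2 * j)).1 j rfl]
    have : ((k + 2 * j).factorial : ℂ) ≠ 0 := by exact_mod_cast (k + 2 * j).factorial_ne_zero
    field_simp
  · intro n hn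
    rw [integral_const_mul, (integral_harmonic_mul_inner_pow hd hp η n).2, mul_zero]
    exact fun j hj => hn ⟨j, hj.symm⟩

/-- The Funk-Hecke formula for the exponential. -/
lemma integral_harmonic_mul_exp (hd : 2 ≤ d) {k : ℕ} {p : MvPolynomial (Fin d) ℂ}
    (hp : p ∈ harmonicPoly d k) (z : ℂ) (η : Sph d) :
    ∫ ω : Sph d, evalEu p ω *
      Complex.exp (z * ((inner ℝ (ω : Eu d) (η : Eu d) : ℝ) : ℂ)) ∂(surf d) =
      fhMul d k z * evalEu p η := by
  rw [← (hasSum_integral_harmonic_mul_exp hd hp z η).tsum_eq, tsum_mul_right, fhMul]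

/-- Convergence is inherited from the integral formula by dividing by a nonzero value of a harmonic
polynomial, so the coefficients need not be estimated. -/
lemma hasSum_fhMul (hd : 2 ≤ d) (k : ℕ) (z : ℂ) :
    HasSum (fun j => (fhCoeff d k j : ℂ) * z ^ (k + 2 * j)) (fhMul d k z) := by
  obtain ⟨p, hp, η, hη⟩ := exists_harmonicPoly_eval_ne_zero hd k
  have h := (hasSum_integral_harmonic_mul_exp hd hp z η).mul_right (evalEu p η)⁻¹
  simp only [mul_assoc, mul_inv_cancel₀ hη, mul_one] at h
  exact h.summable.hasSum

lemma fhCoeff_pos (hd : 2 ≤ d) (k j : ℕ) : 0 < fhCoeff d k j := by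
  have h1 : (0 : ℝ) < (d : ℝ) / 2 + k + j := by
    have : (2 : ℝ) ≤ d := by exact_mod_cast hd
    positivity
  have := Real.Gamma_pos_of_pos h1
  have := Real.pi_pos
  unfold fhCoeff
  positivity
end

/-! ### Beta and Gamma integrals, and Gauss's summation. -/

lemma lintegral_rpow_mul_one_sub_rpow {p q : ℝ} (hp : 0 < p) (hq : 0 < q) :
    ∫⁻ x in Set.Ioo (0 : ℝ) 1, ENNReal.ofReal (x ^ (p - 1) * (1 - x) ^ (q - 1)) =
      ENNReal.ofReal (Real.Gamma p * Real.Gamma q / Real.Gamma (p + q)) := by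
  have h := ProbabilityTheory.lintegral_betaPDF_eq_one hp hq
  have hb := ProbabilityTheory.beta_pos hp hq
  rw [ProbabilityTheory.lintegral_betaPDF] at h
  have h2 : ∀ x : ℝ, ENNReal.ofReal (1 / ProbabilityTheory.beta p q * x ^ (p - 1) *
      (1 - x) ^ (q - 1)) = ENNReal.ofReal (1 / ProbabilityTheory.beta p q) *
      ENNReal.ofReal (x ^ (p - 1) * (1 - x) ^ (q - 1)) := fun x => by
    rw [← ENNReal.ofReal_mul (by positivity), mul_assoc]
  simp only [h2] at h
  rw [lintegral_const_mul _ (by fun_prop)] at h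
  change _ = ENNReal.ofReal (ProbabilityTheory.beta p q)
  have h3 : ENNReal.ofReal (ProbabilityTheory.beta p q) *
      ENNReal.ofReal (1 / ProbabilityTheory.beta p q) = 1 := by
    rw [← ENNReal.ofReal_mul hb.le, mul_one_div_cancel hb.ne', ENNReal.ofReal_one]
  rw [← one_mul (∫⁻ _ in _, _), ← h3, mul_assoc, h, mul_one]

lemma lintegral_rpow_mul_exp {p r : ℝ} (hp : 0 < p) (hr : 0 < r) :
    ∫⁻ t in Set.Ioi (0 : ℝ), ENNReal.ofReal (t ^ (p - 1) * Real.exp (-(r * t))) =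
      ENNReal.ofReal ((1 / r) ^ p * Real.Gamma p) := by
  have h := Real.integral_rpow_mul_exp_neg_mul_Ioi hp hr
  have hpos : 0 < (1 / r) ^ p * Real.Gamma p :=
    mul_pos (by positivity) (Real.Gamma_pos_of_pos hp)
  rw [← h, ofReal_integral_eq_lintegral_ofReal]
  -- The Bochner integral of a non-integrable function is `0`, whereas the known value is positive.
  · by_contra hni
    rw [integral_undef hni] at h
    exact hpos.ne h
  · filter_upwards [ae_restrict_mem measurableSet_Ioi] with t ht
    have : 0 < t := ht
    positivity

lemma tsum_ofReal_pow_div_factorial {y : ℝ} (hy : 0 ≤ y) :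
    ∑' j : ℕ, ENNReal.ofReal (y ^ j / j.factorial) = ENNReal.ofReal (Real.exp y) := by
  rw [← ENNReal.ofReal_tsum_of_nonneg (fun j => by positivity)
    (Real.summable_pow_div_factorial y), Real.exp_eq_exp_ℝ, NormedSpace.exp_eq_tsum_div]

/-- The binomial series: with `Γ(a + j)` written as an integral, the sum over `j` inside turns
`e^{-t}` into `e^{-(1-x)t}`. Nonnegative terms in `ENNReal` make the interchange unconditional. -/
lemma tsum_ofReal_Gamma_mul_pow {a x : ℝ} (ha : 0 < a) (hx : 0 < x) (hx1 : x < 1) :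
    ∑' j : ℕ, ENNReal.ofReal (Real.Gamma (a + j) / j.factorial * x ^ j) =
      ENNReal.ofReal (Real.Gamma a * (1 - x) ^ (-a)) := by
  have h1 : ∀ j : ℕ, ENNReal.ofReal (Real.Gamma (a + j) / j.factorial * x ^ j) =
      ∫⁻ t in Set.Ioi (0 : ℝ), ENNReal.ofReal (t ^ (a - 1) * Real.exp (-t)) *
        ENNReal.ofReal ((x * t) ^ j / j.factorial) := fun j => by
    have h2 := lintegral_rpow_mul_exp (p := a + j) (r := 1) (by positivity) one_pos
    have h3 : ENNReal.ofReal (Real.Gamma (a + j) / j.factorial * x ^ j) =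
        ENNReal.ofReal (x ^ j / j.factorial) *
          ENNReal.ofReal ((1 / 1) ^ (a + j) * Real.Gamma (a + j)) := by
      rw [← ENNReal.ofReal_mul (by positivity)]
      congr 1
      simp
      ring
    rw [h3, ← h2, ← lintegral_const_mul _ (by fun_prop)]
    refine setLIntegral_congr_fun measurableSet_Ioi fun t ht => ?_
    have ht : 0 < t := ht
    rw [← ENNReal.ofReal_mul (by positivity), ← ENNReal.ofReal_mul (by positivity)]
    congr 1
    rw [show a + (j : ℝ) - 1 = (a - 1) + j by ring, Real.rpow_add ht, Real.rpow_natCast, one_mul,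
      mul_pow]
    ring
  simp only [h1]
  rw [← lintegral_tsum (fun j => by fun_prop)]
  have h4 := lintegral_rpow_mul_exp (p := a) (r := 1 - x) ha (by linarith)
  rw [Real.rpow_neg (by linarith), mul_comm (Real.Gamma a), ← Real.inv_rpow (by linarith),
    ← one_div, ← h4]
  refine setLIntegral_congr_fun measurableSet_Ioi fun t ht => ?_
  have ht : 0 < t := ht
  rw [ENNReal.tsum_mul_left, tsum_ofReal_pow_div_factorial (by positivity),
    ← ENNReal.ofReal_mul (by positivity), mul_assoc, ← Real.exp_add]
  congr 3
  ring

/-- Gauss's summation theorem for the hypergeometric series at `1`. -/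
lemma tsum_ofReal_hypergeometric {a b c : ℝ} (ha : 0 < a) (hb : 0 < b) (hc : a + b < c) :
    ∑' j : ℕ, ENNReal.ofReal
      (Real.Gamma (a + j) * Real.Gamma (b + j) / (j.factorial * Real.Gamma (c + j))) =
      ENNReal.ofReal (Real.Gamma a * Real.Gamma b * Real.Gamma (c - a - b) /
        (Real.Gamma (c - a) * Real.Gamma (c - b))) := by
  have hcb : 0 < Real.Gamma (c - b) := Real.Gamma_pos_of_pos (by linarith)
  -- Euler's integral: `Γ(b + j) / Γ(c + j)` is a Beta integral over `Γ(c - b)`. Summing the powers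
  -- of `x` by the binomial series contributes `(1 - x)^{-a}` and leaves a single Beta integral,
  -- which needs `a + b < c`.
  have h1 : ∀ j : ℕ, ENNReal.ofReal
      (Real.Gamma (a + j) * Real.Gamma (b + j) / (j.factorial * Real.Gamma (c + j))) =
      ENNReal.ofReal (Real.Gamma (c - b))⁻¹ * ∫⁻ x in Set.Ioo (0 : ℝ) 1,
        ENNReal.ofReal (x ^ (b - 1) * (1 - x) ^ (c - b - 1)) *
        ENNReal.ofReal (Real.Gamma (a + j) / j.factorial * x ^ j) := fun j => by
    have hj : 0 < Real.Gamma (a + j) := Real.Gamma_pos_of_pos (by positivity)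
    have h2 := lintegral_rpow_mul_one_sub_rpow (p := b + j) (q := c - b) (by positivity)
      (by linarith)
    have h3 : ∫⁻ x in Set.Ioo (0 : ℝ) 1,
        ENNReal.ofReal (x ^ (b - 1) * (1 - x) ^ (c - b - 1)) *
        ENNReal.ofReal (Real.Gamma (a + j) / j.factorial * x ^ j) =
        ENNReal.ofReal (Real.Gamma (a + j) / j.factorial) * ∫⁻ x in Set.Ioo (0 : ℝ) 1,
        ENNReal.ofReal (x ^ (b + j - 1) * (1 - x) ^ (c - b - 1)) := by
      rw [← lintegral_const_mul _ (by fun_prop)]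
      refine setLIntegral_congr_fun measurableSet_Ioo fun x hx => ?_
      have hx0 : 0 < x := hx.1
      have hx1 : 0 < 1 - x := by linarith [hx.2]
      rw [← ENNReal.ofReal_mul (by positivity), ← ENNReal.ofReal_mul (by positivity)]
      congr 1
      rw [show b + (j : ℝ) - 1 = (b - 1) + j by ring, Real.rpow_add hx0, Real.rpow_natCast]
      ring
    rw [h3, h2, ← ENNReal.ofReal_mul (by positivity), ← ENNReal.ofReal_mul (by positivity)]
    congr 1
    rw [show b + (j : ℝ) + (c - b) = c + j by ring]
    field_simp
  simp only [h1]
  rw [ENNReal.tsum_mul_left, ← lintegral_tsum (fun j => by fun_prop)]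
  have h4 := lintegral_rpow_mul_one_sub_rpow (p := b) (q := c - a - b) hb (by linarith)
  have h5 : ∫⁻ x in Set.Ioo (0 : ℝ) 1, ∑' j : ℕ,
      ENNReal.ofReal (x ^ (b - 1) * (1 - x) ^ (c - b - 1)) *
        ENNReal.ofReal (Real.Gamma (a + j) / j.factorial * x ^ j) =
      ENNReal.ofReal (Real.Gamma a) * ∫⁻ x in Set.Ioo (0 : ℝ) 1,
        ENNReal.ofReal (x ^ (b - 1) * (1 - x) ^ (c - a - b - 1)) := by
    rw [← lintegral_const_mul _ (by fun_prop)]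
    refine setLIntegral_congr_fun measurableSet_Ioo fun x hx => ?_
    have hx0 : 0 < x := hx.1
    have hx1 : 0 < 1 - x := by linarith [hx.2]
    have hga : 0 < Real.Gamma a := Real.Gamma_pos_of_pos ha
    rw [ENNReal.tsum_mul_left, tsum_ofReal_Gamma_mul_pow ha hx0 hx.2,
      ← ENNReal.ofReal_mul (by positivity), ← ENNReal.ofReal_mul (by positivity)]
    congr 1
    rw [show c - a - b - 1 = (c - b - 1) + -a by ring, Real.rpow_add hx1]
    ring
  have hga : 0 < Real.Gamma a := Real.Gamma_pos_of_pos ha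
  rw [h5, h4, ← ENNReal.ofReal_mul hga.le, ← ENNReal.ofReal_mul (by positivity)]
  congr 1
  rw [show b + (c - a - b) = c - a by ring]
  field_simp

/-- Put `b = k + d/2 - s` and `c = d/2 + k`. Duplication splits `Γ(b + 2j)`, and its power of two
cancels the `2^{-2j}` in `fhCoeff`. What remains is a hypergeometric series at `1` with parameters
`b/2`, `b/2 + 1/2` and `c`. Its convergence parameter is `s - 1/2`, which is where `s > 1/2` is
decisive. -/
lemma tsum_fhCoeff_mul_Gamma {d : ℕ} (hd : 2 ≤ d) {s : ℝ} (hs : 1 / 2 < s) (hs' : s < (d : ℝ) / 2)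
    (k : ℕ) :
    ∑' j : ℕ, ENNReal.ofReal (fhCoeff d k j * Real.Gamma (k + (d : ℝ) / 2 - s + 2 * j)) =
      ENNReal.ofReal ((2 * Real.pi) ^ ((d : ℝ) / 2) * 2 ^ (1 - s) * Real.Gamma (2 * s - 1) *
        Real.Gamma (k + (d : ℝ) / 2 - s) /
        (Real.Gamma s * Real.Gamma (k + (d : ℝ) / 2 - 1 + s))) := by
  set c : ℝ := (d : ℝ) / 2 + k with hc
  have hd' : (2 : ℝ) ≤ d := by exact_mod_cast hd
  have hk : (0 : ℝ) ≤ k := k.cast_nonneg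
  set b : ℝ := k + (d : ℝ) / 2 - s with hb
  have hb0 : 0 < b := by linarith
  have hπ := Real.pi_pos
  have h1 : ∀ j : ℕ, ENNReal.ofReal (fhCoeff d k j * Real.Gamma (b + 2 * j)) =
      ENNReal.ofReal ((2 * Real.pi) ^ ((d : ℝ) / 2) * 2 ^ (b - c) / √Real.pi) *
        ENNReal.ofReal (Real.Gamma (b / 2 + j) * Real.Gamma (b / 2 + 1 / 2 + j) /
          (j.factorial * Real.Gamma (c + j))) := fun j => by
    rw [← ENNReal.ofReal_mul (by positivity)]
    congr 1
    have h2 := Real.Gamma_mul_Gamma_add_half (b / 2 + j)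
    rw [show b / 2 + 1 / 2 + (j : ℝ) = b / 2 + j + 1 / 2 by ring, h2, fhCoeff, ← hc,
      show 2 * (b / 2 + (j : ℝ)) = b + 2 * j by ring,
      show (1 : ℝ) - (b + 2 * j) = 1 + -b - j - j by ring,
      show b - c = -(-b) + -c by ring, show c + (j : ℝ) - 1 = -(-c) + j + -1 by ring,
      Real.rpow_sub_natCast (by norm_num), Real.rpow_sub_natCast (by norm_num),
      Real.rpow_add (by norm_num), Real.rpow_add (by norm_num), Real.rpow_add (by norm_num),
      Real.rpow_natCast, Real.rpow_neg (by norm_num) (-b),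
      Real.rpow_neg (by norm_num) (-c), Real.rpow_neg_one,
      Real.rpow_add (by norm_num) 1 (-b), Real.rpow_one]
    have hcj : 0 < Real.Gamma (c + j) := Real.Gamma_pos_of_pos (by positivity)
    have hx : (0 : ℝ) < 2 ^ (-b) := by positivity
    have hy : (0 : ℝ) < 2 ^ (-c) := by positivity
    field_simp
  simp only [h1]
  have hcs : b / 2 + (b / 2 + 1 / 2) < c := by linarith
  rw [ENNReal.tsum_mul_left, tsum_ofReal_hypergeometric (by positivity) (by positivity) hcs,
    ← ENNReal.ofReal_mul (by positivity)]
  congr 1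
  -- Three more duplications recombine the half-argument Gamma factors. The last one turns `Γ(s -
  -- 1/2)` into `Γ(2s - 1) / Γ(s)` up to constants.
  have e1 := Real.Gamma_mul_Gamma_add_half (b / 2)
  have e2 := Real.Gamma_mul_Gamma_add_half (c - (b / 2 + 1 / 2))
  have e3 := Real.Gamma_mul_Gamma_add_half (s - 1 / 2)
  rw [show 2 * (b / 2) = b by ring] at e1
  rw [show c - (b / 2 + 1 / 2) + 1 / 2 = c - b / 2 by ring,
    show 2 * (c - (b / 2 + 1 / 2)) = k + (d : ℝ) / 2 - 1 + s by rw [hc, hb]; ring] at e2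
  rw [show s - 1 / 2 + 1 / 2 = s by ring, show 2 * (s - 1 / 2) = 2 * s - 1 by ring] at e3
  rw [e1, show c - b / 2 - (b / 2 + 1 / 2) = s - 1 / 2 by rw [hc, hb]; ring,
    mul_comm (Real.Gamma (c - b / 2)), e2]
  have hgs : 0 < Real.Gamma s := Real.Gamma_pos_of_pos (by linarith)
  rw [← eq_div_iff hgs.ne'] at e3
  rw [e3]
  have hgc : 0 < Real.Gamma (k + (d : ℝ) / 2 - 1 + s) := Real.Gamma_pos_of_pos (by linarith)
  have h2 : (2 : ℝ) ^ (b - c) * 2 ^ (1 - b) * 2 ^ (1 - (2 * s - 1)) =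
      2 ^ (1 - s) * 2 ^ (1 - (k + (d : ℝ) / 2 - 1 + s)) := by
    rw [← Real.rpow_add (by norm_num), ← Real.rpow_add (by norm_num),
      ← Real.rpow_add (by norm_num)]
    congr 1
    rw [hc, hb]
    ring
  have hz : (0 : ℝ) < 2 ^ (1 - (k + (d : ℝ) / 2 - 1 + s)) := by positivity
  have hsq : 0 < √Real.pi := by positivity
  rw [div_mul_div_comm, div_eq_div_iff (by positivity) (by positivity)]
  rw [mul_div_assoc', mul_div_assoc', div_mul_eq_mul_div, div_eq_iff hgs.ne']
  linear_combination ((2 * Real.pi) ^ ((d : ℝ) / 2) * Real.Gamma b * Real.Gamma (2 * s - 1) *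
    √Real.pi * √Real.pi * Real.Gamma s *
      Real.Gamma (k + (d : ℝ) / 2 - 1 + s)) * h2

/-! ### The weighted radial integral of the squared multiplier. -/

section
variable {d : ℕ}

/-- The multiplier of the Fourier transform of spherical harmonics of degree `k` times surface
measure, at radius `r`. -/
def extMul (d k : ℕ) (r : ℝ) : ℂ := fhMul d k (-(Complex.I * r))

lemma continuous_fhMul (hd : 2 ≤ d) (k : ℕ) : Continuous (fhMul d k) := by
  obtain ⟨p, hp, η, hη⟩ := exists_harmonicPoly_eval_ne_zero hd k
  have h : fhMul d k = fun z => (∫ ω : Sph d, evalEu p ω *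
      Complex.exp (z * ((inner ℝ (ω : Eu d) (η : Eu d) : ℝ) : ℂ)) ∂(surf d)) / evalEu p η := by
    funext z
    rw [integral_harmonic_mul_exp hd hp, mul_div_cancel_right₀ _ hη]
  rw [h]
  have hc := continuous_evalEu p
  refine Continuous.div_const ?_ _
  have h2 := continuous_parametric_integral_of_continuous (μ := surf d) (s := Set.univ)
    (f := fun (z : ℂ) (ω : Sph d) => evalEu p ω *
      Complex.exp (z * ((inner ℝ (ω : Eu d) (η : Eu d) : ℝ) : ℂ))) (by fun_prop) isCompact_univ
  simpa using h2

lemma continuous_extMul (hd : 2 ≤ d) (k : ℕ) : Continuous (extMul d k) :=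
  (continuous_fhMul hd k).comp (by fun_prop)

/-- The Gaussian integral of the Fourier transform of a measure with density on the sphere. -/
lemma integral_exp_mul_ext_mul_conj (p : MvPolynomial (Fin d) ℂ) {u : ℝ} (hu : 0 < u) :
    ∫ ξ : Eu d, (Real.exp (-‖ξ‖ ^ 2 / (2 * u)) : ℂ) *
      ((∫ ω : Sph d, evalEu p ω * Complex.exp (-(Complex.I * ((inner ℝ (ω : Eu d) ξ : ℝ) : ℂ)))
        ∂(surf d)) *
      starRingEnd ℂ (∫ ω : Sph d, evalEu p ω *
        Complex.exp (-(Complex.I * ((inner ℝ (ω : Eu d) ξ : ℝ) : ℂ))) ∂(surf d))) =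
    (((2 * Real.pi * u) ^ ((d : ℝ) / 2) * Real.exp (-u) : ℝ) : ℂ) *
      ∫ ω' : Sph d, starRingEnd ℂ (evalEu p ω') * ∫ ω : Sph d, evalEu p ω *
        Complex.exp (u * ((inner ℝ (ω : Eu d) (ω' : Eu d) : ℝ) : ℂ)) ∂(surf d) ∂(surf d) := by
  have hc := continuous_evalEu p
  obtain ⟨c, m, hc0, hb⟩ := norm_evalEu_le p
  have hb' : ∀ ω : Sph d, ‖evalEu p ω‖ ≤ c * 2 ^ m := fun ω => by
    have := hb (ω : Eu d)
    rw [norm_coe_sph] at this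
    convert this using 3
    norm_num
  have hu' : (u : ℂ) ≠ 0 := by exact_mod_cast hu.ne'
  -- the integrand on the product
  set Φ : Eu d × (Sph d × Sph d) → ℂ := fun q =>
    (Real.exp (-‖q.1‖ ^ 2 / (2 * u)) : ℂ) *
      ((evalEu p q.2.1 * Complex.exp (-(Complex.I * ((inner ℝ (q.2.1 : Eu d) q.1 : ℝ) : ℂ)))) *
      starRingEnd ℂ (evalEu p q.2.2 *
        Complex.exp (-(Complex.I * ((inner ℝ (q.2.2 : Eu d) q.1 : ℝ) : ℂ))))) with hΦ
  have hexp : ∀ t : ℝ, ‖Complex.exp (-(Complex.I * (t : ℂ)))‖ = 1 := fun t => by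
    rw [show -(Complex.I * (t : ℂ)) = ((-t : ℝ) : ℂ) * Complex.I by push_cast; ring]
    exact Complex.norm_exp_ofReal_mul_I _
  have hG : ∀ w : Eu d, ∫ ξ : Eu d, (Real.exp (-‖ξ‖ ^ 2 / (2 * u)) : ℂ) *
      Complex.exp (-(Complex.I * ((inner ℝ w ξ : ℝ) : ℂ))) =
      (((2 * Real.pi * u) ^ ((d : ℝ) / 2) * Real.exp (-(u * ‖w‖ ^ 2 / 2)) : ℝ) : ℂ) := fun w => by
    have h := GaussianFourier.integral_cexp_neg_mul_sq_norm_add (V := Eu d) (b := 1 / (2 * u))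
      (by
        rw [show (1 / (2 * u) : ℂ) = ((1 / (2 * u) : ℝ) : ℂ) by push_cast; rfl, Complex.ofReal_re]
        positivity) (-Complex.I) w
    rw [finrank_euclideanSpace_fin] at h
    have h2 : ∀ ξ : Eu d, (Real.exp (-‖ξ‖ ^ 2 / (2 * u)) : ℂ) *
        Complex.exp (-(Complex.I * ((inner ℝ w ξ : ℝ) : ℂ))) =
        Complex.exp (-(1 / (2 * u)) * ‖ξ‖ ^ 2 + -Complex.I * ((inner ℝ w ξ : ℝ) : ℂ)) := fun ξ => by
      rw [Complex.exp_add, Complex.ofReal_exp]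
      push_cast
      congr 2 <;> ring
    simp only [h2]
    rw [h]
    push_cast
    rw [Complex.ofReal_cpow (by positivity)]
    push_cast
    congr 2
    · field_simp
    · rw [neg_sq, Complex.I_sq]
      field_simp
      ring
  have hint0 : Integrable fun ξ : Eu d => Real.exp (-‖ξ‖ ^ 2 / (2 * u)) := by
    have h := GaussianFourier.integrable_cexp_neg_mul_sq_norm_add (V := Eu d) (b := 1 / (2 * u))
      (by
        rw [show (1 / (2 * u) : ℂ) = ((1 / (2 * u) : ℝ) : ℂ) by push_cast; rfl, Complex.ofReal_re]
        positivity) 0 0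
    refine h.norm.congr (Eventually.of_forall fun ξ => ?_)
    simp only [Complex.norm_exp]
    congr 1
    rw [show -(1 / (2 * (u : ℂ))) * (‖ξ‖ : ℂ) ^ 2 + 0 * ((inner ℝ (0 : Eu d) ξ : ℝ) : ℂ) =
      ((-‖ξ‖ ^ 2 / (2 * u) : ℝ) : ℂ) by push_cast; ring, Complex.ofReal_re]
  have hint : Integrable Φ (volume.prod ((surf d).prod (surf d))) := by
    have h1 : Integrable (fun q : Eu d × (Sph d × Sph d) =>
        Real.exp (-‖q.1‖ ^ 2 / (2 * u)) * ((c * 2 ^ m) * (c * 2 ^ m)))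
        (volume.prod ((surf d).prod (surf d))) :=
      hint0.mul_prod (integrable_const ((c * 2 ^ m) * (c * 2 ^ m)))
    refine h1.mono' ?_ (Eventually.of_forall fun q => ?_)
    · refine Continuous.aestronglyMeasurable ?_
      have := Complex.continuous_conj
      fun_prop
    · simp only [hΦ]
      rw [norm_mul, norm_mul, RCLike.norm_conj, norm_mul, norm_mul, hexp, hexp, mul_one, mul_one,
        Complex.norm_real, Real.norm_eq_abs, Real.abs_exp]
      gcongr
      · exact hb' _
      · exact hb' _
  have hL : ∀ ξ : Eu d, (Real.exp (-‖ξ‖ ^ 2 / (2 * u)) : ℂ) *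
      ((∫ ω : Sph d, evalEu p ω * Complex.exp (-(Complex.I * ((inner ℝ (ω : Eu d) ξ : ℝ) : ℂ)))
        ∂(surf d)) *
      starRingEnd ℂ (∫ ω : Sph d, evalEu p ω *
        Complex.exp (-(Complex.I * ((inner ℝ (ω : Eu d) ξ : ℝ) : ℂ))) ∂(surf d))) =
      ∫ q, Φ (ξ, q) ∂((surf d).prod (surf d)) := fun ξ => by
    rw [← integral_conj, ← integral_prod_mul, ← integral_const_mul]
  simp only [hL]
  rw [integral_integral_swap (f := fun ξ q => Φ (ξ, q)) hint]
  have hR : ∀ q : Sph d × Sph d, ∫ ξ, Φ (ξ, q) =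
      (((2 * Real.pi * u) ^ ((d : ℝ) / 2) * Real.exp (-u) : ℝ) : ℂ) *
      (starRingEnd ℂ (evalEu p q.2) * (evalEu p q.1 *
        Complex.exp (u * ((inner ℝ (q.1 : Eu d) (q.2 : Eu d) : ℝ) : ℂ)))) := fun q => by
    have h1 : ∀ ξ, Φ (ξ, q) = (evalEu p q.1 * starRingEnd ℂ (evalEu p q.2)) *
        ((Real.exp (-‖ξ‖ ^ 2 / (2 * u)) : ℂ) *
        Complex.exp (-(Complex.I * ((inner ℝ ((q.1 : Eu d) - q.2) ξ : ℝ) : ℂ)))) := fun ξ => by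
      simp only [hΦ]
      rw [map_mul, ← Complex.exp_conj, inner_sub_left,
        show -(Complex.I * (((inner ℝ (q.1 : Eu d) ξ : ℝ) - (inner ℝ (q.2 : Eu d) ξ : ℝ) : ℝ) : ℂ)) =
          -(Complex.I * ((inner ℝ (q.1 : Eu d) ξ : ℝ) : ℂ)) +
          starRingEnd ℂ (-(Complex.I * ((inner ℝ (q.2 : Eu d) ξ : ℝ) : ℂ))) by
          rw [map_neg, map_mul, Complex.conj_I, Complex.conj_ofReal]; push_cast; ring,
        Complex.exp_add]
      ring
    simp only [h1]
    rw [integral_const_mul, hG]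
    -- For unit vectors `‖ω - ω'‖² = 2 - 2⟨ω, ω'⟩`, so the transformed Gaussian is `e^{-u}` times
    -- the kernel `exp(u⟨ω, ω'⟩)`, to which Funk-Hecke applies at the real point `u`.
    have h2 : -(u * ‖(q.1 : Eu d) - q.2‖ ^ 2 / 2) =
        -u + u * inner ℝ (q.1 : Eu d) (q.2 : Eu d) := by
      rw [norm_sub_sq_real, norm_coe_sph, norm_coe_sph]
      ring
    rw [h2, Real.exp_add]
    push_cast
    ring
  simp only [hR]
  rw [integral_const_mul]
  congr 1
  have hint2 : Integrable (fun q : Sph d × Sph d => starRingEnd ℂ (evalEu p q.2) * (evalEu p q.1 *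
        Complex.exp (u * ((inner ℝ (q.1 : Eu d) (q.2 : Eu d) : ℝ) : ℂ))))
        ((surf d).prod (surf d)) := by
    refine Continuous.integrable_of_hasCompactSupport ?_ (HasCompactSupport.of_compactSpace _)
    have := Complex.continuous_conj
    fun_prop
  rw [integral_prod_symm _ hint2]
  simp only [integral_const_mul]

/-- The integral of `‖p‖²` over the sphere. -/
def sphNormSq (p : MvPolynomial (Fin d) ℂ) : ℝ := ∫ ω : Sph d, ‖evalEu p ω‖ ^ 2 ∂(surf d)

lemma surf_isOpenPosMeasure (hd : 2 ≤ d) : (surf d).IsOpenPosMeasure := by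
  have : Nontrivial (Eu d) :=
    Module.nontrivial_of_finrank_pos (R := ℝ) (by rw [finrank_euclideanSpace_fin]; omega)
  infer_instance

lemma sphNormSq_pos (hd : 2 ≤ d) {p : MvPolynomial (Fin d) ℂ} {η : Sph d} (h : evalEu p η ≠ 0) :
    0 < sphNormSq p := by
  have := surf_isOpenPosMeasure hd
  have hc := continuous_evalEu p
  refine Continuous.integral_pos_of_hasCompactSupport_nonneg_nonzero (x := η) (by fun_prop)
    (HasCompactSupport.of_compactSpace _) (fun ω => by positivity) ?_
  simpa using h

lemma lintegral_sq_norm_evalEu (p : MvPolynomial (Fin d) ℂ) :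
    ∫⁻ ω : Sph d, ‖evalEu p ω‖ₑ ^ 2 ∂(surf d) = ENNReal.ofReal (sphNormSq p) := by
  have hc := continuous_evalEu p
  rw [sphNormSq, ofReal_integral_eq_lintegral_ofReal]
  · simp only [ENNReal.ofReal_pow (norm_nonneg _), ofReal_norm]
  · exact Continuous.integrable_of_hasCompactSupport (by fun_prop)
      (HasCompactSupport.of_compactSpace _)
  · exact Eventually.of_forall fun ω => by positivity

lemma hasSum_fhMul_real (hd : 2 ≤ d) (k : ℕ) (u : ℝ) :
    HasSum (fun j => fhCoeff d k j * u ^ (k + 2 * j)) (fhMul d k u).re ∧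
      fhMul d k u = ((fhMul d k u).re : ℂ) := by
  have h := hasSum_fhMul hd k (u : ℂ)
  have h1 := Complex.hasSum_re h
  have h2 : ∀ j, (fhCoeff d k j : ℂ) * (u : ℂ) ^ (k + 2 * j) =
    ((fhCoeff d k j * u ^ (k + 2 * j) : ℝ) : ℂ) := fun j => by push_cast; rfl
  simp only [h2] at h h1
  simp only [Complex.ofReal_re] at h1
  refine ⟨h1, ?_⟩
  exact h.unique (Complex.hasSum_ofReal.2 h1)

lemma ext_poly_smul (hd : 2 ≤ d) {k : ℕ} {p : MvPolynomial (Fin d) ℂ} (hp : p ∈ harmonicPoly d k)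
    (r : ℝ) (η : Sph d) :
    ∫ ω : Sph d, evalEu p ω *
      Complex.exp (-(Complex.I * ((inner ℝ (ω : Eu d) (r • (η : Eu d)) : ℝ) : ℂ))) ∂(surf d) =
    extMul d k r * evalEu p η := by
  rw [extMul, ← integral_harmonic_mul_exp hd hp]
  refine integral_congr_ae (Eventually.of_forall fun ω => ?_)
  simp only [inner_smul_right]
  push_cast
  ring_nf

/-- The Gaussian average of `|(p dσ)^|²` for one harmonic `p` is computed twice. Polar coordinates
give the left side times `‖p‖²`, while Fubini and Funk-Hecke give the right side times `‖p‖²`. At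
real `u > 0` the series of the multiplier has positive terms. -/
lemma lintegral_exp_mul_extMul (hd : 2 ≤ d) (k : ℕ) {u : ℝ} (hu : 0 < u) :
    ∫⁻ r in Set.Ioi (0 : ℝ), ENNReal.ofReal (r ^ (d - 1)) *
      (ENNReal.ofReal (Real.exp (-r ^ 2 / (2 * u))) * ‖extMul d k r‖ₑ ^ 2) =
    ENNReal.ofReal ((2 * Real.pi * u) ^ ((d : ℝ) / 2) * Real.exp (-u)) *
      ∑' j, ENNReal.ofReal (fhCoeff d k j * u ^ (k + 2 * j)) := by
  obtain ⟨p, hp, η, hη⟩ := exists_harmonicPoly_eval_ne_zero hd k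
  have hN := sphNormSq_pos hd hη
  have hc := continuous_evalEu p
  obtain ⟨hm1, hm2⟩ := hasSum_fhMul_real hd k u
  have hmpos : ∀ j, 0 < fhCoeff d k j * u ^ (k + 2 * j) := fun j => by
    have := fhCoeff_pos hd k j
    positivity
  have hm0 : 0 < (fhMul d k u).re := by
    rw [← hm1.tsum_eq]
    exact hm1.summable.tsum_pos (fun j => (hmpos j).le) 0 (hmpos 0)
  set X : Eu d → ℂ := fun ξ => ∫ ω : Sph d, evalEu p ω *
    Complex.exp (-(Complex.I * ((inner ℝ (ω : Eu d) ξ : ℝ) : ℂ))) ∂(surf d) with hX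
  have hXc : Continuous X := by
    have h2 := continuous_parametric_integral_of_continuous (μ := surf d) (s := Set.univ)
      (f := fun (ξ : Eu d) (ω : Sph d) => evalEu p ω *
        Complex.exp (-(Complex.I * ((inner ℝ (ω : Eu d) ξ : ℝ) : ℂ)))) (by fun_prop) isCompact_univ
    simpa using h2
  have key := integral_exp_mul_ext_mul_conj p hu
  have hR : ∫ ω' : Sph d, starRingEnd ℂ (evalEu p ω') * ∫ ω : Sph d, evalEu p ω *
        Complex.exp (u * ((inner ℝ (ω : Eu d) (ω' : Eu d) : ℝ) : ℂ)) ∂(surf d) ∂(surf d) =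
      (((fhMul d k u).re * sphNormSq p : ℝ) : ℂ) := by
    simp only [integral_harmonic_mul_exp hd hp]
    have h1 : ∀ ω' : Sph d, starRingEnd ℂ (evalEu p ω') * (fhMul d k u * evalEu p ω') =
        (((fhMul d k u).re * ‖evalEu p ω'‖ ^ 2 : ℝ) : ℂ) := fun ω' => by
      rw [mul_left_comm, ← Complex.normSq_eq_conj_mul_self, Complex.normSq_eq_norm_sq, hm2]
      push_cast
      simp
    simp only [h1]
    rw [integral_complex_ofReal, integral_const_mul, sphNormSq]
  rw [hR] at key
  have h1 : ∀ ξ : Eu d, (Real.exp (-‖ξ‖ ^ 2 / (2 * u)) : ℂ) * (X ξ * starRingEnd ℂ (X ξ)) =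
      ((Real.exp (-‖ξ‖ ^ 2 / (2 * u)) * ‖X ξ‖ ^ 2 : ℝ) : ℂ) := fun ξ => by
    rw [Complex.mul_conj, Complex.normSq_eq_norm_sq]
    push_cast
    ring
  change ∫ ξ : Eu d, (Real.exp (-‖ξ‖ ^ 2 / (2 * u)) : ℂ) * (X ξ * starRingEnd ℂ (X ξ)) = _ at key
  simp only [h1] at key
  rw [integral_complex_ofReal, ← Complex.ofReal_mul, Complex.ofReal_inj] at key
  set Q : ℝ := (2 * Real.pi * u) ^ ((d : ℝ) / 2) * Real.exp (-u) with hQ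
  have hQ0 : 0 < Q := by have := Real.pi_pos; positivity
  have hint : Integrable fun ξ : Eu d => Real.exp (-‖ξ‖ ^ 2 / (2 * u)) * ‖X ξ‖ ^ 2 := by
    by_contra hni
    rw [integral_undef hni] at key
    have : 0 < Q * ((fhMul d k u).re * sphNormSq p) := by positivity
    exact this.ne key
  have h2 := ofReal_integral_eq_lintegral_ofReal hint
    (Eventually.of_forall fun ξ => by positivity)
  rw [key, lintegral_polar hd (by fun_prop)] at h2
  have h3 : ∀ r ∈ Set.Ioi (0 : ℝ), ENNReal.ofReal (r ^ (d - 1)) *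
      ∫⁻ ω : Sph d, ENNReal.ofReal (Real.exp (-‖r • (ω : Eu d)‖ ^ 2 / (2 * u)) *
        ‖X (r • (ω : Eu d))‖ ^ 2) ∂(surf d) =
      ENNReal.ofReal (r ^ (d - 1)) *
      (ENNReal.ofReal (Real.exp (-r ^ 2 / (2 * u))) * ‖extMul d k r‖ₑ ^ 2) *
        ENNReal.ofReal (sphNormSq p) := fun r hr => by
    have h4 : ∀ ω : Sph d, ENNReal.ofReal (Real.exp (-‖r • (ω : Eu d)‖ ^ 2 / (2 * u)) *
        ‖X (r • (ω : Eu d))‖ ^ 2) =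
        (ENNReal.ofReal (Real.exp (-r ^ 2 / (2 * u))) * ‖extMul d k r‖ₑ ^ 2) *
          ‖evalEu p ω‖ₑ ^ 2 := fun ω => by
      have h5 : X (r • (ω : Eu d)) = extMul d k r * evalEu p ω := ext_poly_smul hd hp r ω
      rw [h5, ENNReal.ofReal_mul (by positivity), ENNReal.ofReal_pow (by positivity), ofReal_norm,
        enorm_mul, norm_smul, norm_coe_sph, mul_one, Real.norm_eq_abs, sq_abs, mul_pow, mul_assoc]
    simp only [h4]
    have h7 : Continuous fun ω : Sph d => ‖evalEu p ω‖ₑ ^ 2 := by fun_prop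
    rw [lintegral_const_mul _ h7.measurable, lintegral_sq_norm_evalEu]
    simp only [mul_assoc]
  have hmeas := continuous_extMul hd k
  rw [setLIntegral_congr_fun measurableSet_Ioi h3, lintegral_mul_const _ (by fun_prop),
    ← mul_assoc Q, ENNReal.ofReal_mul (by positivity)] at h2
  have h6 := (ENNReal.mul_left_inj (by simpa using hN) ENNReal.ofReal_ne_top).1 h2
  rw [← h6, ← ENNReal.ofReal_tsum_of_nonneg (fun j => (hmpos j).le) hm1.summable, hm1.tsum_eq,
    ENNReal.ofReal_mul hQ0.le]

/-- The Gamma integral after `u ↦ 1/u`. It exhibits `r^{-2s}` as a superposition of Gaussians in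
`r`. -/
lemma lintegral_rpow_mul_exp_div {s r : ℝ} (hs : 0 < s) (hr : 0 < r) :
    ∫⁻ u in Set.Ioi (0 : ℝ), ENNReal.ofReal (u ^ (-s - 1) * Real.exp (-r ^ 2 / (2 * u))) =
      ENNReal.ofReal (2 ^ s * Real.Gamma s * r ^ (-(2 * s))) := by
  have h := Real.integral_rpow_mul_exp_neg_mul_Ioi (a := s) (r := r ^ 2 / 2) hs (by positivity)
  have hpos : 0 < (1 / (r ^ 2 / 2)) ^ s * Real.Gamma s :=
    mul_pos (by positivity) (Real.Gamma_pos_of_pos hs)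
  rw [← integral_comp_rpow_Ioi _ (p := -1) (by norm_num)] at h
  have h2 : ∫ u in Set.Ioi (0 : ℝ), u ^ (-s - 1) * Real.exp (-r ^ 2 / (2 * u)) =
      (1 / (r ^ 2 / 2)) ^ s * Real.Gamma s := by
    rw [← h]
    refine setIntegral_congr_fun measurableSet_Ioi fun u hu => ?_
    have hu : 0 < u := hu
    simp only [smul_eq_mul, Real.rpow_neg_one, Real.inv_rpow hu.le]
    rw [← Real.rpow_neg hu.le, ← mul_assoc, mul_assoc _ (u ^ (-1 - 1 : ℝ)), ← Real.rpow_add hu]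
    norm_num
    congr 2
    · ring
    · field_simp
  have h3 : (1 / (r ^ 2 / 2)) ^ s * Real.Gamma s = 2 ^ s * Real.Gamma s * r ^ (-(2 * s)) := by
    rw [one_div_div, Real.div_rpow (by norm_num) (by positivity), ← Real.rpow_natCast r 2,
      ← Real.rpow_mul hr.le, Real.rpow_neg hr.le]
    push_cast
    ring
  rw [← h3, ← h2, ofReal_integral_eq_lintegral_ofReal]
  · by_contra hni
    rw [integral_undef hni] at h2
    exact hpos.ne h2
  · filter_upwards [ae_restrict_mem measurableSet_Ioi] with t ht
    have : 0 < t := ht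
    positivity

lemma lam_eq (d : ℕ) (s : ℝ) (θ : ℝ → ℂ) (k : ℕ) :
    lam d s θ k = lam d s 1 k * ‖θ (lbEigen d k)‖ ^ 2 := by
  simp [lam]

lemma lam_one_pos (hd : 2 ≤ d) {s : ℝ} (hs : 1 / 2 < s) (hs' : s < (d : ℝ) / 2) (k : ℕ) :
    0 < lam d s 1 k := by
  have hd' : (2 : ℝ) ≤ d := by exact_mod_cast hd
  have hk : (0 : ℝ) ≤ k := k.cast_nonneg
  have h1 : 0 < Real.Gamma (2 * s - 1) := Real.Gamma_pos_of_pos (by linarith)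
  have h2 : 0 < Real.Gamma (k + (d : ℝ) / 2 - s) := Real.Gamma_pos_of_pos (by linarith)
  have h3 : 0 < Real.Gamma s := Real.Gamma_pos_of_pos (by linarith)
  have h4 : 0 < Real.Gamma (k + (d : ℝ) / 2 - 1 + s) := Real.Gamma_pos_of_pos (by linarith)
  simp only [lam, Pi.one_apply, norm_one]
  positivity

/-- The weighted `L²` norm of the multiplier; this is the critical Weber-Schafheitlin integral
for the square of a Bessel function. -/
lemma lintegral_extMul_sq (hd : 2 ≤ d) {s : ℝ} (hs : 1 / 2 < s) (hs' : s < (d : ℝ) / 2) (k : ℕ) :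
    ∫⁻ r in Set.Ioi (0 : ℝ), ENNReal.ofReal (r ^ (d - 1)) *
      (ENNReal.ofReal (r ^ (-(2 * s))) * ‖extMul d k r‖ₑ ^ 2) =
    ENNReal.ofReal ((2 * Real.pi) ^ d * lam d s 1 k) := by
  have hs0 : 0 < s := by linarith
  have hπ := Real.pi_pos
  have hd' : (2 : ℝ) ≤ d := by exact_mod_cast hd
  have hk : (0 : ℝ) ≤ k := k.cast_nonneg
  have hgs : 0 < Real.Gamma s := Real.Gamma_pos_of_pos hs0
  have hmeas := continuous_extMul hd k
  set c : ℝ := 2 ^ s * Real.Gamma s with hc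
  have hc0 : 0 < c := by positivity
  -- Gaussian subordination of the weight, with normalising constant `c = 2^s Γ(s)`.
  have h1 : ENNReal.ofReal c * ∫⁻ r in Set.Ioi (0 : ℝ), ENNReal.ofReal (r ^ (d - 1)) *
      (ENNReal.ofReal (r ^ (-(2 * s))) * ‖extMul d k r‖ₑ ^ 2) =
      ∫⁻ r in Set.Ioi (0 : ℝ), ∫⁻ u in Set.Ioi (0 : ℝ), ENNReal.ofReal (u ^ (-s - 1)) *
        (ENNReal.ofReal (r ^ (d - 1)) *
        (ENNReal.ofReal (Real.exp (-r ^ 2 / (2 * u))) * ‖extMul d k r‖ₑ ^ 2)) := by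
    rw [← lintegral_const_mul _ (by fun_prop)]
    refine setLIntegral_congr_fun measurableSet_Ioi fun r hr => ?_
    have hr : 0 < r := hr
    have h2 : ∀ u ∈ Set.Ioi (0 : ℝ), ENNReal.ofReal (u ^ (-s - 1)) *
        (ENNReal.ofReal (r ^ (d - 1)) *
        (ENNReal.ofReal (Real.exp (-r ^ 2 / (2 * u))) * ‖extMul d k r‖ₑ ^ 2)) =
        (ENNReal.ofReal (r ^ (d - 1)) * ‖extMul d k r‖ₑ ^ 2) *
          ENNReal.ofReal (u ^ (-s - 1) * Real.exp (-r ^ 2 / (2 * u))) := fun u hu => by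
      have hu : 0 < u := hu
      rw [ENNReal.ofReal_mul (by positivity)]
      ring
    rw [setLIntegral_congr_fun measurableSet_Ioi h2, lintegral_const_mul _ (by fun_prop),
      lintegral_rpow_mul_exp_div hs0 hr, ENNReal.ofReal_mul hc0.le]
    ring
  -- With the order of integration exchanged, each power of `u` meets `e^{-u}` and integrates to a
  -- Gamma value. Its argument is positive because `s < d/2`.
  have h3 : ∫⁻ u in Set.Ioi (0 : ℝ), ∫⁻ r in Set.Ioi (0 : ℝ), ENNReal.ofReal (u ^ (-s - 1)) *
        (ENNReal.ofReal (r ^ (d - 1)) *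
        (ENNReal.ofReal (Real.exp (-r ^ 2 / (2 * u))) * ‖extMul d k r‖ₑ ^ 2)) =
      ∑' j, ENNReal.ofReal ((2 * Real.pi) ^ ((d : ℝ) / 2)) *
        ENNReal.ofReal (fhCoeff d k j * Real.Gamma (k + (d : ℝ) / 2 - s + 2 * j)) := by
    have h4 : ∀ u ∈ Set.Ioi (0 : ℝ), ∫⁻ r in Set.Ioi (0 : ℝ), ENNReal.ofReal (u ^ (-s - 1)) *
        (ENNReal.ofReal (r ^ (d - 1)) *
        (ENNReal.ofReal (Real.exp (-r ^ 2 / (2 * u))) * ‖extMul d k r‖ₑ ^ 2)) =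
        ∑' j, ENNReal.ofReal ((2 * Real.pi) ^ ((d : ℝ) / 2) * fhCoeff d k j) *
          ENNReal.ofReal (u ^ (k + (d : ℝ) / 2 - s + 2 * j - 1) * Real.exp (-(1 * u))) :=
        fun u hu => by
      have hu : 0 < u := hu
      rw [lintegral_const_mul _ (by fun_prop), lintegral_exp_mul_extMul hd k hu,
        ← ENNReal.tsum_mul_left, ← ENNReal.tsum_mul_left]
      refine tsum_congr fun j => ?_
      have := fhCoeff_pos hd k j
      rw [← ENNReal.ofReal_mul (by positivity), ← ENNReal.ofReal_mul (by positivity),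
        ← ENNReal.ofReal_mul (by positivity)]
      congr 1
      rw [Real.mul_rpow (by positivity) hu.le,
        show k + (d : ℝ) / 2 - s + 2 * j - 1 = (-s - 1) + (d : ℝ) / 2 + ((k + 2 * j : ℕ) : ℝ) by
          push_cast; ring, Real.rpow_add hu, Real.rpow_add hu, Real.rpow_natCast, one_mul]
      ring
    rw [setLIntegral_congr_fun measurableSet_Ioi h4, lintegral_tsum (fun j => by fun_prop)]
    refine tsum_congr fun j => ?_
    have := fhCoeff_pos hd k j
    have hb : 0 < k + (d : ℝ) / 2 - s + 2 * j := by
      have : (0 : ℝ) ≤ j := j.cast_nonneg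
      linarith
    rw [lintegral_const_mul _ (by fun_prop), lintegral_rpow_mul_exp hb one_pos,
      ← ENNReal.ofReal_mul (by positivity), ← ENNReal.ofReal_mul (by positivity)]
    congr 1
    simp
    ring
  rw [lintegral_lintegral_swap (by fun_prop), h3, ENNReal.tsum_mul_left,
    tsum_fhCoeff_mul_Gamma hd hs hs', ← ENNReal.ofReal_mul (by positivity)] at h1
  have hne : ENNReal.ofReal c ≠ 0 := by simpa using hc0
  rw [← ENNReal.mul_right_inj hne ENNReal.ofReal_ne_top, h1, ← ENNReal.ofReal_mul hc0.le]
  congr 1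
  have e1 : (2 * Real.pi) ^ d = (2 * Real.pi) ^ ((d : ℝ) / 2) * (2 * Real.pi) ^ ((d : ℝ) / 2) := by
    rw [← Real.rpow_natCast, ← Real.rpow_add (by positivity)]
    congr 1
    ring
  have e2 : (2 : ℝ) ^ (1 - s) = 2 ^ s * 2 ^ (1 - 2 * s) := by
    rw [← Real.rpow_add (by norm_num)]
    congr 1
    ring
  simp only [lam, Pi.one_apply, norm_one]
  rw [e1, e2, hc]
  field_simp

/-- The ratio of consecutive terms is `(k + d/2 - s) / (k + d/2 - 1 + s)`, at most `1` since `s >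
1/2`. This makes the case `θ = 1` admissible, so that the operator `A` exists whatever `θ` is. -/
lemma lam_one_succ_le (hd : 2 ≤ d) {s : ℝ} (hs : 1 / 2 < s) (hs' : s < (d : ℝ) / 2) (k : ℕ) :
    lam d s 1 (k + 1) ≤ lam d s 1 k := by
  have hd' : (2 : ℝ) ≤ d := by exact_mod_cast hd
  have hk : (0 : ℝ) ≤ k := k.cast_nonneg
  have h1 : 0 < Real.Gamma (2 * s - 1) := Real.Gamma_pos_of_pos (by linarith)
  have h2 : 0 < Real.Gamma (k + (d : ℝ) / 2 - s) := Real.Gamma_pos_of_pos (by linarith)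
  have h3 : 0 < Real.Gamma s := Real.Gamma_pos_of_pos (by linarith)
  have h4 : 0 < Real.Gamma (k + (d : ℝ) / 2 - 1 + s) := Real.Gamma_pos_of_pos (by linarith)
  have e1 : Real.Gamma (((k + 1 : ℕ) : ℝ) + (d : ℝ) / 2 - s) =
      (k + (d : ℝ) / 2 - s) * Real.Gamma (k + (d : ℝ) / 2 - s) := by
    rw [← Real.Gamma_add_one (by linarith)]
    push_cast
    ring_nf
  have e2 : Real.Gamma (((k + 1 : ℕ) : ℝ) + (d : ℝ) / 2 - 1 + s) =
      (k + (d : ℝ) / 2 - 1 + s) * Real.Gamma (k + (d : ℝ) / 2 - 1 + s) := by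
    rw [← Real.Gamma_add_one (by linarith)]
    push_cast
    ring_nf
  have hx : 0 < k + (d : ℝ) / 2 - s := by linarith
  have hy : 0 < k + (d : ℝ) / 2 - 1 + s := by linarith
  simp only [lam, Pi.one_apply, norm_one]
  rw [e1, e2]
  gcongr ?_ * ?_ * _
  rw [div_le_div_iff₀ (by positivity) (by positivity)]
  have : k + (d : ℝ) / 2 - s ≤ k + (d : ℝ) / 2 - 1 + s := by linarith
  calc _ = (k + (d : ℝ) / 2 - s) * (Real.Gamma (2 * s - 1) * Real.Gamma (k + (d : ℝ) / 2 - s) *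
        (Real.Gamma s ^ 2 * Real.Gamma (k + (d : ℝ) / 2 - 1 + s))) := by ring
    _ ≤ (k + (d : ℝ) / 2 - 1 + s) * (Real.Gamma (2 * s - 1) * Real.Gamma (k + (d : ℝ) / 2 - s) *
        (Real.Gamma s ^ 2 * Real.Gamma (k + (d : ℝ) / 2 - 1 + s))) := by gcongr
    _ = _ := by ring

lemma bddAbove_lam_one (hd : 2 ≤ d) {s : ℝ} (hs : 1 / 2 < s) (hs' : s < (d : ℝ) / 2) :
    BddAbove (Set.range (lam d s 1)) := by
  refine ⟨lam d s 1 0, ?_⟩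
  rintro _ ⟨k, rfl⟩
  exact antitone_nat_of_succ_le (lam_one_succ_le hd hs hs') (Nat.zero_le k)
end

/-! ### The extension operator and `θ(-Λ)` applied to it. -/

section
variable {d : ℕ}

lemma lintegral_sq_enorm_Lp {α : Type*} [MeasurableSpace α] {μ : Measure α} (v : Lp ℂ 2 μ) :
    ∫⁻ x, ‖v x‖ₑ ^ 2 ∂μ = ENNReal.ofReal (‖v‖ ^ 2) := by
  have h := eLpNorm_nnreal_pow_eq_lintegral (μ := μ) (f := v) (p := 2) (by norm_num)
  rw [ENNReal.ofReal_pow (norm_nonneg _), ofReal_norm, Lp.enorm_def]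
  norm_num at h
  rw [h]

/-- The characters `ω ↦ exp (i ⟨ω, ξ⟩)` on the sphere. -/
def sphChar (d : ℕ) : C(Eu d, C(Sph d, ℂ)) :=
  ContinuousMap.curry ⟨fun q : Eu d × Sph d =>
    Complex.exp (Complex.I * ((inner ℝ (q.2 : Eu d) q.1 : ℝ) : ℂ)), by fun_prop⟩

lemma sphChar_apply (ξ : Eu d) (ω : Sph d) :
    sphChar d ξ ω = Complex.exp (Complex.I * ((inner ℝ (ω : Eu d) ξ : ℝ) : ℂ)) := rfl

/-- The class of `sphChar` in `L²`. -/
def sphCharL2 (d : ℕ) (ξ : Eu d) : L2S d :=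
  (ContinuousMap.toLp 2 (surf d) ℂ : C(Sph d, ℂ) →L[ℂ] L2S d) (sphChar d ξ)

lemma continuous_sphCharL2 : Continuous (sphCharL2 d) :=
  (ContinuousLinearMap.continuous _).comp (sphChar d).continuous

/-- Pairing with a continuous bounded curve of characters in `L²` yields continuity, linearity and
boundedness of the extension at once. -/
lemma extension_eq_inner (G : L2S d) (ξ : Eu d) : extension G ξ = inner ℂ (sphCharL2 d ξ) G := by
  rw [L2.inner_def, extension]
  refine integral_congr_ae ?_
  filter_upwards [ContinuousMap.coeFn_toLp (p := 2) (𝕜 := ℂ) (surf d) (sphChar d ξ)] with ω hω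
  rw [sphCharL2, hω, sphChar_apply, RCLike.inner_apply, ← Complex.exp_conj, map_mul,
    Complex.conj_I, Complex.conj_ofReal, neg_mul]

lemma continuous_extension (G : L2S d) : Continuous (extension G) := by
  have : extension G = fun ξ => inner ℂ (sphCharL2 d ξ) G := funext (extension_eq_inner G)
  rw [this]
  exact continuous_sphCharL2.inner continuous_const

lemma extension_add (G G' : L2S d) (ξ : Eu d) :
    extension (G + G') ξ = extension G ξ + extension G' ξ := by
  simp only [extension_eq_inner, inner_add_right]

lemma extension_smul (c : ℂ) (G : L2S d) (ξ : Eu d) :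
    extension (c • G) ξ = c * extension G ξ := by
  simp only [extension_eq_inner, inner_smul_right]

/-- The operator norm of the inclusion of continuous functions in `L²` of the sphere. -/
def sphConst (d : ℕ) : ℝ := ‖(ContinuousMap.toLp 2 (surf d) ℂ : C(Sph d, ℂ) →L[ℂ] L2S d)‖

lemma sphConst_nonneg : 0 ≤ sphConst d := by
  unfold sphConst
  exact ContinuousLinearMap.opNorm_nonneg _

lemma norm_toLp_le {f : C(Sph d, ℂ)} {c : ℝ} (hc : 0 ≤ c) (h : ∀ ω, ‖f ω‖ ≤ c) :
    ‖(ContinuousMap.toLp 2 (surf d) ℂ : C(Sph d, ℂ) →L[ℂ] L2S d) f‖ ≤ sphConst d * c :=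
  ((ContinuousMap.toLp 2 (surf d) ℂ : C(Sph d, ℂ) →L[ℂ] L2S d).le_opNorm f).trans
    (mul_le_mul_of_nonneg_left ((ContinuousMap.norm_le _ hc).2 h) (norm_nonneg _))

lemma norm_sphCharL2_le (ξ : Eu d) : ‖sphCharL2 d ξ‖ ≤ sphConst d := by
  refine (norm_toLp_le zero_le_one fun ω => ?_).trans (mul_one _).le
  rw [sphChar_apply, mul_comm, Complex.norm_exp_ofReal_mul_I]

lemma norm_extension_le (G : L2S d) (ξ : Eu d) : ‖extension G ξ‖ ≤ sphConst d * ‖G‖ := by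
  rw [extension_eq_inner]
  exact (norm_inner_le_norm _ _).trans
    (mul_le_mul_of_nonneg_right (norm_sphCharL2_le ξ) (norm_nonneg _))

/-- The restriction of `extension G` to the sphere of radius `r`. -/
def extSphere (r : ℝ) (G : L2S d) : C(Sph d, ℂ) :=
  ⟨fun ω => extension G (r • (ω : Eu d)), (continuous_extension G).comp (by fun_prop)⟩

/-- The operator sending `G` to the restriction of `extension G` to the sphere of radius `r`. -/
def extOp (d : ℕ) (r : ℝ) : L2S d →L[ℂ] L2S d :=
  LinearMap.mkContinuous
    { toFun := fun G => (ContinuousMap.toLp 2 (surf d) ℂ : C(Sph d, ℂ) →L[ℂ] L2S d) (extSphere r G)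
      map_add' := fun G G' => by
        rw [← map_add]
        congr 1
        ext ω
        exact extension_add G G' _
      map_smul' := fun c G => by
        rw [RingHom.id_apply, ← map_smul]
        congr 1
        ext ω
        exact extension_smul c G _ }
    (sphConst d * sphConst d) fun G => by
      rw [mul_assoc]
      exact norm_toLp_le (mul_nonneg sphConst_nonneg (norm_nonneg _))
        fun ω => norm_extension_le G _

lemma slice_extension_ae (r : ℝ) (G : L2S d) : slice (extension G) r =ᵐ[surf d] extOp d r G :=
  (ContinuousMap.coeFn_toLp (p := 2) (𝕜 := ℂ) (surf d) (extSphere r G)).symm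

lemma extension_polyL2_smul (hd : 2 ≤ d) {k : ℕ} {p : MvPolynomial (Fin d) ℂ}
    (hp : p ∈ harmonicPoly d k) (r : ℝ) (η : Sph d) :
    extension (polyL2 d p) (r • (η : Eu d)) = extMul d k r * evalEu p η := by
  rw [← ext_poly_smul hd hp, extension]
  refine integral_congr_ae ?_
  filter_upwards [coeFn_polyL2 p] with ω hω
  rw [hω]

lemma extOp_of_mem (hd : 2 ≤ d) {k : ℕ} {G : L2S d} (hG : G ∈ sphHarm d k) (r : ℝ) :
    extOp d r G = extMul d k r • G := by
  obtain ⟨p, hp, rfl⟩ := hG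
  change extOp d r (polyL2 d p) = extMul d k r • polyL2 d p
  refine Lp.ext ?_
  filter_upwards [slice_extension_ae r (polyL2 d p), coeFn_polyL2 p,
    Lp.coeFn_smul (extMul d k r) (polyL2 d p)] with ω h1 h2 h3
  rw [← h1, h3, Pi.smul_apply, h2, smul_eq_mul]
  exact extension_polyL2_smul hd hp r ω

lemma hasSum_extOp (hd : 2 ≤ d) (r : ℝ) (G : L2S d) :
    HasSum (fun k => extMul d k r • projH d k G) (extOp d r G) := by
  have h := (hasSum_projH hd G).mapL (extOp d r)
  simpa only [extOp_of_mem hd (projH_mem _ G)] using h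

lemma projH_extOp (hd : 2 ≤ d) (r : ℝ) (G : L2S d) (k : ℕ) :
    projH d k (extOp d r G) = extMul d k r • projH d k G :=
  projH_of_hasSum hd (hasSum_extOp hd r G) k

/-- Slices may be replaced by any curve of `L²` classes that represents them, which removes the
integrability witnesses from later arguments. -/
lemma isTheta_iff {θ : ℝ → ℂ} {f F : Eu d → ℂ} {u : ℝ → L2S d}
    (hu : ∀ᵐ r ∂(volume.restrict (Set.Ioi (0 : ℝ))), slice f r =ᵐ[surf d] u r) :
    IsTheta θ f F ↔ AEStronglyMeasurable F volume ∧
      ∀ᵐ r ∂(volume.restrict (Set.Ioi (0 : ℝ))), ∃ v : L2S d, slice F r =ᵐ[surf d] v ∧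
        IsThetaSphere θ (u r) v := by
  refine and_congr_right fun _ => ⟨fun h => ?_, fun h => ?_⟩
  · filter_upwards [h, hu] with r ⟨hf, hF, hr⟩ hur
    refine ⟨hF.toLp _, hF.coeFn_toLp.symm, ?_⟩
    have : hf.toLp _ = u r := Lp.ext (hf.coeFn_toLp.trans hur)
    rwa [this] at hr
  · filter_upwards [h, hu] with r ⟨v, hv, hr⟩ hur
    have hf : MemLp (slice f r) 2 (surf d) := (memLp_congr_ae hur).2 (Lp.memLp _)
    have hF : MemLp (slice F r) 2 (surf d) := (memLp_congr_ae hv).2 (Lp.memLp _)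
    refine ⟨hf, hF, ?_⟩
    have h1 : hf.toLp _ = u r := Lp.ext (hf.coeFn_toLp.trans hur)
    have h2 : hF.toLp _ = v := Lp.ext (hF.coeFn_toLp.trans hv)
    rwa [h1, h2]

lemma IsTheta.slice_ae_eq {θ : ℝ → ℂ} {f F F' : Eu d → ℂ} (h : IsTheta θ f F)
    (h' : IsTheta θ f F') :
    ∀ᵐ r ∂(volume.restrict (Set.Ioi (0 : ℝ))), slice F r =ᵐ[surf d] slice F' r := by
  filter_upwards [h.2, h'.2] with r ⟨hf, hF, hr⟩ ⟨hf', hF', hr'⟩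
  have : hF.toLp _ = hF'.toLp _ := hr.unique hr'
  exact (MemLp.toLp_eq_toLp_iff hF hF').1 this

lemma IsTheta.ae_eq (hd : 2 ≤ d) {θ : ℝ → ℂ} {f F F' : Eu d → ℂ} (h : IsTheta θ f F)
    (h' : IsTheta θ f F') : F =ᵐ[volume] F' :=
  ae_eq_of_slice hd h.1 h'.1 (h.slice_ae_eq h')

lemma isTheta_extension_iff (hd : 2 ≤ d) {θ : ℝ → ℂ} {G : L2S d} {Φ : Eu d → ℂ} :
    IsTheta θ (extension G) Φ ↔ AEStronglyMeasurable Φ volume ∧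
      ∀ᵐ r ∂(volume.restrict (Set.Ioi (0 : ℝ))), ∃ v : L2S d, slice Φ r =ᵐ[surf d] v ∧
        HasSum (fun k => (θ (lbEigen d k) * extMul d k r) • projH d k G) v := by
  rw [isTheta_iff (u := fun r => extOp d r G)
    (Eventually.of_forall fun r => slice_extension_ae r G)]
  simp only [IsThetaSphere, projH_extOp hd, smul_smul]

lemma lintegral_sq_theta_extension (hd : 2 ≤ d) {s : ℝ} (hs : 1 / 2 < s) (hs' : s < (d : ℝ) / 2)
    (θ : ℝ → ℂ) (G : L2S d) :
    ∫⁻ r in Set.Ioi (0 : ℝ), ENNReal.ofReal (r ^ (d - 1)) * (ENNReal.ofReal (r ^ (-(2 * s))) *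
      ∑' k, ENNReal.ofReal (‖θ (lbEigen d k) * extMul d k r‖ ^ 2 * ‖projH d k G‖ ^ 2)) =
    ∑' k, ENNReal.ofReal ((2 * Real.pi) ^ d * lam d s θ k * ‖projH d k G‖ ^ 2) := by
  have h1 : ∀ r : ℝ, ENNReal.ofReal (r ^ (d - 1)) * (ENNReal.ofReal (r ^ (-(2 * s))) *
      ∑' k, ENNReal.ofReal (‖θ (lbEigen d k) * extMul d k r‖ ^ 2 * ‖projH d k G‖ ^ 2)) =
      ∑' k, ENNReal.ofReal (‖θ (lbEigen d k)‖ ^ 2 * ‖projH d k G‖ ^ 2) *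
        (ENNReal.ofReal (r ^ (d - 1)) *
        (ENNReal.ofReal (r ^ (-(2 * s))) * ‖extMul d k r‖ₑ ^ 2)) := fun r => by
    rw [← ENNReal.tsum_mul_left, ← ENNReal.tsum_mul_left]
    refine tsum_congr fun k => ?_
    rw [norm_mul, mul_pow, mul_right_comm, ENNReal.ofReal_mul (by positivity),
      ENNReal.ofReal_pow (norm_nonneg (extMul d k r)), ofReal_norm]
    ring
  have hm : ∀ k, Measurable fun r => (ENNReal.ofReal (r ^ (d - 1)) *
        (ENNReal.ofReal (r ^ (-(2 * s))) * ‖extMul d k r‖ₑ ^ 2)) := fun k => by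
    have := continuous_extMul hd k
    fun_prop
  simp only [h1]
  rw [lintegral_tsum (fun k => ((hm k).const_mul _).aemeasurable)]
  refine tsum_congr fun k => ?_
  have := lam_one_pos hd hs hs' k
  rw [lintegral_const_mul _ (hm k), lintegral_extMul_sq hd hs hs',
    ← ENNReal.ofReal_mul (by positivity), lam_eq d s θ k]
  congr 1
  ring

lemma lam_nonneg (hd : 2 ≤ d) {s : ℝ} (hs : 1 / 2 < s) (hs' : s < (d : ℝ) / 2) (θ : ℝ → ℂ)
    (k : ℕ) : 0 ≤ lam d s θ k := by
  rw [lam_eq]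
  have := lam_one_pos hd hs hs' k
  positivity

lemma summable_lam_mul (hd : 2 ≤ d) {s : ℝ} (hs : 1 / 2 < s) (hs' : s < (d : ℝ) / 2) {θ : ℝ → ℂ}
    (hθ : BddAbove (Set.range (lam d s θ))) (G : L2S d) :
    Summable (fun k => (2 * Real.pi) ^ d * lam d s θ k * ‖projH d k G‖ ^ 2) ∧
      ∑' k, (2 * Real.pi) ^ d * lam d s θ k * ‖projH d k G‖ ^ 2 ≤
        (2 * Real.pi) ^ d * (⨆ k, lam d s θ k) * ‖G‖ ^ 2 := by
  have hπ := Real.pi_pos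
  have h := (hasSum_norm_sq_projH hd G).mul_left ((2 * Real.pi) ^ d * (⨆ k, lam d s θ k))
  have h0 : ∀ k, 0 ≤ (2 * Real.pi) ^ d * lam d s θ k * ‖projH d k G‖ ^ 2 := fun k => by
    have := lam_nonneg hd hs hs' θ k
    positivity
  have h1 : ∀ k, (2 * Real.pi) ^ d * lam d s θ k * ‖projH d k G‖ ^ 2 ≤
      (2 * Real.pi) ^ d * (⨆ k, lam d s θ k) * ‖projH d k G‖ ^ 2 := fun k => by
    have := le_ciSup hθ k
    gcongr
  have hsum := Summable.of_nonneg_of_le h0 h1 h.summable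
  exact ⟨hsum, (hsum.tsum_le_tsum h1 h.summable).trans h.tsum_eq.le⟩

/-- The values of `θ` may be unbounded, so convergence is not available at a fixed radius. The
weighted radial integral of the squared angular norms is finite, which gives convergence at almost
every radius, and the measurable curve of sums is realised by `exists_slice_eq`. -/
lemma exists_isTheta_extension (hd : 2 ≤ d) {s : ℝ} (hs : 1 / 2 < s) (hs' : s < (d : ℝ) / 2)
    {θ : ℝ → ℂ} (hθ : BddAbove (Set.range (lam d s θ))) (G : L2S d) :
    ∃ Φ, IsTheta θ (extension G) Φ := by
  have hI := lintegral_sq_theta_extension hd hs hs' θ G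
  have hsum := (summable_lam_mul hd hs hs' hθ G).1
  have hfin : ∑' k, ENNReal.ofReal ((2 * Real.pi) ^ d * lam d s θ k * ‖projH d k G‖ ^ 2) ≠ ⊤ := by
    rw [← ENNReal.ofReal_tsum_of_nonneg (fun k => ?_) hsum]
    · exact ENNReal.ofReal_ne_top
    · have := lam_nonneg hd hs hs' θ k
      have := Real.pi_pos
      positivity
  have hcont := fun k => continuous_extMul hd k
  have hm : Measurable fun r => ENNReal.ofReal (r ^ (d - 1)) * (ENNReal.ofReal (r ^ (-(2 * s))) *
      ∑' k, ENNReal.ofReal (‖θ (lbEigen d k) * extMul d k r‖ ^ 2 * ‖projH d k G‖ ^ 2)) := by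
    have : ∀ k, Measurable fun r =>
        ENNReal.ofReal (‖θ (lbEigen d k) * extMul d k r‖ ^ 2 * ‖projH d k G‖ ^ 2) := fun k => by
      have := hcont k
      fun_prop
    exact (by fun_prop : Measurable fun r : ℝ => ENNReal.ofReal (r ^ (d - 1))).mul
      ((by fun_prop : Measurable fun r : ℝ => ENNReal.ofReal (r ^ (-(2 * s)))).mul
        (Measurable.tsum this))
  have hae := ae_lt_top (μ := volume.restrict (Set.Ioi (0 : ℝ))) hm (by rwa [hI])
  have hsumm : ∀ᵐ r ∂(volume.restrict (Set.Ioi (0 : ℝ))),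
      Summable fun k => (θ (lbEigen d k) * extMul d k r) • projH d k G := by
    filter_upwards [hae, ae_restrict_mem measurableSet_Ioi] with r hr hr0
    have hr0 : 0 < r := hr0
    refine summable_smul_projH hd ?_
    have h1 : ENNReal.ofReal (r ^ (d - 1)) ≠ 0 := by simpa using pow_pos hr0 _
    have h2 : ENNReal.ofReal (r ^ (-(2 * s))) ≠ 0 := by simpa using Real.rpow_pos_of_pos hr0 _
    have h3 := (ENNReal.mul_lt_top_iff.1 hr)
    have h4 : ∑' k, ENNReal.ofReal
        (‖θ (lbEigen d k) * extMul d k r‖ ^ 2 * ‖projH d k G‖ ^ 2) ≠ ⊤ := by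
      intro htop
      rw [htop, ENNReal.mul_top h2, ENNReal.mul_top h1] at hr
      exact lt_irrefl _ hr
    have h5 := ENNReal.summable_toReal h4
    refine h5.congr fun k => ?_
    rw [ENNReal.toReal_ofReal (by positivity)]
  have hu : AEStronglyMeasurable
      (fun r => ∑' k, (θ (lbEigen d k) * extMul d k r) • projH d k G)
      (volume.restrict (Set.Ioi (0 : ℝ))) := by
    refine aestronglyMeasurable_of_tendsto_ae atTop
      (f := fun (n : ℕ) r => ∑ k ∈ Finset.range n, (θ (lbEigen d k) * extMul d k r) • projH d k G)
      (fun n => ?_) ?_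
    · refine Continuous.aestronglyMeasurable ?_
      fun_prop
    · filter_upwards [hsumm] with r hr
      exact hr.hasSum.tendsto_sum_nat
  obtain ⟨Φ, hΦ, hΦs⟩ := exists_slice_eq hu
  refine ⟨Φ, (isTheta_extension_iff hd).2 ⟨hΦ, ?_⟩⟩
  filter_upwards [hΦs, hsumm] with r h1 h2
  exact ⟨_, h1, h2.hasSum⟩
end

/-! ### The synthesis operator `G ↦ |ξ|^{-s} θ(-Λ) (G dσ)^`. -/

section
variable {d : ℕ}

/-- Parseval on almost every sphere, integrated over the radii. The mixed terms are gone before the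
radial integral is taken. -/
lemma lintegral_sq_weight_theta (hd : 2 ≤ d) {s : ℝ} (hs : 1 / 2 < s) (hs' : s < (d : ℝ) / 2)
    {θ : ℝ → ℂ} {G : L2S d} {Φ : Eu d → ℂ} (h : IsTheta θ (extension G) Φ) :
    ∫⁻ ξ, ‖((‖ξ‖ ^ (-s) : ℝ) : ℂ) * Φ ξ‖ₑ ^ 2 =
      ∑' k, ENNReal.ofReal ((2 * Real.pi) ^ d * lam d s θ k * ‖projH d k G‖ ^ 2) := by
  have hΦ := h.1
  have hm : AEMeasurable (fun ξ : Eu d => ‖((‖ξ‖ ^ (-s) : ℝ) : ℂ) * Φ ξ‖ₑ ^ 2) := by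
    have h1 : Measurable fun ξ : Eu d => ((‖ξ‖ ^ (-s) : ℝ) : ℂ) := by fun_prop
    exact (h1.aestronglyMeasurable.mul hΦ).enorm.pow_const 2
  rw [lintegral_polar hd hm, ← lintegral_sq_theta_extension hd hs hs']
  refine lintegral_congr_ae ?_
  filter_upwards [((isTheta_extension_iff hd).1 h).2, ae_restrict_mem measurableSet_Ioi]
    with r ⟨v, hv, hsum⟩ hr
  have hr : 0 < r := hr
  congr 1
  have h2 := hasSum_norm_sq_of_hasSum hd hsum
  rw [← ENNReal.ofReal_tsum_of_nonneg (fun k => by positivity) h2.summable, h2.tsum_eq,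
    ← lintegral_sq_enorm_Lp, ← lintegral_const_mul' _ _ ENNReal.ofReal_ne_top]
  refine lintegral_congr_ae ?_
  filter_upwards [hv] with ω hω
  have hω : Φ (r • (ω : Eu d)) = v ω := hω
  rw [hω, norm_smul, norm_coe_sph, mul_one, Real.norm_of_nonneg hr.le, enorm_mul, mul_pow]
  congr 1
  rw [← ofReal_norm, Complex.norm_real, Real.norm_of_nonneg (by positivity),
    ← ENNReal.ofReal_pow (by positivity), ← Real.rpow_mul_natCast hr.le]
  congr 2
  push_cast
  ring

lemma lintegral_sq_weight_theta_eq (hd : 2 ≤ d) {s : ℝ} (hs : 1 / 2 < s) (hs' : s < (d : ℝ) / 2)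
    {θ : ℝ → ℂ} (hθ : BddAbove (Set.range (lam d s θ))) {G : L2S d} {Φ : Eu d → ℂ}
    (h : IsTheta θ (extension G) Φ) :
    ∫⁻ ξ, ‖((‖ξ‖ ^ (-s) : ℝ) : ℂ) * Φ ξ‖ₑ ^ 2 =
      ENNReal.ofReal (∑' k, (2 * Real.pi) ^ d * lam d s θ k * ‖projH d k G‖ ^ 2) := by
  rw [lintegral_sq_weight_theta hd hs hs' h, ENNReal.ofReal_tsum_of_nonneg (fun k => ?_)
    (summable_lam_mul hd hs hs' hθ G).1]
  have := lam_nonneg hd hs hs' θ k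
  have := Real.pi_pos
  positivity

lemma memLp_weight_theta (hd : 2 ≤ d) {s : ℝ} (hs : 1 / 2 < s) (hs' : s < (d : ℝ) / 2)
    {θ : ℝ → ℂ} (hθ : BddAbove (Set.range (lam d s θ))) {G : L2S d} {Φ : Eu d → ℂ}
    (h : IsTheta θ (extension G) Φ) :
    MemLp (fun ξ => ((‖ξ‖ ^ (-s) : ℝ) : ℂ) * Φ ξ) 2 := by
  have h1 : Measurable fun ξ : Eu d => ((‖ξ‖ ^ (-s) : ℝ) : ℂ) := by fun_prop
  refine ⟨h1.aestronglyMeasurable.mul h.1, ?_⟩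
  have h3 := eLpNorm_nnreal_pow_eq_lintegral (μ := (volume : Measure (Eu d)))
    (f := fun ξ => ((‖ξ‖ ^ (-s) : ℝ) : ℂ) * Φ ξ) (p := 2) (by norm_num)
  norm_num at h3
  have h2 := lintegral_sq_weight_theta_eq hd hs hs' hθ h
  have h4 : eLpNorm (fun ξ => ((‖ξ‖ ^ (-s) : ℝ) : ℂ) * Φ ξ) 2 volume ^ 2 < ⊤ := by
    rw [h3]
    simpa only [enorm_mul] using h2.trans_lt ENNReal.ofReal_lt_top
  exact (ENNReal.pow_lt_top_iff.1 h4).resolve_right (by norm_num)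

lemma IsTheta.extension_add (hd : 2 ≤ d) {θ : ℝ → ℂ} {G G' : L2S d} {Φ Φ' : Eu d → ℂ}
    (h : IsTheta θ (extension G) Φ) (h' : IsTheta θ (extension G') Φ') :
    IsTheta θ (extension (G + G')) (fun ξ => Φ ξ + Φ' ξ) := by
  rw [isTheta_extension_iff hd] at *
  refine ⟨h.1.add h'.1, ?_⟩
  filter_upwards [h.2, h'.2] with r ⟨v, hv, hsum⟩ ⟨v', hv', hsum'⟩
  refine ⟨v + v', ?_, ?_⟩
  · filter_upwards [hv, hv', Lp.coeFn_add v v'] with ω h1 h2 h3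
    rw [h3, Pi.add_apply, ← h1, ← h2]
    rfl
  · simpa only [map_add, smul_add] using hsum.add hsum'

lemma IsTheta.extension_smul (hd : 2 ≤ d) {θ : ℝ → ℂ} {G : L2S d} {Φ : Eu d → ℂ}
    (h : IsTheta θ (extension G) Φ) (c : ℂ) :
    IsTheta θ (extension (c • G)) (fun ξ => c * Φ ξ) := by
  rw [isTheta_extension_iff hd] at *
  refine ⟨h.1.const_mul c, ?_⟩
  filter_upwards [h.2] with r ⟨v, hv, hsum⟩
  refine ⟨c • v, ?_, ?_⟩
  · filter_upwards [hv, Lp.coeFn_smul c v] with ω h1 h3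
    rw [h3, Pi.smul_apply, ← h1]
    rfl
  · have := hsum.const_smul c
    refine this.congr_fun fun k => ?_
    rw [map_smul, smul_comm]

/-- The operator `G ↦ |ξ|^{-s} θ(-Λ) (G dσ)^` into `L²`, with its norm. -/
lemma exists_synth (hd : 2 ≤ d) {s : ℝ} (hs : 1 / 2 < s) (hs' : s < (d : ℝ) / 2)
    {θ : ℝ → ℂ} (hθ : BddAbove (Set.range (lam d s θ))) :
    ∃ B : L2S d →L[ℂ] Lp ℂ 2 (volume : Measure (Eu d)),
      (∀ G Φ, IsTheta θ (extension G) Φ →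
        (fun ξ => ((‖ξ‖ ^ (-s) : ℝ) : ℂ) * Φ ξ) =ᵐ[volume] B G) ∧
      ∀ G, ‖B G‖ ^ 2 = ∑' k, (2 * Real.pi) ^ d * lam d s θ k * ‖projH d k G‖ ^ 2 := by
  choose Φ hΦ using exists_isTheta_extension hd hs hs' hθ
  have hnn : ∀ G : L2S d, 0 ≤ ∑' k, (2 * Real.pi) ^ d * lam d s θ k * ‖projH d k G‖ ^ 2 :=
    fun G => tsum_nonneg fun k => by
      have := lam_nonneg hd hs hs' θ k
      have := Real.pi_pos
      positivity
  have hnorm : ∀ G, ‖(memLp_weight_theta hd hs hs' hθ (hΦ G)).toLp‖ ^ 2 =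
      ∑' k, (2 * Real.pi) ^ d * lam d s θ k * ‖projH d k G‖ ^ 2 := fun G => by
    rw [← ENNReal.ofReal_eq_ofReal_iff (by positivity) (hnn G), ← lintegral_sq_enorm_Lp,
      ← lintegral_sq_weight_theta_eq hd hs hs' hθ (hΦ G)]
    refine lintegral_congr_ae ?_
    filter_upwards [(memLp_weight_theta hd hs hs' hθ (hΦ G)).coeFn_toLp] with ξ hξ
    rw [hξ]
  have hM : 0 ≤ ⨆ k, lam d s θ k := Real.iSup_nonneg (lam_nonneg hd hs hs' θ)
  let T : L2S d →ₗ[ℂ] Lp ℂ 2 (volume : Measure (Eu d)) :=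
    { toFun := fun G => (memLp_weight_theta hd hs hs' hθ (hΦ G)).toLp
      map_add' := fun G G' => by
        refine Lp.ext ?_
        filter_upwards [(memLp_weight_theta hd hs hs' hθ (hΦ G)).coeFn_toLp,
          (memLp_weight_theta hd hs hs' hθ (hΦ G')).coeFn_toLp,
          (memLp_weight_theta hd hs hs' hθ (hΦ (G + G'))).coeFn_toLp,
          Lp.coeFn_add (memLp_weight_theta hd hs hs' hθ (hΦ G)).toLp
            (memLp_weight_theta hd hs hs' hθ (hΦ G')).toLp,
          (hΦ (G + G')).ae_eq hd ((hΦ G).extension_add hd (hΦ G'))] with ξ h1 h2 h3 h4 h5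
        rw [h4, Pi.add_apply, h1, h2, h3, h5, mul_add]
      map_smul' := fun c G => by
        refine Lp.ext ?_
        filter_upwards [(memLp_weight_theta hd hs hs' hθ (hΦ G)).coeFn_toLp,
          (memLp_weight_theta hd hs hs' hθ (hΦ (c • G))).coeFn_toLp,
          Lp.coeFn_smul c (memLp_weight_theta hd hs hs' hθ (hΦ G)).toLp,
          (hΦ (c • G)).ae_eq hd ((hΦ G).extension_smul hd c)] with ξ h1 h2 h3 h4
        rw [RingHom.id_apply, h3, Pi.smul_apply, h1, h2, h4, smul_eq_mul, mul_left_comm] }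
  refine ⟨T.mkContinuous (√((2 * Real.pi) ^ d * ⨆ k, lam d s θ k)) fun G => ?_,
    fun G Ψ hΨ => ?_, hnorm⟩
  · refine le_of_sq_le_sq ?_ (by positivity)
    rw [mul_pow, Real.sq_sqrt (by have := Real.pi_pos; positivity)]
    exact (hnorm G).trans_le (summable_lam_mul hd hs hs' hθ G).2
  · refine EventuallyEq.trans ?_ (memLp_weight_theta hd hs hs' hθ (hΦ G)).coeFn_toLp.symm
    filter_upwards [hΨ.ae_eq hd (hΦ G)] with ξ h1
    rw [h1]

end

/-! ### Spectral properties of the synthesis operator and its adjoint. -/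

section
variable {d : ℕ}

/-- `B` is the operator `G ↦ |ξ|^{-s} θ(-Λ) (G dσ)^` from `L²` of the sphere to `L²`. -/
def IsSynth (s : ℝ) (θ : ℝ → ℂ) (B : L2S d →L[ℂ] Lp ℂ 2 (volume : Measure (Eu d))) : Prop :=
  (∀ G Φ, IsTheta θ (extension G) Φ →
    (fun ξ => ((‖ξ‖ ^ (-s) : ℝ) : ℂ) * Φ ξ) =ᵐ[volume] B G) ∧
  ∀ G, HasSum (fun k => (2 * Real.pi) ^ d * lam d s θ k * ‖projH d k G‖ ^ 2) (‖B G‖ ^ 2)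

lemma exists_isSynth (hd : 2 ≤ d) {s : ℝ} (hs : 1 / 2 < s) (hs' : s < (d : ℝ) / 2)
    {θ : ℝ → ℂ} (hθ : BddAbove (Set.range (lam d s θ))) :
    ∃ B : L2S d →L[ℂ] Lp ℂ 2 (volume : Measure (Eu d)), IsSynth s θ B := by
  obtain ⟨B, h1, h2⟩ := exists_synth hd hs hs' hθ
  refine ⟨B, h1, fun G => ?_⟩
  rw [h2]
  exact (summable_lam_mul hd hs hs' hθ G).1.hasSum

namespace IsSynth

variable {s : ℝ} {θ : ℝ → ℂ} {B A : L2S d →L[ℂ] Lp ℂ 2 (volume : Measure (Eu d))}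

/-- Polarisation of the norm identity. -/
lemma hasSum_inner (hB : IsSynth s θ B) (x y : L2S d) :
    HasSum (fun k => (((2 * Real.pi) ^ d * lam d s θ k : ℝ) : ℂ) *
      inner ℂ (projH d k x) (projH d k y)) (inner ℂ (B x) (B y)) := by
  have h := fun z => Complex.hasSum_ofReal.2 (hB.2 z)
  have h1 := (((h (x + y)).sub (h (x - y))).add
    (((h (x - Complex.I • y)).sub (h (x + Complex.I • y))).mul_right Complex.I)).div_const 4
  rw [inner_eq_sum_norm_sq_div_four (𝕜 := ℂ)]
  simp only [map_add, map_sub, map_smul] at h1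
  convert! h1 using 1
  · ext k
    rw [inner_eq_sum_norm_sq_div_four (𝕜 := ℂ)]
    simp only [RCLike.I_to_complex, Complex.coe_algebraMap]
    push_cast
    ring
  · simp only [RCLike.I_to_complex, Complex.coe_algebraMap]
    push_cast
    ring

lemma inner_of_mem (hd : 2 ≤ d) (hB : IsSynth s θ B) {k : ℕ} {x : L2S d} (hx : x ∈ sphHarm d k)
    (y : L2S d) : inner ℂ (B x) (B y) = (((2 * Real.pi) ^ d * lam d s θ k : ℝ) : ℂ) *
      inner ℂ x (projH d k y) := by
  refine (hB.hasSum_inner x y).unique ?_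
  have := hasSum_single (f := fun j => (((2 * Real.pi) ^ d * lam d s θ j : ℝ) : ℂ) *
      inner ℂ (projH d j x) (projH d j y)) k fun j hj => by
    rw [projH_of_mem_ne hd hj.symm hx, inner_zero_left, mul_zero]
  simpa only [projH_of_mem hx] using this

/-- The norm identity in operator form: `B* B` is diagonal in the decomposition into spherical
harmonics, with eigenvalues `(2π)^d λ_k(θ)`. -/
lemma projH_adjoint_self (hd : 2 ≤ d) (hB : IsSynth s θ B) (k : ℕ) (y : L2S d) :
    projH d k (B.adjoint (B y)) = (((2 * Real.pi) ^ d * lam d s θ k : ℝ) : ℂ) • projH d k y := by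
  refine ext_inner_left ℂ fun z => ?_
  rw [← inner_projH_left, ContinuousLinearMap.adjoint_inner_right,
    hB.inner_of_mem hd (projH_mem k z), inner_smul_right, inner_projH_left]
  congr 2
  exact projH_of_mem (projH_mem k y)

lemma apply_of_mem (hd : 2 ≤ d) (hB : IsSynth s θ B) (hA : IsSynth s 1 A) {k : ℕ} {x : L2S d}
    (hx : x ∈ sphHarm d k) : B x = θ (lbEigen d k) • A x := by
  have h1 : ∀ ϑ : ℝ → ℂ, IsTheta ϑ (extension x) fun ξ => ϑ (lbEigen d k) * extension x ξ := by
    intro ϑ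
    refine (isTheta_extension_iff hd).2
      ⟨((continuous_extension x).const_mul _).aestronglyMeasurable, Eventually.of_forall fun r =>
        ⟨ϑ (lbEigen d k) • extOp d r x, ?_, ?_⟩⟩
    · filter_upwards [slice_extension_ae r x, Lp.coeFn_smul (ϑ (lbEigen d k)) (extOp d r x)]
        with ω h1 h2
      rw [h2, Pi.smul_apply, ← h1]
      rfl
    · have := hasSum_single (f := fun j => (ϑ (lbEigen d j) * extMul d j r) • projH d j x) k
        fun j hj => by rw [projH_of_mem_ne hd hj.symm hx, smul_zero]
      rwa [projH_of_mem hx, mul_smul, ← extOp_of_mem hd hx] at this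
  refine Lp.ext ?_
  filter_upwards [hB.1 _ _ (h1 θ), hA.1 _ _ (h1 1), Lp.coeFn_smul (θ (lbEigen d k)) (A x)]
    with ξ h2 h3 h4
  rw [h4, Pi.smul_apply, ← h2, ← h3, Pi.one_apply, one_mul, smul_eq_mul, mul_left_comm]

/-- Taking adjoints in `apply_of_mem` gives `H_k B* = conj θ(k(k+d-2)) H_k A*`. The series for
`(conj θ)(-Λ) A* h` is then just the harmonic expansion of `B* h`, so it converges even if `θ` is
unbounded. -/
lemma isThetaSphere_adjoint (hd : 2 ≤ d) (hB : IsSynth s θ B) (hA : IsSynth s 1 A)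
    (h : Lp ℂ 2 (volume : Measure (Eu d))) :
    IsThetaSphere (fun t => starRingEnd ℂ (θ t)) (A.adjoint h) (B.adjoint h) := by
  have h1 := hasSum_projH hd (B.adjoint h)
  refine h1.congr_fun fun k => ?_
  refine ext_inner_left ℂ fun z => ?_
  rw [inner_smul_right, ← inner_projH_left, ← inner_projH_left,
    ContinuousLinearMap.adjoint_inner_right, ContinuousLinearMap.adjoint_inner_right,
    hB.apply_of_mem hd hA (projH_mem k z), inner_smul_left]

lemma ae_eq_extension (hd : 2 ≤ d) (hA : IsSynth s 1 A) (G : L2S d) :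
    (fun ξ => ((‖ξ‖ ^ (-s) : ℝ) : ℂ) * extension G ξ) =ᵐ[volume] A G := by
  refine hA.1 _ _ ((isTheta_extension_iff hd).2
    ⟨(continuous_extension G).aestronglyMeasurable, Eventually.of_forall fun r =>
      ⟨extOp d r G, slice_extension_ae r G, ?_⟩⟩)
  simpa only [Pi.one_apply, one_mul] using hasSum_extOp hd r G

lemma norm_sq_le (hd : 2 ≤ d) (hB : IsSynth s θ B) (hs : 1 / 2 < s) (hs' : s < (d : ℝ) / 2)
    (hθ : BddAbove (Set.range (lam d s θ))) (G : L2S d) :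
    ‖B G‖ ^ 2 ≤ (2 * Real.pi) ^ d * (⨆ k, lam d s θ k) * ‖G‖ ^ 2 :=
  (hB.2 G).tsum_eq.symm.trans_le (summable_lam_mul hd hs hs' hθ G).2

lemma norm_adjoint_sq_le (hd : 2 ≤ d) (hB : IsSynth s θ B) (hs : 1 / 2 < s)
    (hs' : s < (d : ℝ) / 2) (hθ : BddAbove (Set.range (lam d s θ)))
    (h : Lp ℂ 2 (volume : Measure (Eu d))) :
    ‖B.adjoint h‖ ^ 2 ≤ (2 * Real.pi) ^ d * (⨆ k, lam d s θ k) * ‖h‖ ^ 2 := by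
  have hM : 0 ≤ ⨆ k, lam d s θ k := Real.iSup_nonneg (lam_nonneg hd hs hs' θ)
  have hπ := Real.pi_pos
  have h1 : ‖B‖ ≤ √((2 * Real.pi) ^ d * ⨆ k, lam d s θ k) :=
    B.opNorm_le_bound (by positivity) fun G => le_of_sq_le_sq (by
      rw [mul_pow, Real.sq_sqrt (by positivity)]
      exact hB.norm_sq_le hd hs hs' hθ G) (by positivity)
  have h2 : ‖B.adjoint h‖ ≤ √((2 * Real.pi) ^ d * ⨆ k, lam d s θ k) * ‖h‖ := by
    refine (B.adjoint.le_opNorm h).trans ?_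
    rw [LinearIsometryEquiv.norm_map]
    gcongr
  calc ‖B.adjoint h‖ ^ 2 ≤ (√((2 * Real.pi) ^ d * ⨆ k, lam d s θ k) * ‖h‖) ^ 2 := by gcongr
    _ = _ := by rw [mul_pow, Real.sq_sqrt (by positivity)]

end IsSynth

/-! ### Unitary dilations -/

lemma measurePreserving_inv_smul {r : ℝ} (hr : 0 < r) :
    MeasurePreserving (fun ξ : Eu d => r⁻¹ • ξ) volume (ENNReal.ofReal (r ^ d) • volume) := by
  refine ⟨by fun_prop, ?_⟩
  rw [Measure.map_addHaar_smul volume (inv_ne_zero hr.ne')]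
  simp [abs_of_pos hr]

lemma memLp_inv_smul {r : ℝ} (hr : 0 < r) {h : Eu d → ℂ} (hh : MemLp h 2) :
    MemLp (fun ξ : Eu d => h (r⁻¹ • ξ)) 2 :=
  (hh.smul_measure ENNReal.ofReal_ne_top).comp_measurePreserving (measurePreserving_inv_smul hr)

/-- The unitary dilation `h ↦ r^{-d/2} h(ξ/r)`, for `r > 0`. -/
def dil (r : ℝ) (h : Lp ℂ 2 (volume : Measure (Eu d))) : Lp ℂ 2 (volume : Measure (Eu d)) :=
  if hr : 0 < r then
    ((memLp_inv_smul hr (Lp.memLp h)).const_mul ((r ^ (-((d : ℝ) / 2)) : ℝ) : ℂ)).toLp else 0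

lemma coeFn_dil {r : ℝ} (hr : 0 < r) (h : Lp ℂ 2 (volume : Measure (Eu d))) :
    dil r h =ᵐ[volume] fun ξ => ((r ^ (-((d : ℝ) / 2)) : ℝ) : ℂ) * h (r⁻¹ • ξ) := by
  rw [dil, dif_pos hr]
  exact MemLp.coeFn_toLp _

lemma quasiMeasurePreserving_inv_smul {r : ℝ} (hr : 0 < r) :
    Measure.QuasiMeasurePreserving (fun ξ : Eu d => r⁻¹ • ξ) volume volume :=
  ⟨by fun_prop, by
    rw [(measurePreserving_inv_smul hr).map_eq]
    exact Measure.smul_absolutelyContinuous⟩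

lemma dil_sub (r : ℝ) (h g : Lp ℂ 2 (volume : Measure (Eu d))) :
    dil r (h - g) = dil r h - dil r g := by
  by_cases hr : 0 < r
  · refine Lp.ext ?_
    filter_upwards [coeFn_dil hr h, coeFn_dil hr g, coeFn_dil hr (h - g),
      Lp.coeFn_sub (dil r h) (dil r g),
      (quasiMeasurePreserving_inv_smul hr).ae (Lp.coeFn_sub h g)] with ξ h1 h2 h3 h4 h5
    rw [h4, Pi.sub_apply, h1, h2, h3, h5, Pi.sub_apply, mul_sub]
  · simp [dil, hr]

lemma norm_dil {r : ℝ} (hr : 0 < r) (h : Lp ℂ 2 (volume : Measure (Eu d))) :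
    ‖dil r h‖ = ‖h‖ := by
  have h1 : ENNReal.ofReal (‖dil r h‖ ^ 2) = ENNReal.ofReal (‖h‖ ^ 2) := by
    rw [← lintegral_sq_enorm_Lp, ← lintegral_sq_enorm_Lp]
    have h2 : ∫⁻ ξ, ‖dil r h ξ‖ₑ ^ 2 =
        ∫⁻ ξ, ENNReal.ofReal (r ^ (-(d : ℝ))) * ‖h (r⁻¹ • ξ)‖ₑ ^ 2 := by
      refine lintegral_congr_ae ?_
      filter_upwards [coeFn_dil hr h] with ξ hξ
      rw [hξ, enorm_mul, mul_pow, ← ofReal_norm, Complex.norm_real,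
        Real.norm_of_nonneg (by positivity), ← ENNReal.ofReal_pow (by positivity),
        ← Real.rpow_mul_natCast hr.le]
      congr 3
      push_cast
      ring
    rw [h2, lintegral_const_mul' _ _ ENNReal.ofReal_ne_top]
    have h3 := (measurePreserving_inv_smul (d := d) hr).map_eq
    have h4 : ∫⁻ ξ, ‖h (r⁻¹ • ξ)‖ₑ ^ 2 = ENNReal.ofReal (r ^ d) * ∫⁻ ξ, ‖h ξ‖ₑ ^ 2 := by
      rw [← smul_eq_mul, ← lintegral_smul_measure, ← h3,
        lintegral_map' ?_ (by fun_prop)]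
      rw [h3]
      exact ((Lp.aestronglyMeasurable h).smul_measure _).enorm.pow_const 2
    rw [h4, ← mul_assoc, ← ENNReal.ofReal_mul (by positivity), ← Real.rpow_natCast,
      ← Real.rpow_add hr, neg_add_cancel, Real.rpow_zero, ENNReal.ofReal_one, one_mul]
  rw [ENNReal.ofReal_eq_ofReal_iff (by positivity) (by positivity)] at h1
  exact (sq_eq_sq₀ (norm_nonneg _) (norm_nonneg _)).1 h1

lemma dil_dil {r t : ℝ} (hr : 0 < r) (ht : 0 < t) (h : Lp ℂ 2 (volume : Measure (Eu d))) :
    dil r (dil t h) = dil (r * t) h := by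
  refine Lp.ext ?_
  filter_upwards [coeFn_dil hr (dil t h), coeFn_dil (mul_pos hr ht) h,
    (quasiMeasurePreserving_inv_smul hr).ae (coeFn_dil ht h)] with ξ h1 h2 h3
  rw [h1, h2, h3, Real.mul_rpow hr.le ht.le, smul_smul, mul_inv_rev]
  push_cast
  ring

lemma dil_one (h : Lp ℂ 2 (volume : Measure (Eu d))) : dil 1 h = h := by
  refine Lp.ext ?_
  filter_upwards [coeFn_dil one_pos h] with ξ h1
  rw [h1]
  simp

/-- Dominated convergence: for `1/2 < r < 2` all dilates live in one ball of radius `2|R|` and share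
a bound. -/
lemma tendsto_dil_one_of_continuous {g : Eu d → ℂ} (hg : Continuous g) (hc : HasCompactSupport g)
    (hm : MemLp g 2) : Tendsto (fun r => dil r (hm.toLp g)) (𝓝 1) (𝓝 (hm.toLp g)) := by
  obtain ⟨R, hR⟩ := hc.isCompact.isBounded.subset_closedBall 0
  obtain ⟨K, hK⟩ := hg.bounded_above_of_compact_support hc
  have hK0 : 0 ≤ K := (norm_nonneg _).trans (hK 0)
  have hz : ∀ ξ, R < ‖ξ‖ → g ξ = 0 := fun ξ hξ => by
    by_contra hne
    have := hR (subset_tsupport g hne)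
    rw [mem_closedBall_zero_iff] at this
    exact absurd this (not_le.2 hξ)
  have hnear : ∀ᶠ r : ℝ in 𝓝 1, 1 / 2 < r ∧ r < 2 :=
    (lt_mem_nhds (by norm_num)).and (gt_mem_nhds (by norm_num))
  have hint : Tendsto (fun r : ℝ => ∫⁻ ξ, ‖((r ^ (-((d : ℝ) / 2)) : ℝ) : ℂ) * g (r⁻¹ • ξ) - g ξ‖ₑ ^ 2)
      (𝓝 1) (𝓝 (∫⁻ _ : Eu d, 0)) := by
    refine tendsto_lintegral_filter_of_dominated_convergence
      ((Metric.closedBall (0 : Eu d) (2 * |R|)).indicator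
        fun _ => ENNReal.ofReal (((1 / 2) ^ (-((d : ℝ) / 2)) * K + K) ^ 2)) ?_ ?_ ?_ ?_
    · refine Eventually.of_forall fun r => ?_
      have : Continuous fun ξ : Eu d => ((r ^ (-((d : ℝ) / 2)) : ℝ) : ℂ) * g (r⁻¹ • ξ) - g ξ := by
        fun_prop
      exact this.measurable.enorm.pow_const 2
    · filter_upwards [hnear] with r ⟨h1, h2⟩
      refine Eventually.of_forall fun ξ => ?_
      by_cases hξ : ξ ∈ Metric.closedBall (0 : Eu d) (2 * |R|)
      · rw [Set.indicator_of_mem hξ, ← ofReal_norm, ← ENNReal.ofReal_pow (norm_nonneg _)]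
        refine ENNReal.ofReal_le_ofReal (pow_le_pow_left₀ (norm_nonneg _) ?_ 2)
        refine (norm_sub_le _ _).trans (add_le_add ?_ (hK _))
        rw [norm_mul, Complex.norm_real, Real.norm_of_nonneg (by positivity)]
        refine mul_le_mul ?_ (hK _) (norm_nonneg _) (by positivity)
        exact Real.rpow_le_rpow_of_nonpos (by norm_num) h1.le (by
          rw [neg_nonpos]
          positivity)
      · have h3 : 2 * |R| < ‖ξ‖ := by simpa using hξ
        have h4 := le_abs_self R
        have h5 := abs_nonneg R
        have hr : 0 < r := by linarith
        have h6 : R < ‖r⁻¹ • ξ‖ := by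
          rw [norm_smul, Real.norm_of_nonneg (by positivity), ← div_eq_inv_mul, lt_div_iff₀ hr]
          nlinarith
        rw [hz ξ (by linarith), hz _ h6]
        simp
    · rw [lintegral_indicator_const measurableSet_closedBall]
      exact ENNReal.mul_ne_top ENNReal.ofReal_ne_top
        (isCompact_closedBall _ _).measure_lt_top.ne
    · refine Eventually.of_forall fun ξ => ?_
      have : ContinuousAt (fun r : ℝ => ‖((r ^ (-((d : ℝ) / 2)) : ℝ) : ℂ) * g (r⁻¹ • ξ) - g ξ‖ₑ ^ 2)
          1 := by
        have h1 : ContinuousAt (fun r : ℝ => ((r ^ (-((d : ℝ) / 2)) : ℝ) : ℂ)) 1 :=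
          Complex.continuous_ofReal.continuousAt.comp
            (Real.continuousAt_rpow_const _ _ (Or.inl one_ne_zero))
        have h2 : ContinuousAt (fun r : ℝ => g (r⁻¹ • ξ)) 1 :=
          hg.continuousAt.comp ((continuousAt_inv₀ one_ne_zero).smul continuousAt_const)
        exact (ENNReal.continuous_pow 2).continuousAt.comp
          ((h1.mul h2).sub continuousAt_const).enorm
      simpa using this.tendsto
  rw [lintegral_zero] at hint
  have h2 : Tendsto (fun r => ENNReal.ofReal (‖dil r (hm.toLp g) - hm.toLp g‖ ^ 2)) (𝓝 1)
      (𝓝 0) := by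
    refine hint.congr' ?_
    filter_upwards [hnear] with r ⟨h1, _⟩
    have hr : 0 < r := by linarith
    rw [← lintegral_sq_enorm_Lp]
    refine lintegral_congr_ae ?_
    filter_upwards [coeFn_dil hr (hm.toLp g), hm.coeFn_toLp,
      (quasiMeasurePreserving_inv_smul hr).ae hm.coeFn_toLp,
      Lp.coeFn_sub (dil r (hm.toLp g)) (hm.toLp g)] with ξ h1 h2 h3 h4
    rw [h4, Pi.sub_apply, h1, h2, h3]
  have h3 := (ENNReal.tendsto_toReal ENNReal.zero_ne_top).comp h2
  have h4 : Tendsto (fun r => ‖dil r (hm.toLp g) - hm.toLp g‖ ^ 2) (𝓝 1) (𝓝 0) := by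
    refine h3.congr fun r => ?_
    rw [Function.comp_apply, ENNReal.toReal_ofReal (by positivity)]
  have h5 := h4.sqrt
  simp only [Real.sqrt_sq (norm_nonneg _), Real.sqrt_zero] at h5
  exact tendsto_iff_norm_sub_tendsto_zero.2 h5

/-- Dilations are isometries, so convergence passes from the dense set of compactly supported
continuous functions to all of `L²`. -/
lemma tendsto_dil_one (h : Lp ℂ 2 (volume : Measure (Eu d))) :
    Tendsto (fun r => dil r h) (𝓝 1) (𝓝 h) := by
  rw [Metric.tendsto_nhds]
  intro ε hε
  obtain ⟨g, hgc, hle, hg, hm⟩ := (Lp.memLp h).exists_hasCompactSupport_eLpNorm_sub_le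
    (by norm_num) (ε := ENNReal.ofReal (ε / 4)) (by simpa using hε)
  have hle' : ‖h - hm.toLp g‖ ≤ ε / 4 := by
    rw [Lp.norm_def]
    refine ENNReal.toReal_le_of_le_ofReal (by positivity) ?_
    refine (eLpNorm_congr_ae ?_).trans_le hle
    filter_upwards [Lp.coeFn_sub h (hm.toLp g), hm.coeFn_toLp] with ξ h1 h2
    rw [h1, Pi.sub_apply, h2, Pi.sub_apply]
  have h1 := Metric.tendsto_nhds.1 (tendsto_dil_one_of_continuous hg hgc hm) (ε / 4)
    (by positivity)
  filter_upwards [h1, lt_mem_nhds (zero_lt_one' ℝ)] with r hr hr0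
  rw [dist_eq_norm] at *
  have h2 : ‖dil r h - dil r (hm.toLp g)‖ ≤ ε / 4 := by
    rw [← dil_sub, norm_dil hr0]
    exact hle'
  have h3 : dil r h - h = (dil r h - dil r (hm.toLp g)) + (dil r (hm.toLp g) - hm.toLp g) -
      (h - hm.toLp g) := by abel
  rw [h3]
  have := norm_sub_le ((dil r h - dil r (hm.toLp g)) + (dil r (hm.toLp g) - hm.toLp g))
    (h - hm.toLp g)
  have := norm_add_le (dil r h - dil r (hm.toLp g)) (dil r (hm.toLp g) - hm.toLp g)
  linarith

lemma continuousOn_dil (h : Lp ℂ 2 (volume : Measure (Eu d))) :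
    ContinuousOn (fun r => dil r h) (Set.Ioi 0) := by
  intro t ht
  have ht : 0 < t := ht
  refine ContinuousAt.continuousWithinAt ?_
  have h1 : Tendsto (fun r : ℝ => r / t) (𝓝 t) (𝓝 1) := by
    have : Tendsto (fun r : ℝ => r / t) (𝓝 t) (𝓝 (t / t)) := tendsto_id.div_const t
    rwa [div_self ht.ne'] at this
  refine ((tendsto_dil_one (dil t h)).comp h1).congr' ?_
  filter_upwards [lt_mem_nhds ht] with r hr
  rw [Function.comp_apply, dil_dil (div_pos hr ht) ht, div_mul_cancel₀ _ ht.ne']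

end

/-! ### Tempered functions and their Fourier transforms. -/

section

open FourierTransform

variable {d : ℕ}

lemma exists_norm_schwartz_le (φ : 𝓢(Eu d, ℂ)) (N : ℕ) :
    ∃ C : ℝ, 0 ≤ C ∧ ∀ x, ‖φ x‖ ≤ C * ((1 + ‖x‖) ^ N)⁻¹ := by
  refine ⟨2 ^ N * (Finset.Iic (N, 0)).sup (fun m => SchwartzMap.seminorm ℂ m.1 m.2) φ,
    by positivity, fun x => ?_⟩
  have h := SchwartzMap.one_add_le_sup_seminorm_apply (𝕜 := ℂ) (m := (N, 0)) (k := N) (n := 0)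
    le_rfl le_rfl φ x
  rw [norm_iteratedFDeriv_zero, mul_comm] at h
  rw [← div_eq_mul_inv, le_div_iff₀ (by positivity)]
  exact h

lemma integrableOn_rpow_mul_inv_pow {a : ℝ} (ha : -1 < a) {N : ℕ} (hN : a + 1 < N) :
    IntegrableOn (fun r : ℝ => r ^ a * ((1 + r) ^ N)⁻¹) (Set.Ioi 0) := by
  have hm : Measurable fun r : ℝ => r ^ a * ((1 + r) ^ N)⁻¹ := by fun_prop
  rw [← Set.Ioc_union_Ioi_eq_Ioi (zero_le_one' ℝ)]
  refine IntegrableOn.union ?_ ?_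
  · refine Integrable.mono' (intervalIntegral.intervalIntegrable_rpow' (a := 0) (b := 1) ha).1
      hm.aestronglyMeasurable ?_
    filter_upwards [ae_restrict_mem measurableSet_Ioc] with r hr
    have hr0 : 0 < r := hr.1
    rw [Real.norm_of_nonneg (by positivity)]
    exact mul_le_of_le_one_right (by positivity)
      (inv_le_one_of_one_le₀ (one_le_pow₀ (by linarith)))
  · refine Integrable.mono' (integrableOn_Ioi_rpow_of_lt (a := a - N) (by linarith) one_pos)
      hm.aestronglyMeasurable ?_
    filter_upwards [ae_restrict_mem measurableSet_Ioi] with r hr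
    have hr1 : 1 < r := hr
    have hr0 : 0 < r := by linarith
    rw [Real.norm_of_nonneg (by positivity), Real.rpow_sub hr0, Real.rpow_natCast,
      div_eq_mul_inv]
    gcongr
    linarith

lemma nontrivial_eu (hd : 2 ≤ d) : Nontrivial (Eu d) := by
  have : Nonempty (Fin d) := ⟨⟨0, by omega⟩⟩
  infer_instance

/-- The condition `s < d/2` is exactly local integrability of `|ξ|^{-2s}` at the origin; Schwartz
decay takes care of infinity. By duality `|ξ|^{-s} h` is tempered for every `h` in `L²`. -/
lemma memLp_weight_schwartz (hd : 2 ≤ d) {s : ℝ} (hs' : s < (d : ℝ) / 2) (φ : 𝓢(Eu d, ℂ)) :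
    MemLp (fun ξ => ((‖ξ‖ ^ (-s) : ℝ) : ℂ) * φ ξ) 2 := by
  have hnt := nontrivial_eu hd
  have hm : AEStronglyMeasurable (fun ξ : Eu d => ((‖ξ‖ ^ (-s) : ℝ) : ℂ) * φ ξ) volume := by
    have h1 : Measurable fun ξ : Eu d => ((‖ξ‖ ^ (-s) : ℝ) : ℂ) := by fun_prop
    exact h1.aestronglyMeasurable.mul φ.continuous.aestronglyMeasurable
  rw [memLp_two_iff_integrable_sq_norm hm]
  obtain ⟨N, hN⟩ := exists_nat_gt ((d : ℝ) - 2 * s)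
  obtain ⟨C, hC0, hC⟩ := exists_norm_schwartz_le φ N
  have hint : Integrable (fun ξ : Eu d => C ^ 2 * (‖ξ‖ ^ (-(2 * s)) * ((1 + ‖ξ‖) ^ (2 * N))⁻¹)) := by
    refine Integrable.const_mul ?_ _
    rw [integrable_fun_norm_addHaar volume
      (f := fun r : ℝ => r ^ (-(2 * s)) * ((1 + r) ^ (2 * N))⁻¹), finrank_euclideanSpace_fin]
    refine (integrableOn_rpow_mul_inv_pow (a := (d : ℝ) - 1 - 2 * s) (N := 2 * N) (by linarith)
      (by push_cast; linarith [Nat.cast_nonneg (α := ℝ) N])).congr_fun (fun r hr => ?_) measurableSet_Ioi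
    have hr : 0 < r := hr
    change r ^ ((d : ℝ) - 1 - 2 * s) * _ = r ^ (d - 1) • (r ^ (-(2 * s)) * _)
    rw [smul_eq_mul, ← mul_assoc, ← Real.rpow_natCast r, ← Real.rpow_add hr]
    congr 2
    rw [Nat.cast_sub (by omega)]
    push_cast
    ring
  refine hint.mono' (hm.norm.pow 2) (Eventually.of_forall fun ξ => ?_)
  rw [Real.norm_of_nonneg (by positivity), norm_mul, mul_pow, Complex.norm_real,
    Real.norm_of_nonneg (by positivity)]
  have h1 : ‖φ ξ‖ ^ 2 ≤ (C * ((1 + ‖ξ‖) ^ N)⁻¹) ^ 2 := by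
    gcongr
    exact hC ξ
  have h2 : (‖ξ‖ ^ (-s)) ^ 2 = ‖ξ‖ ^ (-(2 * s)) := by
    rw [← Real.rpow_mul_natCast (norm_nonneg _)]
    congr 1
    push_cast
    ring
  rw [h2]
  calc ‖ξ‖ ^ (-(2 * s)) * ‖φ ξ‖ ^ 2 ≤ ‖ξ‖ ^ (-(2 * s)) * (C * ((1 + ‖ξ‖) ^ N)⁻¹) ^ 2 := by gcongr
    _ = _ := by
      rw [mul_pow, inv_pow, ← pow_mul, mul_comm N 2]
      ring

lemma isTempered_of_memLp {f : Eu d → ℂ} (hf : MemLp f 2) : IsTempered f := fun φ =>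
  hf.integrable_mul (φ.memLp 2)

lemma isTempered_weight (hd : 2 ≤ d) {s : ℝ} (hs' : s < (d : ℝ) / 2) {h : Eu d → ℂ}
    (hh : MemLp h 2) : IsTempered fun ξ => ((‖ξ‖ ^ (-s) : ℝ) : ℂ) * h ξ := fun φ => by
  refine ((memLp_weight_schwartz hd hs' φ).integrable_mul hh).congr (Eventually.of_forall fun ξ => ?_)
  simp only [Pi.mul_apply]
  ring

lemma IsTempered.congr {f g : Eu d → ℂ} (hf : IsTempered f) (h : f =ᵐ[volume] g) :
    IsTempered g := fun φ => (hf φ).congr (h.mul EventuallyEq.rfl)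

lemma IsFourier.congr {f f' F F' : Eu d → ℂ} (h : IsFourier f F) (hf : f =ᵐ[volume] f')
    (hF : F =ᵐ[volume] F') : IsFourier f' F' := by
  refine ⟨h.1.congr hf, h.2.1.congr hF, fun φ => ?_⟩
  have h1 : ∫ ξ, F ξ * φ ξ = ∫ ξ, F' ξ * φ ξ := integral_congr_ae (hF.mul EventuallyEq.rfl)
  have h2 : ∫ x, f x * fourierInt (fun y => φ y) x = ∫ x, f' x * fourierInt (fun y => φ y) x :=
    integral_congr_ae (hf.mul EventuallyEq.rfl)
  rw [← h1, ← h2]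
  exact h.2.2 φ

lemma IsTempered.locallyIntegrable {f : Eu d → ℂ} (hf : IsTempered f) :
    LocallyIntegrable f volume := by
  intro x
  let g : ContDiffBump x := default
  have hg : ContDiff ℝ (((⊤ : ℕ∞) : WithTop ℕ∞)) fun y => ((g y : ℝ) : ℂ) :=
    Complex.ofRealCLM.contDiff.comp g.contDiff
  have hc : HasCompactSupport fun y => ((g y : ℝ) : ℂ) :=
    g.hasCompactSupport.comp_left Complex.ofReal_zero
  refine ⟨Metric.closedBall x g.rIn, Metric.closedBall_mem_nhds x g.rIn_pos, ?_⟩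
  refine (hf (hc.toSchwartzMap hg)).integrableOn.congr_fun (fun y hy => ?_)
    measurableSet_closedBall
  change f y * ((g y : ℝ) : ℂ) = f y
  rw [g.one_of_mem_closedBall hy, Complex.ofReal_one, mul_one]

lemma IsTempered.ae_eq {f g : Eu d → ℂ} (hf : IsTempered f) (hg : IsTempered g)
    (h : ∀ φ : 𝓢(Eu d, ℂ), ∫ x, f x * φ x = ∫ x, g x * φ x) : f =ᵐ[volume] g := by
  have h1 := ae_eq_zero_of_integral_contDiff_smul_eq_zero
    (hf.locallyIntegrable.sub hg.locallyIntegrable) (μ := volume) fun φ hφ hc => by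
      have hφ' : ContDiff ℝ (((⊤ : ℕ∞) : WithTop ℕ∞)) fun x => ((φ x : ℝ) : ℂ) := Complex.ofRealCLM.contDiff.comp hφ
      have hc' : HasCompactSupport fun x => ((φ x : ℝ) : ℂ) := hc.comp_left Complex.ofReal_zero
      have h2 := h (hc'.toSchwartzMap hφ')
      have h3 : ∀ x, φ x • (f - g) x = f x * (hc'.toSchwartzMap hφ') x -
          g x * (hc'.toSchwartzMap hφ') x := fun x => by
        change φ x • (f - g) x = f x * ((φ x : ℝ) : ℂ) - g x * ((φ x : ℝ) : ℂ)
        rw [Pi.sub_apply, Complex.real_smul]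
        ring
      simp only [h3]
      rw [integral_sub (hf _) (hg _), h2, sub_self]
  filter_upwards [h1] with x hx
  exact sub_eq_zero.1 hx

/-- The scaling by `2π`. -/
def scale (d : ℕ) : Eu d ≃L[ℝ] Eu d :=
  ContinuousLinearEquiv.smulLeft (Units.mk0 (2 * Real.pi) (by positivity))

/-- The Fourier transform without `2π` in the exponent, on Schwartz functions. -/
def fourierS (φ : 𝓢(Eu d, ℂ)) : 𝓢(Eu d, ℂ) :=
  SchwartzMap.compCLMOfContinuousLinearEquiv ℂ (scale d).symm (𝓕 φ)

lemma fourierS_apply (φ : 𝓢(Eu d, ℂ)) (x : Eu d) :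
    fourierS φ x = (𝓕 φ) ((2 * Real.pi)⁻¹ • x) := rfl

lemma fourierInt_eq (φ : 𝓢(Eu d, ℂ)) : fourierInt (fun y => φ y) = fourierS φ := by
  ext x
  rw [fourierS_apply, SchwartzMap.fourier_coe, Real.fourier_eq', fourierInt]
  refine integral_congr_ae (Eventually.of_forall fun y => ?_)
  simp only [smul_eq_mul]
  rw [mul_comm, inner_smul_right]
  congr 2
  have := Real.pi_pos.ne'
  push_cast
  field_simp

lemma fourierS_surjective (ψ : 𝓢(Eu d, ℂ)) : ∃ φ, fourierS φ = ψ := by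
  refine ⟨𝓕⁻ (SchwartzMap.compCLMOfContinuousLinearEquiv ℂ (scale d) ψ), ?_⟩
  ext x
  rw [fourierS, FourierTransform.fourier_fourierInv_eq]
  change ψ (scale d ((scale d).symm x)) = ψ x
  rw [ContinuousLinearEquiv.apply_symm_apply]

lemma integral_fourierS_mul_exp (φ : 𝓢(Eu d, ℂ)) (ξ : Eu d) :
    ∫ x, fourierS φ x * Complex.exp (Complex.I * ((inner ℝ x ξ : ℝ) : ℂ)) =
      (((2 * Real.pi) ^ d : ℝ) : ℂ) * φ ξ := by
  have h1 : φ ξ = 𝓕⁻ (𝓕 φ) ξ := by rw [FourierTransform.fourierInv_fourier_eq]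
  have hπ := Real.pi_pos
  have h2 := Measure.integral_comp_inv_smul (volume : Measure (Eu d))
    (fun v => Complex.exp (Complex.I * ((inner ℝ ((2 * Real.pi) • v) ξ : ℝ) : ℂ)) * (𝓕 φ) v) (2 * Real.pi)
  rw [finrank_euclideanSpace_fin, abs_of_pos (by positivity)] at h2
  rw [h1, SchwartzMap.fourierInv_coe, Real.fourierInv_eq', ← Complex.real_smul]
  refine Eq.trans ?_ (h2.trans ?_)
  · refine integral_congr_ae (Eventually.of_forall fun x => ?_)
    simp only [fourierS_apply, smul_smul, mul_inv_cancel₀ (by positivity : 2 * Real.pi ≠ 0), one_smul]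
    rw [mul_comm]
  · congr 1
    refine integral_congr_ae (Eventually.of_forall fun x => ?_)
    simp only [smul_eq_mul, inner_smul_left]
    congr 2
    simp
    ring

lemma IsFourier.ae_eq_right {f F F' : Eu d → ℂ} (h : IsFourier f F) (h' : IsFourier f F') :
    F =ᵐ[volume] F' :=
  h.2.1.ae_eq h'.2.1 fun φ => (h.2.2 φ).trans (h'.2.2 φ).symm

lemma IsFourier.ae_eq_left {f f' F : Eu d → ℂ} (h : IsFourier f F) (h' : IsFourier f' F) :
    f =ᵐ[volume] f' := by
  refine h.1.ae_eq h'.1 fun ψ => ?_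
  obtain ⟨φ, rfl⟩ := fourierS_surjective ψ
  have := (h.2.2 φ).symm.trans (h'.2.2 φ)
  rwa [fourierInt_eq] at this

lemma IsFourier.fourierT_ae_eq {f F : Eu d → ℂ} (h : IsFourier f F) :
    fourierT f =ᵐ[volume] F := by
  have h1 : ∃ F, IsFourier f F := ⟨F, h⟩
  rw [fourierT, dif_pos h1]
  exact h1.choose_spec.ae_eq_right h

lemma exists_isFourier_of_memLp {h : Eu d → ℂ} (hh : MemLp h 2) :
    ∃ g : Eu d → ℂ, MemLp g 2 ∧ IsFourier g h := by
  have hπ := Real.pi_pos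
  -- The unitary transform has `2π` in its exponent, so the inverse without it is `(2π)^{-d} g₀(x /
  -- 2π)`.
  set g₀ : Lp ℂ 2 (volume : Measure (Eu d)) := 𝓕⁻ (hh.toLp h)
  have hg₀ : 𝓕 g₀ = hh.toLp h := FourierTransform.fourier_fourierInv_eq _
  have hm : MemLp (fun x => ((((2 * Real.pi) ^ d)⁻¹ : ℝ) : ℂ) * g₀ ((2 * Real.pi)⁻¹ • x)) 2 :=
    (memLp_inv_smul (by positivity) (Lp.memLp g₀)).const_mul _
  refine ⟨_, hm, isTempered_of_memLp hm, isTempered_of_memLp hh, fun φ => ?_⟩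
  have h1 := congrArg (fun T => T φ) (Lp.fourier_toTemperedDistribution_eq g₀)
  simp only [TemperedDistribution.fourier_apply, Lp.toTemperedDistribution_apply, hg₀,
    smul_eq_mul] at h1
  have h2 := Measure.integral_comp_inv_smul (volume : Measure (Eu d))
    (fun v => (𝓕 φ) v * g₀ v) (2 * Real.pi)
  rw [finrank_euclideanSpace_fin, abs_of_pos (by positivity), h1] at h2
  rw [fourierInt_eq]
  calc ∫ ξ, h ξ * φ ξ = ∫ ξ, φ ξ * hh.toLp h ξ := by
        refine integral_congr_ae ?_
        filter_upwards [hh.coeFn_toLp] with ξ hξ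
        rw [hξ, mul_comm]
    _ = ((((2 * Real.pi) ^ d)⁻¹ : ℝ) : ℂ) * ∫ x, (𝓕 φ) ((2 * Real.pi)⁻¹ • x) * g₀ ((2 * Real.pi)⁻¹ • x) := by
        rw [h2, Complex.real_smul, ← mul_assoc, ← Complex.ofReal_mul,
          inv_mul_cancel₀ (by positivity), Complex.ofReal_one, one_mul]
    _ = _ := by
        rw [← integral_const_mul]
        refine integral_congr_ae (Eventually.of_forall fun x => ?_)
        simp only [fourierS_apply]
        ring

end

/-! ### Radial slices of a function with given Fourier transform. -/

section
variable {d : ℕ}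

lemma inner_dil {r : ℝ} (hr : 0 < r) (x y : Lp ℂ 2 (volume : Measure (Eu d))) :
    inner ℂ (dil r x) (dil r y) = inner ℂ x y := by
  rw [L2.inner_def, L2.inner_def]
  have h2 := Measure.integral_comp_inv_smul_of_nonneg (volume : Measure (Eu d))
    (fun ξ => inner ℂ (x ξ) (y ξ)) hr.le
  rw [finrank_euclideanSpace_fin] at h2
  have h3 : ∫ ξ, inner ℂ (dil r x ξ) (dil r y ξ) =
      ∫ ξ, (r ^ d)⁻¹ • inner ℂ (x (r⁻¹ • ξ)) (y (r⁻¹ • ξ)) := by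
    refine integral_congr_ae ?_
    filter_upwards [coeFn_dil hr x, coeFn_dil hr y] with ξ h4 h5
    have h6 : r ^ (-((d : ℝ) / 2)) * r ^ (-((d : ℝ) / 2)) = (r ^ d)⁻¹ := by
      rw [← Real.rpow_add hr, ← neg_add, add_halves, Real.rpow_neg hr.le, Real.rpow_natCast]
    rw [h4, h5, ← h6, Complex.real_smul]
    simp only [RCLike.inner_apply, map_mul, Complex.conj_ofReal]
    push_cast
    ring
  rw [h3, integral_smul, h2, smul_smul, inv_mul_cancel₀ (by positivity), one_smul]

lemma lintegral_enorm_mul_le (x y : Lp ℂ 2 (volume : Measure (Eu d))) :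
    ∫⁻ ξ, ‖x ξ * y ξ‖ₑ ≤ ‖x‖ₑ * ‖y‖ₑ := by
  have h := eLpNorm_smul_le_mul_eLpNorm (p := 2) (q := 2) (r := 1)
    (Lp.aestronglyMeasurable y) (Lp.aestronglyMeasurable x)
  rw [eLpNorm_one_eq_lintegral_enorm] at h
  simpa only [Lp.enorm_def, Pi.smul_apply', smul_eq_mul] using h

/-- The radial slices at radius `r` of the function with Fourier transform `|ξ|^{-s} h` (or of
its image under a function of the Laplace-Beltrami operator, encoded in `B`). -/
def radialTrace (s : ℝ) (B : L2S d →L[ℂ] Lp ℂ 2 (volume : Measure (Eu d)))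
    (h : Lp ℂ 2 (volume : Measure (Eu d))) (r : ℝ) : L2S d :=
  ((((2 * Real.pi) ^ d)⁻¹ * r ^ (s - (d : ℝ) / 2) : ℝ) : ℂ) • B.adjoint (dil r h)

variable {s : ℝ} {θ : ℝ → ℂ} {B A : L2S d →L[ℂ] Lp ℂ 2 (volume : Measure (Eu d))}

lemma continuousOn_radialTrace (s : ℝ) (B : L2S d →L[ℂ] Lp ℂ 2 (volume : Measure (Eu d)))
    (h : Lp ℂ 2 (volume : Measure (Eu d))) :
    ContinuousOn (radialTrace s B h) (Set.Ioi 0) := by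
  suffices h1 : ContinuousOn (fun r : ℝ =>
      ((((2 * Real.pi) ^ d)⁻¹ * r ^ (s - (d : ℝ) / 2) : ℝ) : ℂ)) (Set.Ioi 0) from
    h1.smul (B.adjoint.continuous.comp_continuousOn (continuousOn_dil h))
  refine Complex.continuous_ofReal.comp_continuousOn (continuousOn_const.mul fun r hr => ?_)
  exact (Real.continuousAt_rpow_const _ _ (Or.inl (ne_of_gt hr))).continuousWithinAt

lemma norm_radialTrace_le {r : ℝ} (hr : 0 < r) (h : Lp ℂ 2 (volume : Measure (Eu d))) :
    ‖radialTrace s B h r‖ ≤ ((2 * Real.pi) ^ d)⁻¹ * (‖B‖ * ‖h‖) * r ^ (s - (d : ℝ) / 2) := by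
  have hπ := Real.pi_pos
  rw [radialTrace, norm_smul, Complex.norm_real, Real.norm_of_nonneg (by positivity)]
  have h1 : ‖B.adjoint (dil r h)‖ ≤ ‖B‖ * ‖h‖ := by
    refine (B.adjoint.le_opNorm _).trans ?_
    rw [LinearIsometryEquiv.norm_map, norm_dil hr]
  calc _ ≤ ((2 * Real.pi) ^ d)⁻¹ * r ^ (s - (d : ℝ) / 2) * (‖B‖ * ‖h‖) := by gcongr
    _ = _ := by ring

lemma isThetaSphere_radialTrace (hd : 2 ≤ d) (hB : IsSynth s θ B) (hA : IsSynth s 1 A)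
    (h : Lp ℂ 2 (volume : Measure (Eu d))) (r : ℝ) :
    IsThetaSphere (fun t => starRingEnd ℂ (θ t)) (radialTrace s A h r) (radialTrace s B h r) := by
  have := (hB.isThetaSphere_adjoint hd hA (dil r h)).const_smul
    ((((2 * Real.pi) ^ d)⁻¹ * r ^ (s - (d : ℝ) / 2) : ℝ) : ℂ)
  refine this.congr_fun fun k => ?_
  rw [radialTrace, map_smul, smul_comm]

lemma radialTrace_one (s : ℝ) (B : L2S d →L[ℂ] Lp ℂ 2 (volume : Measure (Eu d)))
    (h : Lp ℂ 2 (volume : Measure (Eu d))) :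
    radialTrace s B h 1 = ((((2 * Real.pi) ^ d)⁻¹ : ℝ) : ℂ) • B.adjoint h := by
  rw [radialTrace, Real.one_rpow, mul_one, dil_one]

/-- The sphere has finite measure, so slice bounds in `L²` are slice bounds in `L¹`. Against
`r^{d-1}` the power `r^a` is integrable at `0` because `a > -d`, and the test function decays at
infinity. -/
lemma isTempered_of_slice (hd : 2 ≤ d) {f : Eu d → ℂ} (hf : AEStronglyMeasurable f volume)
    {v : ℝ → L2S d}
    (hv : ∀ᵐ r ∂(volume.restrict (Set.Ioi (0 : ℝ))), slice f r =ᵐ[surf d] v r)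
    {C a : ℝ} (ha : -(d : ℝ) < a) (hb : ∀ r, 0 < r → ‖v r‖ ≤ C * r ^ a) :
    IsTempered f := by
  intro φ
  refine ⟨hf.mul φ.continuous.aestronglyMeasurable, ?_⟩
  obtain ⟨N, hN⟩ := exists_nat_gt ((d : ℝ) - 1 + a + 1)
  obtain ⟨D, hD0, hD⟩ := exists_norm_schwartz_le φ N
  have hm : AEMeasurable (fun x => ‖f x * φ x‖ₑ) :=
    (hf.mul φ.continuous.aestronglyMeasurable).enorm
  set K : ENNReal := surf d Set.univ ^ (1 / (1 : ENNReal).toReal - 1 / (2 : ENNReal).toReal)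
  have hK : K ≠ ⊤ := by
    refine ENNReal.rpow_ne_top_of_nonneg ?_ (measure_ne_top _ _)
    norm_num
  have hL1 : ∀ w : L2S d, ∫⁻ ω, ‖w ω‖ₑ ∂surf d ≤ ‖w‖ₑ * K := fun w => by
    rw [← eLpNorm_one_eq_lintegral_enorm, Lp.enorm_def]
    exact eLpNorm_le_eLpNorm_mul_rpow_measure_univ (p := 1) (q := 2) (by norm_num) (Lp.aestronglyMeasurable w)
  rw [HasFiniteIntegral, lintegral_polar hd hm]
  have hint := (integrableOn_rpow_mul_inv_pow (a := (d : ℝ) - 1 + a) (N := N) (by linarith)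
    hN).const_mul (D * C)
  refine lt_of_le_of_lt ?_ (ENNReal.mul_lt_top hint.lintegral_lt_top (lt_top_iff_ne_top.2 hK))
  rw [← lintegral_mul_const' _ _ hK]
  refine lintegral_mono_ae ?_
  filter_upwards [hv, ae_restrict_mem measurableSet_Ioi] with r hr hr0
  have hr0 : 0 < r := hr0
  have h1 : ∫⁻ ω : Sph d, ‖f (r • (ω : Eu d)) * φ (r • (ω : Eu d))‖ₑ ∂surf d ≤
      ENNReal.ofReal (D * ((1 + r) ^ N)⁻¹) * (ENNReal.ofReal (C * r ^ a) * K) := by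
    calc _ ≤ ∫⁻ ω : Sph d, ENNReal.ofReal (D * ((1 + r) ^ N)⁻¹) * ‖v r ω‖ₑ ∂surf d := by
          refine lintegral_mono_ae ?_
          filter_upwards [hr] with ω hω
          have hω : f (r • (ω : Eu d)) = v r ω := hω
          rw [enorm_mul, hω, mul_comm]
          gcongr
          rw [← ofReal_norm]
          refine ENNReal.ofReal_le_ofReal ((hD _).trans_eq ?_)
          rw [norm_smul, norm_coe_sph, mul_one, Real.norm_of_nonneg hr0.le]
      _ ≤ _ := by
          rw [lintegral_const_mul' _ _ ENNReal.ofReal_ne_top]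
          gcongr
          refine (hL1 _).trans ?_
          gcongr
          rw [← ofReal_norm]
          exact ENNReal.ofReal_le_ofReal (hb r hr0)
  calc _ ≤ ENNReal.ofReal (r ^ (d - 1)) *
        (ENNReal.ofReal (D * ((1 + r) ^ N)⁻¹) * (ENNReal.ofReal (C * r ^ a) * K)) := by gcongr
    _ = _ := by
      rw [← mul_assoc, ← mul_assoc, ← ENNReal.ofReal_mul (by positivity),
        ← ENNReal.ofReal_mul (by positivity)]
      congr 2
      have h2 : r ^ ((d : ℝ) - 1 + a) = r ^ (d - 1) * r ^ a := by
        rw [Real.rpow_add hr0, ← Real.rpow_natCast r (d - 1), Nat.cast_sub (by omega)]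
        push_cast
        rfl
      rw [h2]
      ring

/-- The conjugates of the restrictions of a Schwartz function to the spheres of radius `r`. -/
def conjSlice (ψ : 𝓢(Eu d, ℂ)) : C(ℝ, C(Sph d, ℂ)) :=
  ContinuousMap.curry ⟨fun q : ℝ × Sph d => starRingEnd ℂ (ψ (q.1 • (q.2 : Eu d))), by
    have := ψ.continuous
    fun_prop⟩

lemma conjSlice_apply (ψ : 𝓢(Eu d, ℂ)) (r : ℝ) (ω : Sph d) :
    conjSlice ψ r ω = starRingEnd ℂ (ψ (r • (ω : Eu d))) := rfl

/-- `conjSlice` in `L²`. -/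
def conjSliceL2 (ψ : 𝓢(Eu d, ℂ)) (r : ℝ) : L2S d :=
  (ContinuousMap.toLp 2 (surf d) ℂ : C(Sph d, ℂ) →L[ℂ] L2S d) (conjSlice ψ r)

lemma coeFn_conjSliceL2 (ψ : 𝓢(Eu d, ℂ)) (r : ℝ) :
    conjSliceL2 ψ r =ᵐ[surf d] fun ω => starRingEnd ℂ (ψ (r • (ω : Eu d))) :=
  ContinuousMap.coeFn_toLp (p := 2) (𝕜 := ℂ) (surf d) (conjSlice ψ r)

lemma continuous_conjSliceL2 (ψ : 𝓢(Eu d, ℂ)) : Continuous (conjSliceL2 ψ) :=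
  (ContinuousLinearMap.continuous _).comp (conjSlice ψ).continuous

/-- The kernel `∫ ψ(r ω) exp (i r ⟨ω, ξ⟩) dσ(ω)`. -/
def polarKernel (ψ : 𝓢(Eu d, ℂ)) (r : ℝ) (ξ : Eu d) : ℂ :=
  inner ℂ (conjSliceL2 ψ r) (sphCharL2 d (r • ξ))

lemma polarKernel_eq_integral (ψ : 𝓢(Eu d, ℂ)) (r : ℝ) (ξ : Eu d) :
    polarKernel ψ r ξ = ∫ ω : Sph d, ψ (r • (ω : Eu d)) *
      Complex.exp (Complex.I * ((inner ℝ (r • (ω : Eu d)) ξ : ℝ) : ℂ)) ∂surf d := by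
  rw [polarKernel, L2.inner_def]
  refine integral_congr_ae ?_
  filter_upwards [coeFn_conjSliceL2 ψ r,
    ContinuousMap.coeFn_toLp (p := 2) (𝕜 := ℂ) (surf d) (sphChar d (r • ξ))] with ω h1 h2
  rw [sphCharL2, h2, h1, sphChar_apply, RCLike.inner_apply, Complex.conj_conj, mul_comm,
    inner_smul_left, inner_smul_right]
  rfl

lemma polarKernel_eq_extension (ψ : 𝓢(Eu d, ℂ)) (r : ℝ) (ξ : Eu d) :
    polarKernel ψ r ξ = starRingEnd ℂ (extension (conjSliceL2 ψ r) (r • ξ)) := by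
  rw [extension_eq_inner, inner_conj_symm, polarKernel]

lemma integral_polarKernel (hd : 2 ≤ d) (φ : 𝓢(Eu d, ℂ)) (ξ : Eu d) :
    ∫ r in Set.Ioi (0 : ℝ), ((r ^ (d - 1) : ℝ) : ℂ) * polarKernel (fourierS φ) r ξ =
      (((2 * Real.pi) ^ d : ℝ) : ℂ) * φ ξ := by
  rw [← integral_fourierS_mul_exp, integral_polar hd]
  · simp only [polarKernel_eq_integral]
  · refine ((fourierS φ).integrable (μ := volume)).norm.mono' ?_ (Eventually.of_forall fun x => ?_)
    · refine Continuous.aestronglyMeasurable ?_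
      have := (fourierS φ).continuous
      fun_prop
    · rw [norm_mul, mul_comm Complex.I, Complex.norm_exp_ofReal_mul_I, mul_one]

/-- Homogeneity of `|ξ|^{-s}` lets the dependence of the kernel on `r` be written as a dilation
applied to `A`. This is the origin of the power `r^{s-d/2}` in `radialTrace`. -/
lemma weight_polarKernel (hd : 2 ≤ d) (hA : IsSynth s 1 A) (ψ : 𝓢(Eu d, ℂ)) {r : ℝ}
    (hr : 0 < r) : ∀ᵐ ξ : Eu d, ((‖ξ‖ ^ (-s) : ℝ) : ℂ) * polarKernel ψ r ξ =
      ((r ^ (s - (d : ℝ) / 2) : ℝ) : ℂ) * starRingEnd ℂ (dil r⁻¹ (A (conjSliceL2 ψ r)) ξ) := by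
  have h0 := (quasiMeasurePreserving_inv_smul (d := d) (inv_pos.2 hr)).ae
    (hA.ae_eq_extension hd (conjSliceL2 ψ r))
  filter_upwards [coeFn_dil (inv_pos.2 hr) (A (conjSliceL2 ψ r)), h0] with ξ h1 h2
  rw [h1, ← h2, inv_inv, polarKernel_eq_extension, norm_smul, Real.norm_of_nonneg hr.le,
    Real.mul_rpow hr.le (norm_nonneg _)]
  simp only [map_mul, Complex.conj_ofReal]
  have h3 : r ^ (s - (d : ℝ) / 2) * ((r⁻¹) ^ (-((d : ℝ) / 2)) * r ^ (-s)) = 1 := by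
    rw [Real.inv_rpow hr.le, Real.rpow_neg hr.le, inv_inv, ← Real.rpow_add hr, ← Real.rpow_add hr]
    ring_nf
    exact Real.rpow_zero r
  have h4 : ((r ^ (s - (d : ℝ) / 2) : ℝ) : ℂ) * ((((r⁻¹) ^ (-((d : ℝ) / 2)) : ℝ) : ℂ) *
      ((r ^ (-s) : ℝ) : ℂ)) = 1 := by exact_mod_cast h3
  push_cast at h4 ⊢
  linear_combination (-(((‖ξ‖ ^ (-s) : ℝ) : ℂ)) *
    starRingEnd ℂ (extension (conjSliceL2 ψ r) (r • ξ))) * h4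

lemma integral_weight_polarKernel (hd : 2 ≤ d) (hA : IsSynth s 1 A) (ψ : 𝓢(Eu d, ℂ))
    (h : Lp ℂ 2 (volume : Measure (Eu d))) {r : ℝ} (hr : 0 < r) :
    ∫ ξ, ((‖ξ‖ ^ (-s) : ℝ) : ℂ) * h ξ * polarKernel ψ r ξ =
      (((2 * Real.pi) ^ d : ℝ) : ℂ) * inner ℂ (conjSliceL2 ψ r) (radialTrace s A h r) := by
  have hπ := Real.pi_pos
  have h1 : inner ℂ (dil r⁻¹ (A (conjSliceL2 ψ r))) h =
      inner ℂ (conjSliceL2 ψ r) (A.adjoint (dil r h)) := by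
    rw [ContinuousLinearMap.adjoint_inner_right, ← inner_dil hr (dil r⁻¹ _),
      dil_dil hr (inv_pos.2 hr), mul_inv_cancel₀ hr.ne', dil_one]
  rw [radialTrace, inner_smul_right, ← h1, ← mul_assoc, ← Complex.ofReal_mul,
    mul_inv_cancel_left₀ (by positivity), L2.inner_def, ← integral_const_mul]
  refine integral_congr_ae ?_
  filter_upwards [weight_polarKernel hd hA ψ hr] with ξ hξ
  rw [RCLike.inner_apply, mul_right_comm, hξ]
  ring

lemma lintegral_weight_polarKernel_le (hd : 2 ≤ d) (hA : IsSynth s 1 A) (ψ : 𝓢(Eu d, ℂ))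
    (h : Lp ℂ 2 (volume : Measure (Eu d))) {r : ℝ} (hr : 0 < r) :
    ∫⁻ ξ, ‖((‖ξ‖ ^ (-s) : ℝ) : ℂ) * h ξ * polarKernel ψ r ξ‖ₑ ≤
      ENNReal.ofReal (r ^ (s - (d : ℝ) / 2)) * (‖A (conjSliceL2 ψ r)‖ₑ * ‖h‖ₑ) := by
  have h1 : ∫⁻ ξ, ‖((‖ξ‖ ^ (-s) : ℝ) : ℂ) * h ξ * polarKernel ψ r ξ‖ₑ =
      ∫⁻ ξ, ENNReal.ofReal (r ^ (s - (d : ℝ) / 2)) *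
        ‖dil r⁻¹ (A (conjSliceL2 ψ r)) ξ * h ξ‖ₑ := by
    refine lintegral_congr_ae ?_
    filter_upwards [weight_polarKernel hd hA ψ hr] with ξ hξ
    rw [mul_right_comm, hξ, mul_assoc, enorm_mul, enorm_mul, enorm_mul, ← ofReal_norm,
      Complex.norm_real, Real.norm_of_nonneg (by positivity), RCLike.enorm_conj]
  rw [h1, lintegral_const_mul' _ _ ENNReal.ofReal_ne_top]
  gcongr
  refine (lintegral_enorm_mul_le _ _).trans ?_
  rw [← ofReal_norm (dil r⁻¹ _), norm_dil (inv_pos.2 hr), ofReal_norm]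

/-- The Fubini hypothesis. Cauchy-Schwarz in `ξ` and boundedness of `A` leave `r^{d/2-1+s}` times
the decay of `ψ`, integrable on `(0, ∞)`. -/
lemma integrable_polarKernel (hd : 2 ≤ d) (hs : 1 / 2 < s) (hA : IsSynth s 1 A) (ψ : 𝓢(Eu d, ℂ))
    (h : Lp ℂ 2 (volume : Measure (Eu d))) :
    Integrable (fun q : ℝ × Eu d => ((q.1 ^ (d - 1) : ℝ) : ℂ) *
      (((‖q.2‖ ^ (-s) : ℝ) : ℂ) * h q.2 * polarKernel ψ q.1 q.2))
      ((volume.restrict (Set.Ioi (0 : ℝ))).prod volume) := by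
  have hm : AEStronglyMeasurable (fun q : ℝ × Eu d => ((q.1 ^ (d - 1) : ℝ) : ℂ) *
      (((‖q.2‖ ^ (-s) : ℝ) : ℂ) * h q.2 * polarKernel ψ q.1 q.2))
      ((volume.restrict (Set.Ioi (0 : ℝ))).prod volume) := by
    have h1 : Measurable fun q : ℝ × Eu d => ((q.1 ^ (d - 1) : ℝ) : ℂ) := by fun_prop
    have h2 : Measurable fun q : ℝ × Eu d => ((‖q.2‖ ^ (-s) : ℝ) : ℂ) := by fun_prop
    have h3 : Continuous fun q : ℝ × Eu d => polarKernel ψ q.1 q.2 :=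
      ((continuous_conjSliceL2 ψ).comp continuous_fst).inner
        (continuous_sphCharL2.comp (continuous_fst.smul continuous_snd))
    exact h1.aestronglyMeasurable.mul ((h2.aestronglyMeasurable.mul
      (Lp.aestronglyMeasurable h).comp_snd).mul h3.aestronglyMeasurable)
  refine ⟨hm, ?_⟩
  obtain ⟨N, hN⟩ := exists_nat_gt ((d : ℝ) / 2 - 1 + s + 1)
  obtain ⟨D, hD0, hD⟩ := exists_norm_schwartz_le ψ N
  have hb : ∀ r, 0 < r → ‖A (conjSliceL2 ψ r)‖ ≤ ‖A‖ * (sphConst d * (D * ((1 + r) ^ N)⁻¹)) := by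
    intro r hr
    refine (A.le_opNorm _).trans (mul_le_mul_of_nonneg_left ?_ (norm_nonneg _))
    refine norm_toLp_le (by positivity) fun ω => ?_
    rw [conjSlice_apply, RCLike.norm_conj]
    refine (hD _).trans_eq ?_
    rw [norm_smul, norm_coe_sph, mul_one, Real.norm_of_nonneg hr.le]
  have hint := (integrableOn_rpow_mul_inv_pow (a := (d : ℝ) / 2 - 1 + s) (N := N)
    (by linarith [Nat.cast_nonneg (α := ℝ) d]) hN).const_mul (‖A‖ * (sphConst d * D))
  have hsc := sphConst_nonneg (d := d)
  rw [HasFiniteIntegral, lintegral_prod _ hm.enorm]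
  refine lt_of_le_of_lt ?_ (ENNReal.mul_lt_top hint.lintegral_lt_top (enorm_lt_top (x := h)))
  rw [← lintegral_mul_const' _ _ enorm_ne_top]
  refine lintegral_mono_ae ?_
  filter_upwards [ae_restrict_mem measurableSet_Ioi] with r hr
  have hr : 0 < r := hr
  simp only [enorm_mul (((r ^ (d - 1) : ℝ) : ℂ))]
  rw [lintegral_const_mul' _ _ enorm_ne_top, ← ofReal_norm (((r ^ (d - 1) : ℝ) : ℂ)),
    Complex.norm_real, Real.norm_of_nonneg (by positivity)]
  calc _ ≤ ENNReal.ofReal (r ^ (d - 1)) * (ENNReal.ofReal (r ^ (s - (d : ℝ) / 2)) *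
        (ENNReal.ofReal (‖A‖ * (sphConst d * (D * ((1 + r) ^ N)⁻¹))) * ‖h‖ₑ)) := by
        gcongr
        refine (lintegral_weight_polarKernel_le hd hA ψ h hr).trans ?_
        gcongr
        rw [← ofReal_norm]
        exact ENNReal.ofReal_le_ofReal (hb r hr)
    _ = _ := by
      rw [← mul_assoc, ← mul_assoc, ← ENNReal.ofReal_mul (by positivity),
        ← ENNReal.ofReal_mul (by positivity)]
      congr 2
      have h2 : r ^ ((d : ℝ) / 2 - 1 + s) = r ^ (d - 1) * r ^ (s - (d : ℝ) / 2) := by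
        rw [← Real.rpow_natCast r (d - 1), ← Real.rpow_add hr, Nat.cast_sub (by omega)]
        push_cast
        ring_nf
      rw [h2]
      ring

/-- The function with Fourier transform `|ξ|^{-s} h`. -/
lemma exists_isFourier_weight (hd : 2 ≤ d) (hs : 1 / 2 < s) (hs' : s < (d : ℝ) / 2)
    (hA : IsSynth s 1 A) (h : Lp ℂ 2 (volume : Measure (Eu d))) :
    ∃ f : Eu d → ℂ, IsFourier f (fun ξ => ((‖ξ‖ ^ (-s) : ℝ) : ℂ) * h ξ) ∧
      ∀ᵐ r ∂(volume.restrict (Set.Ioi (0 : ℝ))), slice f r =ᵐ[surf d] radialTrace s A h r := by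
  have hπ := Real.pi_pos
  -- The product `|ξ|^{-s} h` need not be integrable, so `f` is not given by an inversion integral.
  -- It is assembled from its prospective slices, and the Fourier relation is checked against test
  -- functions.
  obtain ⟨f, hfm, hf⟩ := exists_slice_eq
    ((continuousOn_radialTrace s A h).aestronglyMeasurable measurableSet_Ioi)
  have htemp : IsTempered f := isTempered_of_slice hd hfm hf (a := s - (d : ℝ) / 2)
    (by linarith [Nat.cast_nonneg (α := ℝ) d]) fun r hr => norm_radialTrace_le hr h
  refine ⟨f, ⟨htemp, isTempered_weight hd hs' (Lp.memLp h), fun φ => ?_⟩, hf⟩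
  have hslice : ∀ᵐ r ∂(volume.restrict (Set.Ioi (0 : ℝ))),
      (((2 * Real.pi) ^ d : ℝ) : ℂ) * (((r ^ (d - 1) : ℝ) : ℂ) *
        ∫ ω : Sph d, f (r • (ω : Eu d)) * fourierS φ (r • (ω : Eu d)) ∂surf d) =
      ∫ ξ, ((r ^ (d - 1) : ℝ) : ℂ) *
        (((‖ξ‖ ^ (-s) : ℝ) : ℂ) * h ξ * polarKernel (fourierS φ) r ξ) := by
    filter_upwards [hf, ae_restrict_mem measurableSet_Ioi] with r hr hr0
    rw [integral_const_mul, integral_weight_polarKernel hd hA _ h hr0, mul_left_comm, L2.inner_def]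
    congr 2
    refine integral_congr_ae ?_
    filter_upwards [hr, coeFn_conjSliceL2 (fourierS φ) r] with ω h1 h2
    have h1 : f (r • (ω : Eu d)) = radialTrace s A h r ω := h1
    rw [h1, h2, RCLike.inner_apply, Complex.conj_conj]
  have hne : (((2 * Real.pi) ^ d : ℝ) : ℂ) ≠ 0 := by
    rw [Complex.ofReal_ne_zero]
    positivity
  rw [fourierInt_eq, integral_polar hd (htemp (fourierS φ))]
  refine mul_left_cancel₀ hne ?_
  -- After exchanging the integrals, the inner integral over `r` is Fourier inversion for `φ` in
  -- polar coordinates. It returns the factor `(2π)^d` introduced above.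
  rw [← integral_const_mul (_ : ℂ) (fun r : ℝ => _), integral_congr_ae hslice,
    integral_integral_swap (integrable_polarKernel hd hs hA (fourierS φ) h), ← integral_const_mul]
  refine integral_congr_ae (Eventually.of_forall fun ξ => ?_)
  have h3 : ∀ r : ℝ, ((r ^ (d - 1) : ℝ) : ℂ) * (((‖ξ‖ ^ (-s) : ℝ) : ℂ) * h ξ *
      polarKernel (fourierS φ) r ξ) = ((‖ξ‖ ^ (-s) : ℝ) : ℂ) * h ξ *
      (((r ^ (d - 1) : ℝ) : ℂ) * polarKernel (fourierS φ) r ξ) := fun r => by ring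
  simp only [h3]
  rw [integral_const_mul, integral_polarKernel hd]
  ring

end

/-! ### Sobolev functions described by their weighted Fourier transforms. -/

section
variable {d : ℕ} {s : ℝ} {θ : ℝ → ℂ} {B A : L2S d →L[ℂ] Lp ℂ 2 (volume : Measure (Eu d))}

lemma ae_ne_zero (hd : 2 ≤ d) : ∀ᵐ ξ : Eu d, ξ ≠ 0 := by
  have := nontrivial_eu hd
  exact compl_mem_ae_iff.2 (measure_singleton (0 : Eu d))

lemma weight_mul_cancel {ξ : Eu d} (hξ : ξ ≠ 0) (s : ℝ) :
    ((‖ξ‖ ^ s : ℝ) : ℂ) * ((‖ξ‖ ^ (-s) : ℝ) : ℂ) = 1 := by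
  rw [← Complex.ofReal_mul, ← Real.rpow_add (norm_pos_iff.2 hξ), add_neg_cancel, Real.rpow_zero,
    Complex.ofReal_one]

lemma MemHdot.exists_weight (hd : 2 ≤ d) {f : Eu d → ℂ} (hf : MemHdot s f) :
    ∃ h : Lp ℂ 2 (volume : Measure (Eu d)),
      IsFourier f fun ξ => ((‖ξ‖ ^ (-s) : ℝ) : ℂ) * h ξ := by
  obtain ⟨⟨F, hF⟩, hm⟩ := hf
  refine ⟨hm.toLp, hF.congr EventuallyEq.rfl ?_⟩
  filter_upwards [hm.coeFn_toLp, ae_ne_zero hd, hF.fourierT_ae_eq] with ξ h1 h2 h3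
  rw [h1, ← mul_assoc, mul_comm ((‖ξ‖ ^ (-s) : ℝ) : ℂ), weight_mul_cancel h2, one_mul, h3]

lemma weight_fourierT (hd : 2 ≤ d) {f : Eu d → ℂ} {h : Lp ℂ 2 (volume : Measure (Eu d))}
    (hf : IsFourier f fun ξ => ((‖ξ‖ ^ (-s) : ℝ) : ℂ) * h ξ) :
    (fun ξ => ((‖ξ‖ ^ s : ℝ) : ℂ) * fourierT f ξ) =ᵐ[volume] h := by
  filter_upwards [ae_ne_zero hd, hf.fourierT_ae_eq] with ξ h2 h3
  rw [h3, ← mul_assoc, weight_mul_cancel h2, one_mul]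

lemma memHdot_of_weight (hd : 2 ≤ d) {f : Eu d → ℂ} {h : Lp ℂ 2 (volume : Measure (Eu d))}
    (hf : IsFourier f fun ξ => ((‖ξ‖ ^ (-s) : ℝ) : ℂ) * h ξ) : MemHdot s f :=
  ⟨⟨_, hf⟩, (memLp_congr_ae (weight_fourierT hd hf)).2 (Lp.memLp h)⟩

lemma hdotNormSq_eq (hd : 2 ≤ d) {f : Eu d → ℂ} {h : Lp ℂ 2 (volume : Measure (Eu d))}
    (hf : IsFourier f fun ξ => ((‖ξ‖ ^ (-s) : ℝ) : ℂ) * h ξ) :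
    hdotNormSq s f = ((2 * Real.pi) ^ d)⁻¹ * ‖h‖ ^ 2 := by
  rw [hdotNormSq]
  congr 1
  have h1 : ((‖h‖ ^ 2 : ℝ) : ℂ) = ((∫ ξ, ‖h ξ‖ ^ 2 : ℝ) : ℂ) := by
    have := inner_self_eq_norm_sq_to_K (𝕜 := ℂ) h
    rw [L2.inner_def] at this
    rw [← integral_complex_ofReal]
    push_cast
    refine this.symm.trans (integral_congr_ae (Eventually.of_forall fun ξ => ?_))
    exact inner_self_eq_norm_sq_to_K (𝕜 := ℂ) (h ξ)
  rw [Complex.ofReal_inj.1 h1]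
  refine integral_congr_ae ?_
  filter_upwards [weight_fourierT hd hf] with ξ hξ
  rw [← hξ, norm_mul, mul_pow, Complex.norm_real, Real.norm_of_nonneg (by positivity),
    ← Real.rpow_mul_natCast (norm_nonneg _)]
  congr 2
  push_cast
  ring

/-! ### Traces -/

/-- A neighbourhood of `1` has positive measure and so meets every conull set. Uniqueness of traces
rests on this. -/
lemma neBot_nhds_inf_ae : (𝓝 (1 : ℝ) ⊓ ae volume).NeBot := by
  rw [Filter.inf_neBot_iff]
  intro U hU V hV
  by_contra hne
  rw [Set.not_nonempty_iff_eq_empty, ← Set.disjoint_iff_inter_eq_empty] at hne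
  have h1 : volume U ≤ volume Vᶜ := measure_mono hne.subset_compl_right
  rw [mem_ae_iff.1 hV] at h1
  exact (Measure.measure_pos_of_mem_nhds volume hU).not_ge h1

/-- Off a null set of radii the slices follow the curve `u`, so continuity at `1` determines the
limit. -/
lemma isTrace_iff {F : Eu d → ℂ} {u : ℝ → L2S d}
    (hF : ∀ᵐ r ∂(volume.restrict (Set.Ioi (0 : ℝ))), slice F r =ᵐ[surf d] u r)
    (hu : ContinuousAt u 1) (k : L2S d) : IsTrace F k ↔ k = u 1 := by
  have h1 : (fun r : ℝ => eLpNorm (fun ω => slice F r ω - k ω) 2 (surf d)) =ᶠ[𝓝 1 ⊓ ae volume]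
      fun r => ‖u r - k‖ₑ := by
    rw [ae_restrict_iff' measurableSet_Ioi] at hF
    filter_upwards [mem_inf_of_left (Ioi_mem_nhds (zero_lt_one' ℝ)),
      mem_inf_of_right (f := 𝓝 (1 : ℝ)) hF] with r hr0 hr
    rw [Lp.enorm_def]
    refine eLpNorm_congr_ae ?_
    filter_upwards [hr hr0, Lp.coeFn_sub (u r) k] with ω h2 h3
    rw [h3, Pi.sub_apply, h2]
  have h2 : Tendsto (fun r => ‖u r - k‖ₑ) (𝓝 1 ⊓ ae volume) (𝓝 ‖u 1 - k‖ₑ) :=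
    (hu.tendsto.mono_left inf_le_left).sub_const k |>.enorm
  have := neBot_nhds_inf_ae
  rw [IsTrace, tendsto_congr' h1]
  constructor
  · intro h3
    have := tendsto_nhds_unique h2 h3
    rw [enorm_eq_zero, sub_eq_zero] at this
    exact this.symm
  · rintro rfl
    simpa using h2

/-- The slices of `f` are `radialTrace s A h r`, and `(conj θ)(-Λ)` sends them to `radialTrace s B h
r`, a curve continuous in `r`. Its value at `r = 1` is the trace. Any other version of `(conj θ)(-Λ)
f` has the same slices at almost every radius. -/
lemma isTraceTheta_iff (hd : 2 ≤ d) (hs : 1 / 2 < s) (hs' : s < (d : ℝ) / 2)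
    (hB : IsSynth s θ B) (hA : IsSynth s 1 A) {f : Eu d → ℂ}
    {h : Lp ℂ 2 (volume : Measure (Eu d))}
    (hf : IsFourier f fun ξ => ((‖ξ‖ ^ (-s) : ℝ) : ℂ) * h ξ) (k : L2S d) :
    IsTraceTheta θ f k ↔ k = ((((2 * Real.pi) ^ d)⁻¹ : ℝ) : ℂ) • B.adjoint h := by
  have hslice : ∀ᵐ r ∂(volume.restrict (Set.Ioi (0 : ℝ))),
      slice f r =ᵐ[surf d] radialTrace s A h r := by
    obtain ⟨f', hf', hr⟩ := exists_isFourier_weight hd hs hs' hA h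
    filter_upwards [hr, ae_slice hd (p := fun x => f x = f' x) (hf.ae_eq_left hf')] with r h1 h2
    exact EventuallyEq.trans h2 h1
  have hc := continuousOn_radialTrace s B h
  obtain ⟨F₀, hF₀m, hF₀⟩ := exists_slice_eq (hc.aestronglyMeasurable measurableSet_Ioi)
  have hθ₀ : IsTheta (fun t => starRingEnd ℂ (θ t)) f F₀ := by
    refine (isTheta_iff hslice).2 ⟨hF₀m, ?_⟩
    filter_upwards [hF₀] with r hr
    exact ⟨_, hr, isThetaSphere_radialTrace hd hB hA h r⟩
  have hc1 : ContinuousAt (radialTrace s B h) 1 := hc.continuousAt (Ioi_mem_nhds one_pos)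
  rw [← radialTrace_one s]
  constructor
  · rintro ⟨F, hF, hk⟩
    refine (isTrace_iff ?_ hc1 k).1 hk
    filter_upwards [hF.slice_ae_eq hθ₀, hF₀] with r h1 h2
    exact h1.trans h2
  · intro hk
    exact ⟨F₀, hθ₀, (isTrace_iff hF₀ hc1 k).2 hk⟩

lemma exists_isSThetaStar_iff (hd : 2 ≤ d) (hs : 1 / 2 < s) (hs' : s < (d : ℝ) / 2)
    (hθ : BddAbove (Set.range (lam d s θ))) (hB : IsSynth s θ B) (G : L2S d) (f : Eu d → ℂ) :
    (∃ g : Eu d → ℂ, IsSThetaStar s θ G g ∧ IsDNeg s g f) ↔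
      IsFourier f fun ξ => ((‖ξ‖ ^ (-s) : ℝ) : ℂ) * B G ξ := by
  constructor
  · rintro ⟨g, ⟨-, Φ, hΦ, hg⟩, G', hG', hf⟩
    exact hf.congr EventuallyEq.rfl
      (EventuallyEq.rfl.mul ((hG'.ae_eq_right hg).trans (hB.1 G Φ hΦ)))
  · intro hf
    obtain ⟨Φ, hΦ⟩ := exists_isTheta_extension hd hs hs' hθ G
    obtain ⟨g, hgm, hg⟩ := exists_isFourier_of_memLp (Lp.memLp (B G))
    exact ⟨g, ⟨hgm, Φ, hΦ, hg.congr EventuallyEq.rfl (hB.1 G Φ hΦ).symm⟩, B G, hg, hf⟩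

/-! ### The equality case -/

/-- Expanding, `‖B B* h - M h‖² = ‖B B* h‖² - 2M ‖B* h‖² + M² ‖h‖²`, and the hypotheses bound this
by `(M² - 2M² + M²) ‖h‖² = 0`. -/
lemma apply_adjoint_eq_smul {E F : Type*} [NormedAddCommGroup E] [InnerProductSpace ℂ E]
    [CompleteSpace E] [NormedAddCommGroup F] [InnerProductSpace ℂ F] [CompleteSpace F]
    {B : E →L[ℂ] F} {M : ℝ} (hM : 0 ≤ M) {h : F}
    (hle : ‖B (B.adjoint h)‖ ^ 2 ≤ M * (M * ‖h‖ ^ 2)) (hh : ‖B.adjoint h‖ ^ 2 = M * ‖h‖ ^ 2) :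
    B (B.adjoint h) = (M : ℂ) • h := by
  have h3 : inner ℂ (B (B.adjoint h)) ((M : ℂ) • h) = ((M * ‖B.adjoint h‖ ^ 2 : ℝ) : ℂ) := by
    rw [inner_smul_right, ← ContinuousLinearMap.adjoint_inner_right B (B.adjoint h) h,
      inner_self_eq_norm_sq_to_K, Complex.ofReal_mul, Complex.ofReal_pow]
    rfl
  have h2 := norm_sub_sq (𝕜 := ℂ) (B (B.adjoint h)) ((M : ℂ) • h)
  rw [h3, RCLike.re_to_complex, Complex.ofReal_re, norm_smul, Complex.norm_real,
    Real.norm_of_nonneg hM, mul_pow, hh] at h2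
  have h4 : ‖B (B.adjoint h) - (M : ℂ) • h‖ ^ 2 ≤ 0 := by linear_combination h2 + hle
  have h5 := pow_eq_zero_iff (two_ne_zero) |>.1 (le_antisymm h4 (by positivity))
  exact sub_eq_zero.1 (norm_eq_zero.1 h5)

namespace IsSynth

lemma adjoint_apply_of_mem (hd : 2 ≤ d) (hB : IsSynth s θ B) {k : ℕ} {x : L2S d}
    (hx : x ∈ sphHarm d k) :
    B.adjoint (B x) = (((2 * Real.pi) ^ d * lam d s θ k : ℝ) : ℂ) • x := by
  have h1 := hasSum_projH hd (B.adjoint (B x))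
  simp only [hB.projH_adjoint_self hd] at h1
  refine h1.unique ?_
  have := hasSum_single (f := fun j => (((2 * Real.pi) ^ d * lam d s θ j : ℝ) : ℂ) •
    projH d j x) k fun j hj => by rw [projH_of_mem_ne hd hj.symm hx, smul_zero]
  simpa only [projH_of_mem hx] using this

/-- On every summand the eigenvalue of `B* B` is the maximal one, and an eigenspace of a bounded
operator is closed, so it contains the closed sum. -/
lemma adjoint_apply_of_mem_sumHarm (hd : 2 ≤ d) (hB : IsSynth s θ B) {G : L2S d}
    (hG : G ∈ sumHarm d (argSup d s θ)) :
    B.adjoint (B G) = (((2 * Real.pi) ^ d * ⨆ k, lam d s θ k : ℝ) : ℂ) • G := by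
  let T : L2S d →L[ℂ] L2S d := B.adjoint ∘L B -
    (((2 * Real.pi) ^ d * ⨆ k, lam d s θ k : ℝ) : ℂ) • ContinuousLinearMap.id ℂ (L2S d)
  have h1 : sumHarm d (argSup d s θ) ≤ LinearMap.ker T.toLinearMap := by
    refine Submodule.topologicalClosure_minimal _ (iSup₂_le fun k hk x hx => ?_) T.isClosed_ker
    have hk : lam d s θ k = ⨆ l, lam d s θ l := hk
    rw [LinearMap.mem_ker]
    change B.adjoint (B x) - (((2 * Real.pi) ^ d * ⨆ k, lam d s θ k : ℝ) : ℂ) • x = 0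
    rw [hB.adjoint_apply_of_mem hd hx, hk, sub_self]
  exact sub_eq_zero.1 (LinearMap.mem_ker.1 (h1 hG))

lemma norm_adjoint_sq_of_mem_sumHarm (hd : 2 ≤ d) (hB : IsSynth s θ B) {G : L2S d}
    (hG : G ∈ sumHarm d (argSup d s θ)) :
    ‖B.adjoint (B G)‖ ^ 2 = (2 * Real.pi) ^ d * (⨆ k, lam d s θ k) * ‖B G‖ ^ 2 := by
  have h1 := hB.adjoint_apply_of_mem_sumHarm hd hG
  have h2 : ((‖B G‖ ^ 2 : ℝ) : ℂ) =
      (((2 * Real.pi) ^ d * (⨆ k, lam d s θ k) * ‖G‖ ^ 2 : ℝ) : ℂ) := by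
    have h3 := inner_self_eq_norm_sq_to_K (𝕜 := ℂ) (B G)
    rw [← ContinuousLinearMap.adjoint_inner_right, h1, inner_smul_right,
      inner_self_eq_norm_sq_to_K] at h3
    push_cast at h3 ⊢
    exact h3.symm
  rw [Complex.ofReal_inj.1 h2, h1, norm_smul, Complex.norm_real, mul_pow, Real.norm_eq_abs, sq_abs]
  ring

/-- From `B B* h = M h` follows `B* B (B* h) = M B* h`. Comparing components of degree `k`, either
`H_k B* h = 0` or `λ_k(θ)` is the supremum. The preimage is `M⁻¹ B* h`, whence the need for a
positive supremum. -/
lemma exists_of_norm_adjoint_sq_eq (hd : 2 ≤ d) (hB : IsSynth s θ B) (hs : 1 / 2 < s)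
    (hs' : s < (d : ℝ) / 2) (hθ : BddAbove (Set.range (lam d s θ)))
    (hM : 0 < ⨆ k, lam d s θ k) {h : Lp ℂ 2 (volume : Measure (Eu d))}
    (hh : ‖B.adjoint h‖ ^ 2 = (2 * Real.pi) ^ d * (⨆ k, lam d s θ k) * ‖h‖ ^ 2) :
    ∃ G ∈ sumHarm d (argSup d s θ), B G = h := by
  have hπ := Real.pi_pos
  have hle := hB.norm_sq_le hd hs hs' hθ (B.adjoint h)
  set M : ℝ := (2 * Real.pi) ^ d * ⨆ k, lam d s θ k with hMdef
  have hM0 : 0 < M := by positivity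
  have hMc : (M : ℂ) ≠ 0 := Complex.ofReal_ne_zero.2 hM0.ne'
  have h1 : B (B.adjoint h) = (M : ℂ) • h :=
    apply_adjoint_eq_smul hM0.le (hle.trans_eq (by rw [hh])) hh
  refine ⟨(M : ℂ)⁻¹ • B.adjoint h, ?_, ?_⟩
  · have hk : ∀ k, k ∉ argSup d s θ → projH d k (B.adjoint h) = 0 := fun k hk => by
      have h2 := hB.projH_adjoint_self hd k (B.adjoint h)
      rw [h1, B.adjoint.map_smul, (projH d k).map_smul] at h2
      by_contra hne
      have h3 := Complex.ofReal_inj.1 (smul_left_injective ℂ hne h2)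
      exact hk (mul_left_cancel₀ (by positivity) h3).symm
    refine Submodule.smul_mem _ _ ?_
    have hcl : IsClosed (sumHarm d (argSup d s θ) : Set (L2S d)) :=
      Submodule.isClosed_topologicalClosure _
    refine hcl.mem_of_tendsto (hasSum_projH hd (B.adjoint h))
      (Eventually.of_forall fun S => Submodule.sum_mem _ fun k _ => ?_)
    by_cases hkm : k ∈ argSup d s θ
    · exact Submodule.le_topologicalClosure _
        (Submodule.mem_iSup_of_mem k (Submodule.mem_iSup_of_mem hkm (projH_mem k _)))
    · rw [hk k hkm]
      exact Submodule.zero_mem _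
  · rw [map_smul, h1, smul_smul, inv_mul_cancel₀ hMc, one_smul]

lemma adjoint_apply_one_of_mem (hd : 2 ≤ d) (hB : IsSynth s θ B) (hA : IsSynth s 1 A) {k : ℕ}
    {x : L2S d} (hx : x ∈ sphHarm d k) : B.adjoint (A x) =
      (starRingEnd ℂ (θ (lbEigen d k)) * (((2 * Real.pi) ^ d * lam d s 1 k : ℝ) : ℂ)) • x := by
  have h1 : HasSum _ _ := hB.isThetaSphere_adjoint hd hA (A x)
  simp only [hA.projH_adjoint_self hd, smul_smul] at h1
  refine h1.unique ?_
  have := hasSum_single (f := fun j => (starRingEnd ℂ (θ (lbEigen d j)) *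
    (((2 * Real.pi) ^ d * lam d s 1 j : ℝ) : ℂ)) • projH d j x) k fun j hj => by
      rw [projH_of_mem_ne hd hj.symm hx, smul_zero]
  simpa only [projH_of_mem hx] using this

end IsSynth

lemma exists_ne_zero_mem_sphHarm (hd : 2 ≤ d) (k : ℕ) : ∃ x ∈ sphHarm d k, x ≠ 0 := by
  obtain ⟨p, hp, η, hη⟩ := exists_harmonicPoly_eval_ne_zero hd k
  refine ⟨polyL2 d p, polyL2_mem_sphHarm hp, fun h0 => hη ?_⟩
  have := surf_isOpenPosMeasure hd
  have h1 : (fun ω : Sph d => evalEu p ω) =ᵐ[surf d] fun _ => 0 := by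
    filter_upwards [coeFn_polyL2 p, Lp.coeFn_zero ℂ 2 (surf d)] with ω h2 h3
    rw [← h2, h0, h3, Pi.zero_apply]
  have h2 := (Continuous.ae_eq_iff_eq (surf d)
    ((continuous_evalEu p).comp continuous_subtype_val) continuous_const).1 h1
  exact congrFun h2 η

/-- Test with `h = A x` for a nonzero `x` in `ℋ_k`: the trace is `conj θ(k(k+d-2)) λ_k(1) x` and the
ratio of the squared norms is `λ_k(θ)`. Using `A` rather than `B` keeps the test function nonzero
when `θ` vanishes at that eigenvalue, so that `0 ≤ C` is obtained as well. -/
lemma lam_le_of_trace_le (hd : 2 ≤ d) (hs : 1 / 2 < s) (hs' : s < (d : ℝ) / 2)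
    (hB : IsSynth s θ B) (hA : IsSynth s 1 A) {C : ℝ}
    (hC : ∀ (f : Eu d → ℂ) (h : L2S d), MemHdot s f → IsTraceTheta θ f h →
      ‖h‖ ^ 2 ≤ C * hdotNormSq s f) (k : ℕ) : lam d s θ k ≤ C := by
  have hπ := Real.pi_pos
  obtain ⟨x, hx, hx0⟩ := exists_ne_zero_mem_sphHarm hd k
  obtain ⟨f, hf, -⟩ := exists_isFourier_weight hd hs hs' hA (A x)
  have h1 := hC f _ (memHdot_of_weight hd hf) ((isTraceTheta_iff hd hs hs' hB hA hf _).2 rfl)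
  have hl := lam_one_pos hd hs hs' k
  have h2 : ‖A x‖ ^ 2 = (2 * Real.pi) ^ d * lam d s 1 k * ‖x‖ ^ 2 := by
    have h3 := hA.inner_of_mem hd hx x
    rw [projH_of_mem hx, inner_self_eq_norm_sq_to_K, inner_self_eq_norm_sq_to_K] at h3
    refine Complex.ofReal_inj.1 ?_
    push_cast at h3 ⊢
    exact h3
  have hx1 : 0 < ‖x‖ ^ 2 := by positivity
  have hP : 0 < (2 * Real.pi) ^ d := by positivity
  rw [hdotNormSq_eq hd hf, hB.adjoint_apply_one_of_mem hd hA hx, smul_smul, norm_smul, norm_mul,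
    norm_mul, Complex.norm_real, Complex.norm_real, RCLike.norm_conj,
    Real.norm_of_nonneg (by positivity), Real.norm_of_nonneg (by positivity), h2] at h1
  rw [lam_eq]
  have h4 : (((2 * Real.pi) ^ d)⁻¹ * (‖θ (lbEigen d k)‖ * ((2 * Real.pi) ^ d * lam d s 1 k)) *
      ‖x‖) ^ 2 = lam d s 1 k * ‖θ (lbEigen d k)‖ ^ 2 * (lam d s 1 k * ‖x‖ ^ 2) := by
    field_simp
  have h5 : C * (((2 * Real.pi) ^ d)⁻¹ * ((2 * Real.pi) ^ d * lam d s 1 k * ‖x‖ ^ 2)) =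
      C * (lam d s 1 k * ‖x‖ ^ 2) := by
    field_simp
  rw [h4, h5] at h1
  exact le_of_mul_le_mul_right h1 (by positivity)

lemma iSup_lam_pos (hd : 2 ≤ d) (hs : 1 / 2 < s) (hs' : s < (d : ℝ) / 2)
    (hθ : BddAbove (Set.range (lam d s θ))) (h : ∃ k : ℕ, θ (lbEigen d k) ≠ 0) :
    0 < ⨆ k, lam d s θ k := by
  obtain ⟨k, hk⟩ := h
  refine lt_of_lt_of_le ?_ (le_ciSup hθ k)
  rw [lam_eq]
  have := lam_one_pos hd hs hs' k
  have := norm_pos_iff.2 hk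
  positivity

lemma norm_trace_sq_eq_iff (x M : ℝ) (y : L2S d) :
    ‖((((2 * Real.pi) ^ d)⁻¹ : ℝ) : ℂ) • y‖ ^ 2 = M * (((2 * Real.pi) ^ d)⁻¹ * x) ↔
      ‖y‖ ^ 2 = (2 * Real.pi) ^ d * M * x := by
  have hπ := Real.pi_pos
  rw [norm_smul, Complex.norm_real, Real.norm_of_nonneg (by positivity), mul_pow]
  constructor
  · intro h
    field_simp at h
    linarith
  · intro h
    rw [h]
    field_simp

end

end

end SphereTrace

/-! ### The sharp trace theorem. -/

theorem corollary5 (d : ℕ) (hd : 2 ≤ d) (s : ℝ) (hs : 1 / 2 < s) (hs' : s < (d : ℝ) / 2)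
    (θ : ℝ → ℂ) (hθ : BddAbove (Set.range (SphereTrace.lam d s θ))) :
    -- the operator `ℛ (conj θ)(-Λ)` is well defined on the homogeneous Sobolev space
    (∀ f : SphereTrace.Eu d → ℂ, SphereTrace.MemHdot s f →
      ∃! h : SphereTrace.L2S d, SphereTrace.IsTraceTheta θ f h) ∧
    -- the estimate
    (∀ (f : SphereTrace.Eu d → ℂ) (h : SphereTrace.L2S d),
      SphereTrace.MemHdot s f → SphereTrace.IsTraceTheta θ f h →
        ‖h‖ ^ 2 ≤ (⨆ k, SphereTrace.lam d s θ k) * SphereTrace.hdotNormSq s f) ∧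
    -- the constant is optimal
    (∀ C : ℝ,
      (∀ (f : SphereTrace.Eu d → ℂ) (h : SphereTrace.L2S d),
        SphereTrace.MemHdot s f → SphereTrace.IsTraceTheta θ f h →
          ‖h‖ ^ 2 ≤ C * SphereTrace.hdotNormSq s f) →
      (⨆ k, SphereTrace.lam d s θ k) ≤ C) ∧
    -- the operator `D^{-s} S_θ^*` is defined on the whole of `L²` of the sphere
    (∀ G : SphereTrace.L2S d, ∃ g f : SphereTrace.Eu d → ℂ,
      SphereTrace.IsSThetaStar s θ G g ∧ SphereTrace.IsDNeg s g f) ∧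
    -- the extremisers
    ((∃ k : ℕ, θ (SphereTrace.lbEigen d k) ≠ 0) →
      ∀ f : SphereTrace.Eu d → ℂ, SphereTrace.IsExtremiser s θ f ↔
        (¬ f =ᵐ[volume] 0 ∧
          ∃ G ∈ SphereTrace.sumHarm d (SphereTrace.argSup d s θ), ∃ g : SphereTrace.Eu d → ℂ,
            SphereTrace.IsSThetaStar s θ G g ∧ SphereTrace.IsDNeg s g f)) := by
  obtain ⟨B, hB⟩ := SphereTrace.exists_isSynth hd hs hs' hθ
  -- The operator for `θ = 1` describes the slices of `f` itself, before `(conj θ)(-Λ)` is applied.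
  obtain ⟨A, hA⟩ := SphereTrace.exists_isSynth hd hs hs' (SphereTrace.bddAbove_lam_one hd hs hs')
  have htr := fun f h hf => SphereTrace.isTraceTheta_iff (f := f) (h := h) hd hs hs' hB hA hf
  refine ⟨fun f hf => ?_, fun f k hf hk => ?_, fun C hC => ?_, fun G => ?_, fun hne f => ?_⟩
  · obtain ⟨h, hh⟩ := hf.exists_weight hd
    exact ⟨_, (htr f h hh _).2 rfl, fun k hk => (htr f h hh k).1 hk⟩
  · obtain ⟨h, hh⟩ := hf.exists_weight hd
    rw [(htr f h hh k).1 hk, SphereTrace.hdotNormSq_eq hd hh, norm_smul, Complex.norm_real,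
      Real.norm_of_nonneg (by positivity), mul_pow]
    have h1 := hB.norm_adjoint_sq_le hd hs hs' hθ h
    calc _ ≤ (((2 * Real.pi) ^ d)⁻¹) ^ 2 *
          ((2 * Real.pi) ^ d * (⨆ k, SphereTrace.lam d s θ k) * ‖h‖ ^ 2) := by gcongr
      _ = _ := by
        have := Real.pi_pos
        field_simp
  · exact ciSup_le fun k => SphereTrace.lam_le_of_trace_le hd hs hs' hB hA hC k
  · obtain ⟨f, hf, -⟩ := SphereTrace.exists_isFourier_weight hd hs hs' hA (B G)
    obtain ⟨g, hg, hgf⟩ := (SphereTrace.exists_isSThetaStar_iff hd hs hs' hθ hB G f).2 hf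
    exact ⟨g, f, hg, hgf⟩
  -- Membership in the range of `D^{-s} S_θ^*` now means that the weighted transform `h` of `f` is
  -- `B G`, so the claim concerns only the equality case for `B*`.
  · simp only [SphereTrace.exists_isSThetaStar_iff hd hs hs' hθ hB]
    constructor
    · rintro ⟨hf, hf0, k, hk, hkn⟩
      obtain ⟨h, hh⟩ := hf.exists_weight hd
      rw [(htr f h hh k).1 hk, SphereTrace.hdotNormSq_eq hd hh,
        SphereTrace.norm_trace_sq_eq_iff] at hkn
      obtain ⟨G, hG, rfl⟩ := hB.exists_of_norm_adjoint_sq_eq hd hs hs' hθ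
        (SphereTrace.iSup_lam_pos hd hs hs' hθ hne) hkn
      exact ⟨hf0, G, hG, hh⟩
    · rintro ⟨hf0, G, hG, hf⟩
      refine ⟨SphereTrace.memHdot_of_weight hd hf, hf0, _, (htr f _ hf _).2 rfl, ?_⟩
      rw [SphereTrace.hdotNormSq_eq hd hf, SphereTrace.norm_trace_sq_eq_iff]
      exact hB.norm_adjoint_sq_of_mem_sumHarm hd hG
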